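/- **Setting.** An episodic two-player zero-sum Markov game has horizon $H$, a measurable state space $\mathcal X$, finite nonempty action sets $\mathcal A,\mathcal B$, transition kernels $\mathbb P_h(\cdot\mid x,a,b)$, deterministic measurable rewards $r^h(x,a,b)\in[0,1]$ and a fixed initial state $x^1$. For Markov policies $\mu,\nu$ of the max- and min-player, $V_h^{\mu,\nu}$ and $Q_h^{\mu,\nu}$ are the expected total reward from step $h$ on, given $x^h$, respectively $(x^h,a^h,b^h)$. Let $(\mu^*,\nu^*)$ be a Nash equilibrium, $V^*=V^{\mu^*,\nu^*}$, $Q^*=Q^{\mu^*,\nu^*}$. Let $\mathcal F=\mathcal F_1\times\dots\times\mathcal F_H$, where $\mathcal F_h$ is a set of functions $\mathcal X\times\mathcal A\times\mathcal B\to\mathbb R$ with a $\sigma$-algebra making evaluation jointly measurable, and let $p_0^h$ be a probability measure on $\mathcal F_h$. For $f,g\in\mathcal F$ and a policy $\mu$ put $V_{f,h}(x)=\max_{p\in\Delta_{\mathcal A}}\min_{q\in\Delta_{\mathcal B}}p^\top f^h(x,\cdot,\cdot)q$ and $V^\mu_{g,h}(x)=\min_{q}\mu_h(x)^\top g^h(x,\cdot,\cdot)q$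 (both $0$ for $h=H+1$), $\mathcal T_hf=r^h+\mathbb P_hV_{f,h+1}$, $\mathcal T_h^\mu g=r^h+\mathbb P_hV^\mu_{g,h+1}$, $\mathcal E_h(f)=f^h-\mathcal T_hf$, $\mathcal E^\mu_h(g)=g^h-\mathcal T^\mu_hg$. Let $\mu_{f,h}(x)\in\operatorname{argmax}_p\min_q p^\top f^h(x,\cdot,\cdot)q$ and $\nu_{f,g,h}(x)\in\operatorname{argmin}_q\mu_{f,h}(x)^\top g^h(x,\cdot,\cdot)q$ be chosen measurably. **Algorithm.** Given $\eta,\lambda$ and the history $S_{t-1}$ of trajectories $(x_s^h,a_s^h,b_s^h)_{h\le H}$, $s<t$, draw $f_t\sim p_t$ with $$p_t(df)\propto e^{\lambda V_{f,1}(x^1)}\prod_{h=1}^H\frac{e^{-\eta L^h(f^h,f^{h+1})}\,p_0^h(df^h)}{\mathbb E_{u\sim p_0^h}e^{-\eta L^h(u,f^{h+1})}},\qquad L^h(u,f^{h+1})=\sum_{s<t}\bigl(u(x_s^h,a_s^h,b_s^h)-r_s^h-V_{f,h+1}(x_s^{h+1})\bigr)^2,$$ set $\mu_t=\mu_{f_t}$,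 draw $g_t\sim p_t^{\mu_t}$, where $p_t^{\mu}$ is defined in the same way with $e^{-\lambda V^\mu_{g,1}(x^1)}$ in place of $e^{\lambda V_{f,1}(x^1)}$ and $V^\mu_{g,h+1}$ in place of $V_{f,h+1}$, set $\nu_t=\nu_{f_t,g_t}$, and play $(\mu_t,\nu_t)$ for one episode to obtain $S_t$. **Complexities.** Let $\kappa(\varepsilon)=\sup_{f,g\in\mathcal F}\sum_{h=1}^H\ln\bigl(1/p_0^h\{u\in\mathcal F_h:\sup|u-\mathcal T_h^{\mu_f}g|\le\varepsilon\}\bigr)$. For $m>0$ let $dc(\mathcal F,MG,T,m)$ be the smallest integer $K$ such that for all $f_1,g_1,\dots,f_T,g_T\in\mathcal F$, with $\pi_t=(\mu_{f_t},\nu_{f_t,g_t})$, $$\sum_{h=1}^H\sum_{t=1}^T\mathbb E_{\pi_t}[e_{t,h}(x^h,a^h,b^h)]\le m\sum_{h=1}^H\sum_{t=1}^T\sum_{s=1}^{t-1}\mathbb E_{\pi_s}[e_{t,h}(x^h,a^h,b^h)^2]+\frac K{4m}$$ holds both for $e_{t,h}=\mathcal E_h^{\mu_{f_t}}(g_t)$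 and for $e_{t,h}=\mathcal E_h(f_t)$. **Theorem 2 (bound of the main agent).** There are a universal constant $C$ and constants $C_{H,\beta}$ depending only on $H$ and $\beta$ such that the following holds. Assume realizability ($Q^*_h\in\mathcal F_h$, and $Q_h^{\mu_f,\nu^\dagger}\in\mathcal F_h$ for every $f\in\mathcal F$ and every best response $\nu^\dagger$ to $\mu_f$, for all $h$), completeness ($\mathcal T_h^{\mu_f}g\in\mathcal F_h$ for all $f,g\in\mathcal F$ and all $h$) and boundedness ($f^h(x,a,b)\in[0,\beta-1]$ for all $f\in\mathcal F$, $h$, $x,a,b$, where $\beta>1$). Let $T\ge1$, $\kappa:=\kappa(\beta/T^2)<\infty$, let $D=dc(\mathcal F,MG,T)\ge1$ be a real upper bound of $dc(\mathcal F,MG,T,m)$ over $0<m\le1$, and let $\eta=\frac1{4\beta^2}$ (so $\eta\beta^2\le0.5$) and $\lambda=\sqrt{\frac{T\kappa}{\beta^2D}}$, where $\lambda\beta^2\ge1$. Then $$\sum_{t=1}^T\mathbb E_{S_{t-1}}\mathbb E_{f_t\sim p_t}\mathbb E_{g_t\sim p_t^{\mu_t}}\bigl[V_1^*(x^1)-V_1^{\mu_t,\nu_t}(x^1)\bigr]\le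 C_{H,\beta}\Bigl(\beta\sqrt{D\,\kappa(\beta/T^2)\,T}+D\Bigr),$$ and if moreover $H\le T\,\kappa(\beta/T^2)$, then the same bound holds with the universal constant $C$ in place of $C_{H,\beta}$. -/

import Mathlib

open MeasureTheory ProbabilityTheory
open scoped ENNReal

noncomputable section

namespace SelfPlay

/-! ### Matrix games -/

section MatrixGame

variable {A B : Type*} [Fintype A] [Fintype B]

/-- The bilinear payoff `pᵀ M q`. -/
def payoff (p : A → ℝ) (M : A → B → ℝ) (q : B → ℝ) : ℝ :=
  ∑ a, ∑ b, p a * M a b * q b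

/-- `min_{q ∈ Δ_B} pᵀ M q`. -/
def responseValue (p : A → ℝ) (M : A → B → ℝ) : ℝ :=
  ⨅ q : stdSimplex ℝ B, payoff p M q.1

/-- `max_{p ∈ Δ_A} min_{q ∈ Δ_B} pᵀ M q`. -/
def gameValue (M : A → B → ℝ) : ℝ :=
  ⨆ p : stdSimplex ℝ A, responseValue p.1 M

end MatrixGame

/-! ### Markov games, policies and values.  Steps are numbered `0, …, H - 1`. -/

/-- An episodic two-player zero-sum Markov game with horizon `H`, deterministic rewards in
`[0, 1]` and a fixed initial state. -/
structure MarkovGame (H : ℕ) (X A B : Type*) [MeasurableSpace X] [MeasurableSpace A]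
    [MeasurableSpace B] where
  P : Fin H → Kernel (X × A × B) X
  markov : ∀ h, IsMarkovKernel (P h)
  r : Fin H → X → A → B → ℝ
  measurable_r : ∀ h a b, Measurable fun x => r h x a b
  r_mem : ∀ h x a b, r h x a b ∈ Set.Icc (0 : ℝ) 1
  init : X

/-- A Markov policy `{π_h : X → Δ_A}_h`. -/
structure Policy (H : ℕ) (X A : Type*) [MeasurableSpace X] [Fintype A] where
  prob : Fin H → X → A → ℝ
  mem : ∀ h x, prob h x ∈ stdSimplex ℝ A
  measurable_prob : ∀ h a, Measurable fun x => prob h x a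

/-- A trajectory `(x^h, a^h, b^h)_h` of one episode; the rewards are functions of it. -/
abbrev Traj (H : ℕ) (X A B : Type*) : Type _ := Fin H → X × A × B

section Values

variable {H : ℕ} {X A B : Type*} [MeasurableSpace X]
  [Fintype A] [MeasurableSpace A] [Fintype B] [MeasurableSpace B]

/-- Law of the action pair at step `h`: given the state, `a ∼ μ_h(x)` and `b ∼ ν_h(x)`
independently. -/
def actKernel (μ : Policy H X A) (ν : Policy H X B) (h : Fin H) : Kernel X (A × B) where
  toFun x := ∑ a, ∑ b, ENNReal.ofReal (μ.prob h x a * ν.prob h x b) • Measure.dirac (a, b)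
  measurable' := by
    refine Measure.measurable_of_measurable_coe _ fun s _ => ?_
    simp only [Measure.coe_finsetSum, Finset.sum_apply, Measure.smul_apply, smul_eq_mul]
    refine Finset.measurable_sum _ fun a _ => Finset.measurable_sum _ fun b _ => ?_
    exact (((μ.measurable_prob h a).mul (ν.measurable_prob h b)).ennreal_ofReal).mul_const _

/-- Law of the last part of an episode, from step `h` to the end, when the first state and action
pair are given and the part after the first transition has the law `K`. -/
def consKernel (M : MarkovGame H X A B) (h : Fin H) {n : ℕ}
    (K : Kernel X (Traj n X A B)) : Kernel (X × A × B) (Traj (n + 1) X A B) :=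
  (Kernel.id ×ₖ (K ∘ₖ M.P h)).map fun z => (Fin.cons z.1 z.2 : Traj (n + 1) X A B)

/-- Law of `(x^{h'}, a^{h'}, b^{h'})_{h' ≥ h}` given `x^h = x` when `(μ, ν)` is played.  Here `n`
is the number of remaining steps, so the `i`-th entry belongs to step `h + i`. -/
def rollout (M : MarkovGame H X A B) (μ : Policy H X A) (ν : Policy H X B) :
    (n h : ℕ) → h + n = H → Kernel X (Traj n X A B)
  | 0, _, _ => Kernel.const X (Measure.dirac Fin.elim0)
  | n + 1, h, hh =>
      consKernel M ⟨h, by omega⟩ (rollout M μ ν n (h + 1) (by omega)) ∘ₖ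
        (Kernel.id ×ₖ actKernel μ ν ⟨h, by omega⟩)

/-- Law of a whole episode played with `(μ, ν)`. -/
def episodeLaw (M : MarkovGame H X A B) (μ : Policy H X A) (ν : Policy H X B) :
    Measure (Traj H X A B) :=
  rollout M μ ν H 0 (by omega) M.init

/-- Total reward collected from step `h` on. -/
def totalReward (M : MarkovGame H X A B) (n h : ℕ) (hh : h + n = H) (ζ : Traj n X A B) : ℝ :=
  ∑ i : Fin n, M.r ⟨h + i, by omega⟩ (ζ i).1 (ζ i).2.1 (ζ i).2.2

/-- `V_h^{μ,ν}(x) = E_{μ,ν}[∑_{h' ≥ h} r^{h'} | x^h = x]`. -/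
def value (M : MarkovGame H X A B) (μ : Policy H X A) (ν : Policy H X B) (h : Fin H) (x : X) : ℝ :=
  ∫ ζ, totalReward M (H - h) h (by omega) ζ ∂(rollout M μ ν (H - h) h (by omega) x)

/-- `Q_h^{μ,ν}(x,a,b) = E_{μ,ν}[∑_{h' ≥ h} r^{h'} | (x^h, a^h, b^h) = (x, a, b)]`. -/
def qValue (M : MarkovGame H X A B) (μ : Policy H X A) (ν : Policy H X B) (h : Fin H)
    (x : X) (a : A) (b : B) : ℝ :=
  ∫ ζ, totalReward M (H - (h + 1) + 1) h (by omega) ζ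
    ∂(consKernel M h (rollout M μ ν (H - (h + 1)) (h + 1) (by omega)) (x, a, b))

/-- The value `V_1^{μ,ν}(x^1)` of the game from its initial state. -/
def initValue (M : MarkovGame H X A B) (μ : Policy H X A) (ν : Policy H X B) : ℝ :=
  ∫ ζ, totalReward M H 0 (by omega) ζ ∂(episodeLaw M μ ν)

/-- `(μ, ν)` is a Nash equilibrium (a saddle point at every step and state). -/
def IsNash (M : MarkovGame H X A B) (μ : Policy H X A) (ν : Policy H X B) : Prop :=
  ∀ h x, (∀ μ', value M μ' ν h x ≤ value M μ ν h x) ∧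
    (∀ ν', value M μ ν h x ≤ value M μ ν' h x)

/-- `ν` is a best response of the min-player to `μ`. -/
def IsBestResponse (M : MarkovGame H X A B) (μ : Policy H X A) (ν : Policy H X B) : Prop :=
  ∀ h x ν', value M μ ν h x ≤ value M μ ν' h x

end Values

/-! ### Function classes and induced policies -/

/-- A function class `F = F_0 × ⋯ × F_{H-1}`; every `F_h` carries a σ-algebra (so that one can put
a prior on it) for which evaluation is jointly measurable. -/
structure FunctionClass (H : ℕ) (X A B : Type*) [MeasurableSpace X] where
  carrier : Fin H → Set (X → A → B → ℝ)
  mspace : ∀ h, MeasurableSpace (carrier h)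
  measurable_eval : ∀ h a b,
    @Measurable _ _ (@Prod.instMeasurableSpace _ _ (mspace h) _) _
      fun p : carrier h × X => p.1.1 p.2 a b

/-- The elements of `F_h`, with the σ-algebra of the class. -/
def FunctionClass.Elem {H : ℕ} {X A B : Type*} [MeasurableSpace X]
    (F : FunctionClass H X A B) (h : Fin H) : Type _ :=
  F.carrier h

instance {H : ℕ} {X A B : Type*} [MeasurableSpace X] (F : FunctionClass H X A B) (h : Fin H) :
    MeasurableSpace (F.Elem h) :=
  F.mspace h

/-- The elements `f = (f^h)_h` of the class. -/
abbrev FunctionClass.Elems {H : ℕ} {X A B : Type*} [MeasurableSpace X]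
    (F : FunctionClass H X A B) : Type _ :=
  (h : Fin H) → F.Elem h

/-- A (measurable) choice of the induced policies
`μ_{f,h}(x) ∈ argmax_p min_q pᵀ f^h(x,·,·) q` and
`ν_{f,g,h}(x) ∈ argmin_q μ_{f,h}(x)ᵀ g^h(x,·,·) q`. -/
structure InducedPolicies {H : ℕ} {X A B : Type*} [MeasurableSpace X] [Fintype A] [Fintype B]
    (F : FunctionClass H X A B) where
  mu : (h : Fin H) → F.Elem h → X → A → ℝ
  nu : (h : Fin H) → F.Elem h → F.Elem h → X → B → ℝ
  mu_mem : ∀ h f x, mu h f x ∈ stdSimplex ℝ A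
  nu_mem : ∀ h f g x, nu h f g x ∈ stdSimplex ℝ B
  mu_max : ∀ h f x, IsMaxOn (fun p => responseValue p (f.1 x)) (stdSimplex ℝ A) (mu h f x)
  nu_min : ∀ h f g x,
    IsMinOn (fun q => payoff (mu h f x) (g.1 x) q) (stdSimplex ℝ B) (nu h f g x)
  measurable_mu : ∀ h a, Measurable fun p : F.Elem h × X => mu h p.1 p.2 a
  measurable_nu : ∀ h b, Measurable fun p : (F.Elem h × F.Elem h) × X => nu h p.1.1 p.1.2 p.2 b

section Learning

variable {H : ℕ} {X A B : Type*} [MeasurableSpace X]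
  [Fintype A] [MeasurableSpace A] [Fintype B] [MeasurableSpace B]
  {F : FunctionClass H X A B}

/-- The max-player policy `μ_f`. -/
def InducedPolicies.maxPolicy (I : InducedPolicies F) (f : F.Elems) : Policy H X A where
  prob h x := I.mu h (f h) x
  mem h x := I.mu_mem h (f h) x
  measurable_prob h a := (I.measurable_mu h a).comp measurable_prodMk_left

/-- The min-player policy `ν_{f,g}`. -/
def InducedPolicies.minPolicy (I : InducedPolicies F) (f g : F.Elems) : Policy H X B where
  prob h x := I.nu h (f h) (g h) x
  mem h x := I.nu_mem h (f h) (g h) x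
  measurable_prob h b := (I.measurable_nu h b).comp (measurable_prodMk_left (x := (f h, g h)))

/-- `V_{f,h}(x) = max_p min_q pᵀ f^h(x,·,·) q`, and `0` after the last step. -/
def maxminValue (f : F.Elems) (h : ℕ) (x : X) : ℝ :=
  if hh : h < H then gameValue ((f ⟨h, hh⟩).1 x) else 0

/-- `V_{g,h}^μ(x) = min_q μ_h(x)ᵀ g^h(x,·,·) q`, and `0` after the last step. -/
def policyValue (μ : Policy H X A) (g : F.Elems) (h : ℕ) (x : X) : ℝ :=
  if hh : h < H then responseValue (μ.prob ⟨h, hh⟩ x) ((g ⟨h, hh⟩).1 x) else 0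

/-- `r^h + P_h V`. -/
def backup (M : MarkovGame H X A B) (h : Fin H) (V : X → ℝ) (x : X) (a : A) (b : B) : ℝ :=
  M.r h x a b + ∫ x', V x' ∂(M.P h (x, a, b))

/-- The Bellman operator `T_h f = r^h + P_h V_{f,h+1}`. -/
def bellman (M : MarkovGame H X A B) (h : Fin H) (f : F.Elems) : X → A → B → ℝ :=
  backup M h (maxminValue f (h + 1))

/-- The Bellman operator `T_h^μ g = r^h + P_h V_{g,h+1}^μ`. -/
def bellmanPolicy (M : MarkovGame H X A B) (μ : Policy H X A) (h : Fin H) (g : F.Elems) :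
    X → A → B → ℝ :=
  backup M h (policyValue μ g (h + 1))

/-- The Bellman residual `E_h(f; x, a, b)`. -/
def residual (M : MarkovGame H X A B) (h : Fin H) (f : F.Elems) (z : X × A × B) : ℝ :=
  (f h).1 z.1 z.2.1 z.2.2 - bellman M h f z.1 z.2.1 z.2.2

/-- The Bellman residual `E_h^μ(g; x, a, b)`. -/
def residualPolicy (M : MarkovGame H X A B) (μ : Policy H X A) (h : Fin H) (g : F.Elems)
    (z : X × A × B) : ℝ :=
  (g h).1 z.1 z.2.1 z.2.2 - bellmanPolicy M μ h g z.1 z.2.1 z.2.2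

/-! ### Assumptions -/

/-- Realizability with respect to the Nash equilibrium `(μs, νs)`: `Q_h^* ∈ F_h`, and
`Q_h^{μ_f,†} ∈ F_h` for every `f` in the class. -/
def Realizable (M : MarkovGame H X A B) (I : InducedPolicies F) (μs : Policy H X A)
    (νs : Policy H X B) : Prop :=
  (∀ h, qValue M μs νs h ∈ F.carrier h) ∧
    ∀ (f : F.Elems) (ν : Policy H X B), IsBestResponse M (I.maxPolicy f) ν →
      ∀ h, qValue M (I.maxPolicy f) ν h ∈ F.carrier h

/-- Completeness: `T_h^{μ_f} g ∈ F_h` for all `f, g` in the class. -/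
def Complete (M : MarkovGame H X A B) (I : InducedPolicies F) : Prop :=
  ∀ (f g : F.Elems) (h : Fin H), bellmanPolicy M (I.maxPolicy f) h g ∈ F.carrier h

/-- Boundedness: all functions of the class take values in `[0, β - 1]`. -/
def BoundedBy (F : FunctionClass H X A B) (β : ℝ) : Prop :=
  ∀ h, ∀ f ∈ F.carrier h, ∀ x a b, f x a b ∈ Set.Icc 0 (β - 1)

/-! ### The complexity measures -/

/-- `κ_μ(ε) = sup_g ∑_h ln (1 / p_0^h {u ∈ F_h : sup |u - T_h^μ g| ≤ ε})`, possibly `∞`. -/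
def kappaPolicy (M : MarkovGame H X A B) (p₀ : (h : Fin H) → Measure (F.Elem h))
    (μ : Policy H X A) (ε : ℝ) : EReal :=
  ⨆ g : F.Elems, ∑ h, ENNReal.log
    (1 / p₀ h {u | ∀ x a b, |u.1 x a b - bellmanPolicy M μ h g x a b| ≤ ε})

/-- `κ(ε) = sup_f κ_{μ_f}(ε)`. -/
def kappa (M : MarkovGame H X A B) (I : InducedPolicies F)
    (p₀ : (h : Fin H) → Measure (F.Elem h)) (ε : ℝ) : EReal :=
  ⨆ f : F.Elems, kappaPolicy M p₀ (I.maxPolicy f) ε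

/-- The inequality that defines the decoupling coefficient, for episode laws `π t` and
residuals `e t h`. -/
def Decouples {T : ℕ} (π : Fin T → Measure (Traj H X A B))
    (e : Fin T → Fin H → X × A × B → ℝ) (m : ℝ) (K : ℤ) : Prop :=
  ∑ h, ∑ t, ∫ ζ, e t h (ζ h) ∂(π t) ≤
    m * ∑ h, ∑ t, ∑ s ∈ Finset.Iio t, ∫ ζ, (e t h (ζ h)) ^ 2 ∂(π s) + K / (4 * m)

/-- The multi-agent decoupling coefficient `dc(F, MG, T, m)`: the smallest integer `K` such that
for all `f_t, g_t` in the class, with `π_t` the law of an episode under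
`(μ_{f_t}, ν_{f_t,g_t})`, the decoupling inequality holds for the residuals
`E_h^{μ_{f_t}}(g_t)` of the booster agent and for the residuals `E_h(f_t)` of the main agent. -/
def decouplingCoeff (M : MarkovGame H X A B) (I : InducedPolicies F) (T : ℕ) (m : ℝ) : ℤ :=
  sInf {K : ℤ | ∀ f g : Fin T → F.Elems,
    Decouples (fun t => episodeLaw M (I.maxPolicy (f t)) (I.minPolicy (f t) (g t)))
      (fun t h => residualPolicy M (I.maxPolicy (f t)) h (g t)) m K ∧
    Decouples (fun t => episodeLaw M (I.maxPolicy (f t)) (I.minPolicy (f t) (g t)))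
      (fun t h => residual M h (f t)) m K}

/-! ### The algorithm: conditional posterior sampling with booster -/

/-- The state `x^{h+1}` of a trajectory.  At the last step the value is irrelevant, because the
value functions after the last step are zero. -/
def nextState (ζ : Traj H X A B) (h : Fin H) : X :=
  if hh : (h : ℕ) + 1 < H then (ζ ⟨h + 1, hh⟩).1 else (ζ h).1

/-- The squared loss `∑_s (u(x_s^h, a_s^h, b_s^h) - r_s^h - V(x_s^{h+1}))²` over the history `S` of
`t` episodes. -/
def sqLoss (M : MarkovGame H X A B) (h : Fin H) (u : X → A → B → ℝ) (V : X → ℝ) {t : ℕ}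
    (S : Fin t → Traj H X A B) : ℝ :=
  ∑ s, (u (S s h).1 (S s h).2.1 (S s h).2.2 - M.r h (S s h).1 (S s h).2.1 (S s h).2.2
    - V (nextState (S s) h)) ^ 2

/-- `ln` of `exp(-η L^h(u, V; S)) / E_{ũ ∼ p_0^h} exp(-η L^h(ũ, V; S))`. -/
def logLikelihood (M : MarkovGame H X A B) (p₀ : (h : Fin H) → Measure (F.Elem h)) (η : ℝ)
    (h : Fin H) (u : F.Elem h) (V : X → ℝ) {t : ℕ} (S : Fin t → Traj H X A B) : ℝ :=
  -η * sqLoss M h u.1 V S -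
    Real.log (∫ u' : F.Elem h, Real.exp (-η * sqLoss M h u'.1 V S) ∂(p₀ h))

/-- The posterior of the main agent,
`p(f | S) ∝ exp(lam V_{f,1}(x^1)) ∏_h q(f^h | f^{h+1}, S)` with respect to `∏_h p_0^h`. -/
def mainPosterior (M : MarkovGame H X A B) (p₀ : (h : Fin H) → Measure (F.Elem h))
    (η lam : ℝ) {t : ℕ} (S : Fin t → Traj H X A B) : Measure F.Elems :=
  (Measure.pi p₀).tilted fun f =>
    lam * maxminValue f 0 M.init +
      ∑ h, logLikelihood M p₀ η h (f h) (maxminValue f (h + 1)) S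

/-- The posterior of the booster agent,
`p^μ(g | S) ∝ exp(-lam V_{g,1}^μ(x^1)) ∏_h q^μ(g^h | g^{h+1}, S)` with respect to `∏_h p_0^h`. -/
def boosterPosterior (M : MarkovGame H X A B) (p₀ : (h : Fin H) → Measure (F.Elem h))
    (η lam : ℝ) (μ : Policy H X A) {t : ℕ} (S : Fin t → Traj H X A B) : Measure F.Elems :=
  (Measure.pi p₀).tilted fun g =>
    -lam * policyValue μ g 0 M.init +
      ∑ h, logLikelihood M p₀ η h (g h) (policyValue μ g (h + 1)) S

/-- The law of the history `S_t` of the first `t` episodes: given `S_t`, draw `f` from the main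
posterior, then `g` from the booster posterior for `μ_f`, play `(μ_f, ν_{f,g})` and append the
trajectory. -/
def historyLaw (M : MarkovGame H X A B) (I : InducedPolicies F)
    (p₀ : (h : Fin H) → Measure (F.Elem h)) (η lam : ℝ) :
    (t : ℕ) → Measure (Fin t → Traj H X A B)
  | 0 => Measure.dirac Fin.elim0
  | t + 1 => (historyLaw M I p₀ η lam t).bind fun S =>
      (mainPosterior M p₀ η lam S).bind fun f =>
        (boosterPosterior M p₀ η lam (I.maxPolicy f) S).bind fun g =>
          (episodeLaw M (I.maxPolicy f) (I.minPolicy f g)).map fun ζ =>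
            (Fin.snoc S ζ : Fin (t + 1) → Traj H X A B)

/-- The main-agent part of the regret,
`∑_{t=1}^T E_{S_{t-1}} E_{f_t} E_{g_t} [V_1^*(x^1) - V_1^{μ_t,ν_t}(x^1)]`, where `V^* = V^{μs,νs}`. -/
def mainRegret (M : MarkovGame H X A B) (I : InducedPolicies F)
    (p₀ : (h : Fin H) → Measure (F.Elem h)) (η lam : ℝ) (μs : Policy H X A) (νs : Policy H X B)
    (T : ℕ) : ℝ :=
  ∑ t ∈ Finset.range T,
    ∫ S, ∫ f, ∫ g, (initValue M μs νs - initValue M (I.maxPolicy f) (I.minPolicy f g))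
      ∂(boosterPosterior M p₀ η lam (I.maxPolicy f) S)
      ∂(mainPosterior M p₀ η lam S)
      ∂(historyLaw M I p₀ η lam t)

end Learning

end SelfPlay

end

open SelfPlay

/-!
The regret of a round splits as `V^* - V_{f_t}` plus `V_{f_t} - V^{μ_t,ν_t}`, and by performance
difference the second part is at most the sum of the Bellman residuals of `f_t` along the episode.
The decoupling coefficient trades these residuals for the in-sample squared residuals under the
earlier policies, so it remains to bound the posterior mean of
`(η / 2) ∑_{s<t} ∑_h E_s[E_h(f)²] - λ V_{f,1}(x^1)`.

Measure every loss relative to that of the Bayes predictor `T_h f`; the posterior is unchanged. The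
excess loss has conditional mean `E_h(f)²` and is bounded, so `E[exp(-η' · excess loss)]` is at most
`exp(-η'/2 · E_s[E_h(f)²])` for small `η'`. Two links `(f^h, f^{h+1})` at steps of the same parity
share no component and are independent under the prior. The Cauchy-Schwarz inequality over even and
odd steps therefore doubles `η`, and the Gibbs variational inequality moves the bound from the prior
to the posterior at the cost of the log-evidence. The latter is controlled by a comparator that
draws `f^H, …, f^1` in turn from the prior conditioned on `f^h` being within `ε` of `T_h f`, whose
relative entropy is at most `κ(ε)` and whose value is optimistic up to `H ε`. The normalizing
factors of the posterior are at least the prior mass of those balls up to `e^{O(η t ε β)}`, which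
costs `κ(ε)` once more.
-/

noncomputable section

namespace SelfPlay

/-! ### Matrix games -/

section MatrixGame

variable {A B : Type*} [Fintype A] [Fintype B] {p : A → ℝ} {q : B → ℝ}

theorem payoff_mono (hp : p ∈ stdSimplex ℝ A) (hq : q ∈ stdSimplex ℝ B) {M N : A → B → ℝ}
    (h : ∀ a b, M a b ≤ N a b) : payoff p M q ≤ payoff p N q :=
  Finset.sum_le_sum fun a _ => Finset.sum_le_sum fun b _ =>
    mul_le_mul_of_nonneg_right (mul_le_mul_of_nonneg_left (h a b) (hp.1 a)) (hq.1 b)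

theorem payoff_const (hp : p ∈ stdSimplex ℝ A) (hq : q ∈ stdSimplex ℝ B) (c : ℝ) :
    payoff p (fun _ _ => c) q = c := by
  simp only [payoff, ← Finset.mul_sum, hq.2, mul_one, ← Finset.sum_mul, hp.2, one_mul]

theorem payoff_sub (p : A → ℝ) (M N : A → B → ℝ) (q : B → ℝ) :
    payoff p (fun a b => M a b - N a b) q = payoff p M q - payoff p N q := by
  simp only [payoff, ← Finset.sum_sub_distrib, mul_sub, sub_mul]

theorem payoff_mem_Icc (hp : p ∈ stdSimplex ℝ A) (hq : q ∈ stdSimplex ℝ B) {M : A → B → ℝ}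
    {c d : ℝ} (h : ∀ a b, M a b ∈ Set.Icc c d) : payoff p M q ∈ Set.Icc c d :=
  ⟨(payoff_const hp hq c).symm.le.trans (payoff_mono hp hq fun a b => (h a b).1),
    (payoff_mono hp hq fun a b => (h a b).2).trans (payoff_const hp hq d).le⟩

theorem bddBelow_range_payoff (p : A → ℝ) (M : A → B → ℝ) :
    BddBelow (Set.range fun q : stdSimplex ℝ B => payoff p M q.1) := by
  rw [← Set.image_eq_range]
  exact ((isCompact_stdSimplex ℝ B).image (by unfold payoff; fun_prop)).bddBelow

theorem responseValue_le (p : A → ℝ) (M : A → B → ℝ) (hq : q ∈ stdSimplex ℝ B) :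
    responseValue p M ≤ payoff p M q :=
  ciInf_le (bddBelow_range_payoff p M) ⟨q, hq⟩

theorem le_responseValue [Nonempty B] {M : A → B → ℝ} {c : ℝ}
    (h : ∀ q ∈ stdSimplex ℝ B, c ≤ payoff p M q) : c ≤ responseValue p M :=
  le_ciInf fun q => h q.1 q.2

theorem responseValue_eq_payoff (hq : q ∈ stdSimplex ℝ B) {M : A → B → ℝ}
    (h : IsMinOn (payoff p M) (stdSimplex ℝ B) q) : responseValue p M = payoff p M q :=
  h.iInf_eq hq

theorem gameValue_eq_responseValue (hp : p ∈ stdSimplex ℝ A) {M : A → B → ℝ}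
    (h : IsMaxOn (fun p => responseValue p M) (stdSimplex ℝ A) p) :
    gameValue M = responseValue p M :=
  h.iSup_eq hp

end MatrixGame

/-! ### Values of the induced policies -/

section Induced

variable {H : ℕ} {X A B : Type*} [MeasurableSpace X] [Fintype A] [Fintype B]
  {F : FunctionClass H X A B}

theorem policyValue_eq_payoff (I : InducedPolicies F) (f g : F.Elems) {h : ℕ} (hh : h < H) (x : X) :
    policyValue (I.maxPolicy f) g h x =
      payoff (I.mu ⟨h, hh⟩ (f ⟨h, hh⟩) x) ((g ⟨h, hh⟩).1 x)
        (I.nu ⟨h, hh⟩ (f ⟨h, hh⟩) (g ⟨h, hh⟩) x) := by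
  rw [policyValue, dif_pos hh]
  exact responseValue_eq_payoff (I.nu_mem _ _ _ _) (I.nu_min _ _ _ _)

theorem maxminValue_eq_policyValue (I : InducedPolicies F) (f : F.Elems) (h : ℕ) :
    maxminValue f h = policyValue (I.maxPolicy f) f h := by
  funext x
  rw [maxminValue, policyValue]
  split_ifs with hh
  · exact gameValue_eq_responseValue (I.mu_mem _ _ _) (I.mu_max _ _ _)
  · rfl

theorem maxminValue_of_le (f : F.Elems) {h : ℕ} (hh : H ≤ h) (x : X) : maxminValue f h x = 0 :=
  dif_neg hh.not_gt

theorem maxminValue_congr {f g : F.Elems} {h : ℕ} (hfg : ∀ hh : h < H, f ⟨h, hh⟩ = g ⟨h, hh⟩) :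
    maxminValue f h = maxminValue g h := by
  funext x
  rw [maxminValue, maxminValue]
  split_ifs with hh
  · rw [hfg hh]
  · rfl

theorem responseValue_le_maxminValue (I : InducedPolicies F) (f : F.Elems) {h : ℕ} (hh : h < H)
    (x : X) {p : A → ℝ} (hp : p ∈ stdSimplex ℝ A) :
    responseValue p ((f ⟨h, hh⟩).1 x) ≤ maxminValue f h x := by
  rw [maxminValue, dif_pos hh,
    gameValue_eq_responseValue (I.mu_mem _ (f ⟨h, hh⟩) x) (I.mu_max _ _ _)]
  exact I.mu_max _ _ _ hp

theorem maxminValue_le_payoff (I : InducedPolicies F) (f : F.Elems) {h : ℕ} (hh : h < H)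
    (x : X) {q : B → ℝ} (hq : q ∈ stdSimplex ℝ B) :
    maxminValue f h x ≤ payoff (I.mu ⟨h, hh⟩ (f ⟨h, hh⟩) x) ((f ⟨h, hh⟩).1 x) q := by
  rw [maxminValue, dif_pos hh,
    gameValue_eq_responseValue (I.mu_mem _ (f ⟨h, hh⟩) x) (I.mu_max _ _ _)]
  exact responseValue_le _ _ hq

theorem policyValue_mem_Icc (I : InducedPolicies F) {β : ℝ} (hβ : 1 ≤ β) (hF : BoundedBy F β)
    (f g : F.Elems) (h : ℕ) (x : X) :
    policyValue (I.maxPolicy f) g h x ∈ Set.Icc 0 (β - 1) := by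
  by_cases hh : h < H
  · rw [policyValue_eq_payoff I f g hh]
    exact payoff_mem_Icc (I.mu_mem _ _ _) (I.nu_mem _ _ _ _) fun a b => hF _ _ (g ⟨h, hh⟩).2 x a b
  · rw [policyValue, dif_neg hh]
    exact ⟨le_rfl, sub_nonneg.2 hβ⟩

theorem maxminValue_mem_Icc (I : InducedPolicies F) {β : ℝ} (hβ : 1 ≤ β) (hF : BoundedBy F β)
    (f : F.Elems) (h : ℕ) (x : X) : maxminValue f h x ∈ Set.Icc 0 (β - 1) := by
  rw [maxminValue_eq_policyValue I]
  exact policyValue_mem_Icc I hβ hF f f h x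

theorem measurable_policyValue (I : InducedPolicies F) (h : ℕ) :
    Measurable fun p : (F.Elems × F.Elems) × X => policyValue (I.maxPolicy p.1.1) p.1.2 h p.2 := by
  by_cases hh : h < H
  · simp only [policyValue_eq_payoff I _ _ hh, payoff]
    refine Finset.measurable_sum _ fun a _ => Finset.measurable_sum _ fun b _ => ?_
    refine Measurable.mul (Measurable.mul ?_ ?_) ?_
    · exact (I.measurable_mu ⟨h, hh⟩ a).comp (by fun_prop : Measurable fun p :
        (F.Elems × F.Elems) × X => (p.1.1 ⟨h, hh⟩, p.2))
    · exact (F.measurable_eval ⟨h, hh⟩ a b).comp (by fun_prop : Measurable fun p :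
        (F.Elems × F.Elems) × X => (p.1.2 ⟨h, hh⟩, p.2))
    · exact (I.measurable_nu ⟨h, hh⟩ b).comp (by fun_prop : Measurable fun p :
        (F.Elems × F.Elems) × X => ((p.1.1 ⟨h, hh⟩, p.1.2 ⟨h, hh⟩), p.2))
  · simp only [policyValue, dif_neg hh, measurable_const]

theorem measurable_maxminValue (I : InducedPolicies F) (h : ℕ) :
    Measurable fun p : F.Elems × X => maxminValue p.1 h p.2 := by
  simp only [maxminValue_eq_policyValue I]
  have := (measurable_policyValue I h).comp (by fun_prop : Measurable fun p : F.Elems × X =>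
    ((p.1, p.1), p.2))
  exact this

theorem measurable_maxminValue_right (I : InducedPolicies F) (f : F.Elems) (h : ℕ) :
    Measurable (maxminValue f h) := by
  have := (measurable_maxminValue I h).comp (measurable_prodMk_left (x := f))
  exact this

theorem measurable_policyValue_right (I : InducedPolicies F) (f g : F.Elems) (h : ℕ) :
    Measurable (policyValue (I.maxPolicy f) g h) := by
  have := (measurable_policyValue I h).comp (measurable_prodMk_left (x := (f, g)))
  exact this

variable [MeasurableSpace A] [MeasurableSpace B]

theorem bellman_eq_bellmanPolicy (M : MarkovGame H X A B) (I : InducedPolicies F) (f : F.Elems)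
    (h : Fin H) : bellman M h f = bellmanPolicy M (I.maxPolicy f) h f := by
  rw [bellman, bellmanPolicy, maxminValue_eq_policyValue I]

end Induced

/-! ### Bellman backups and residuals -/

theorem measurable_action {A B : Type*} [Finite A] [MeasurableSpace A] [MeasurableSingletonClass A]
    [Finite B] [MeasurableSpace B] [MeasurableSingletonClass B]
    {E E' : Type*} [MeasurableSpace E] [MeasurableSpace E']
    {g : E → A → B → E'} (hg : ∀ a b, Measurable fun x => g x a b) :
    Measurable fun z : E × A × B => g z.1 z.2.1 z.2.2 :=
  measurable_from_prod_countable_left (f := fun z : E × A × B => g z.1 z.2.1 z.2.2)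
    fun ab => hg ab.1 ab.2

section Backup

variable {H : ℕ} {X A B : Type*} [MeasurableSpace X] [MeasurableSpace A] [MeasurableSpace B]
  (M : MarkovGame H X A B) (h : Fin H)

theorem integral_transition_mem_Icc {V : X → ℝ} {c : ℝ} (hVm : Measurable V)
    (hV : ∀ x, V x ∈ Set.Icc 0 c) (z : X × A × B) : ∫ x', V x' ∂(M.P h z) ∈ Set.Icc 0 c := by
  have := M.markov h
  refine ⟨integral_nonneg fun x => (hV x).1, ?_⟩
  have hint : Integrable V (M.P h z) :=
    Integrable.of_mem_Icc 0 c hVm.aemeasurable (Filter.Eventually.of_forall hV)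
  calc ∫ x', V x' ∂(M.P h z) ≤ ∫ _, c ∂(M.P h z) :=
        integral_mono hint (integrable_const _) fun x => (hV x).2
    _ = c := by simp

theorem backup_mem_Icc {V : X → ℝ} {c : ℝ} (hVm : Measurable V)
    (hV : ∀ x, V x ∈ Set.Icc 0 c) (x : X) (a : A) (b : B) :
    backup M h V x a b ∈ Set.Icc 0 (1 + c) := by
  have hint := integral_transition_mem_Icc M h hVm hV (x, a, b)
  have hr := M.r_mem h x a b
  exact ⟨add_nonneg hr.1 hint.1, add_le_add hr.2 hint.2⟩

variable [Finite A] [MeasurableSingletonClass A] [Finite B] [MeasurableSingletonClass B]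

theorem measurable_reward : Measurable fun z : X × A × B => M.r h z.1 z.2.1 z.2.2 :=
  measurable_action (M.measurable_r h)

theorem measurable_backup {Θ : Type*} [MeasurableSpace Θ] {V : Θ → X → ℝ}
    (hV : Measurable fun p : Θ × X => V p.1 p.2) :
    Measurable fun p : Θ × (X × A × B) => backup M h (V p.1) p.2.1 p.2.2.1 p.2.2.2 := by
  have := M.markov h
  refine ((measurable_reward M h).comp measurable_snd).add ?_
  have hsnd : Measurable (Prod.snd : Θ × (X × A × B) → X × A × B) := measurable_snd
  have hint : StronglyMeasurable fun p : Θ × (X × A × B) =>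
      ∫ x', V p.1 x' ∂((M.P h).comap _ hsnd p) :=
    StronglyMeasurable.integral_kernel_prod_right
      (f := fun (p : Θ × (X × A × B)) x' => V p.1 x')
      (hV.comp (by fun_prop : Measurable fun p : (Θ × (X × A × B)) × X =>
        (p.1.1, p.2))).stronglyMeasurable
  simpa only [Kernel.comap_apply] using hint.measurable

end Backup

theorem measurable_elem {H : ℕ} {X A B : Type*} [MeasurableSpace X]
    [Finite A] [MeasurableSpace A] [MeasurableSingletonClass A]
    [Finite B] [MeasurableSpace B] [MeasurableSingletonClass B]
    {F : FunctionClass H X A B} (h : Fin H) :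
    Measurable fun p : F.Elem h × (X × A × B) => p.1.1 p.2.1 p.2.2.1 p.2.2.2 := by
  have : Measurable fun z : (F.Elem h × X) × A × B => z.1.1.1 z.1.2 z.2.1 z.2.2 :=
    measurable_action (g := fun (z : F.Elem h × X) a b => z.1.1 z.2 a b) (F.measurable_eval h)
  exact this.comp (by fun_prop : Measurable fun p : F.Elem h × (X × A × B) =>
    ((p.1, p.2.1), p.2.2))

section Residual

variable {H : ℕ} {X A B : Type*} [MeasurableSpace X]
  [Fintype A] [MeasurableSpace A] [Fintype B] [MeasurableSpace B]
  {F : FunctionClass H X A B} (M : MarkovGame H X A B) (I : InducedPolicies F) (h : Fin H)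

include I in
theorem abs_residual_le {β : ℝ} (hβ : 1 ≤ β) (hF : BoundedBy F β) (f : F.Elems) (z : X × A × B) :
    |residual M h f z| ≤ β := by
  have hf := hF h _ (f h).2 z.1 z.2.1 z.2.2
  have hTf := backup_mem_Icc M h (measurable_maxminValue_right I f (h + 1))
    (maxminValue_mem_Icc I hβ hF f (h + 1)) z.1 z.2.1 z.2.2
  rw [residual, bellman, abs_le]
  constructor <;> linarith [hf.1, hf.2, hTf.1, hTf.2]

theorem abs_residualPolicy_le {β : ℝ} (hβ : 1 ≤ β) (hF : BoundedBy F β) (f g : F.Elems)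
    (z : X × A × B) : |residualPolicy M (I.maxPolicy f) h g z| ≤ β := by
  have hg := hF h _ (g h).2 z.1 z.2.1 z.2.2
  have hTg := backup_mem_Icc M h (measurable_policyValue_right I f g (h + 1))
    (policyValue_mem_Icc I hβ hF f g (h + 1)) z.1 z.2.1 z.2.2
  rw [residualPolicy, bellmanPolicy, abs_le]
  constructor <;> linarith [hg.1, hg.2, hTg.1, hTg.2]

variable [MeasurableSingletonClass A] [MeasurableSingletonClass B]

include I in
theorem measurable_bellman :
    Measurable fun p : F.Elems × (X × A × B) => bellman M h p.1 p.2.1 p.2.2.1 p.2.2.2 :=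
  measurable_backup M h (V := fun f : F.Elems => maxminValue f (h + 1))
    (measurable_maxminValue I (h + 1))

include I in
theorem measurable_residual :
    Measurable fun p : F.Elems × (X × A × B) => residual M h p.1 p.2 :=
  ((measurable_elem h).comp (by fun_prop : Measurable fun p : F.Elems × (X × A × B) =>
    (p.1 h, p.2))).sub (measurable_bellman M I h)

end Residual

/-! ### The law of an episode -/

section BoundedIntegrand

variable {Ω : Type*} [MeasurableSpace Ω] {P : Measure Ω} {φ : Ω → ℝ} {c : ℝ}

theorem integrable_of_abs_le [IsFiniteMeasure P] (hφ : Measurable φ) (hc : ∀ ω, |φ ω| ≤ c) :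
    Integrable φ P :=
  .of_bound hφ.aestronglyMeasurable c (.of_forall hc)

theorem abs_integral_le [IsProbabilityMeasure P] (hc : ∀ ω, |φ ω| ≤ c) : |∫ ω, φ ω ∂P| ≤ c := by
  simpa using norm_integral_le_of_norm_le_const (μ := P) (f := φ) (C := c) (.of_forall hc)

end BoundedIntegrand

section ActionLaw

variable {H : ℕ} {X A B : Type*} [MeasurableSpace X] [Fintype A] [Fintype B]

theorem sum_prob_mul_prob (μ : Policy H X A) (ν : Policy H X B) (h : Fin H) (x : X) :
    ∑ a, ∑ b, μ.prob h x a * ν.prob h x b = 1 := by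
  simp only [← Finset.mul_sum, (ν.mem h x).2, mul_one, (μ.mem h x).2]

theorem prob_mul_prob_nonneg (μ : Policy H X A) (ν : Policy H X B) (h : Fin H) (x : X) (a : A)
    (b : B) : 0 ≤ μ.prob h x a * ν.prob h x b :=
  mul_nonneg ((μ.mem h x).1 a) ((ν.mem h x).1 b)

theorem sum_ofReal_prob_mul_prob (μ : Policy H X A) (ν : Policy H X B) (h : Fin H) (x : X) :
    ∑ a, ∑ b, ENNReal.ofReal (μ.prob h x a * ν.prob h x b) = 1 := by
  rw [← ENNReal.ofReal_one, ← sum_prob_mul_prob μ ν h x,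
    ENNReal.ofReal_sum_of_nonneg fun a _ => Finset.sum_nonneg fun b _ =>
      prob_mul_prob_nonneg μ ν h x a b]
  exact Finset.sum_congr rfl fun a _ =>
    (ENNReal.ofReal_sum_of_nonneg fun b _ => prob_mul_prob_nonneg μ ν h x a b).symm

variable [MeasurableSpace A] [MeasurableSpace B]

theorem lintegral_actKernel (μ : Policy H X A) (ν : Policy H X B) (h : Fin H) (x : X)
    {φ : A × B → ℝ≥0∞} (hφ : Measurable φ) :
    ∫⁻ ab, φ ab ∂(actKernel μ ν h x) =
      ∑ a, ∑ b, ENNReal.ofReal (μ.prob h x a * ν.prob h x b) * φ (a, b) := by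
  change ∫⁻ ab, φ ab ∂(∑ a, ∑ b, ENNReal.ofReal (μ.prob h x a * ν.prob h x b) •
    Measure.dirac (a, b)) = _
  simp [lintegral_finsetSum_measure, lintegral_smul_measure, lintegral_dirac' _ hφ]

instance (μ : Policy H X A) (ν : Policy H X B) (h : Fin H) : IsMarkovKernel (actKernel μ ν h) := by
  refine ⟨fun x => ⟨?_⟩⟩
  rw [← lintegral_one, lintegral_actKernel μ ν h x measurable_const]
  simpa using sum_ofReal_prob_mul_prob μ ν h x

end ActionLaw

section Cons

variable {H : ℕ} {X A B : Type*} [MeasurableSpace X] [MeasurableSpace A] [MeasurableSpace B]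

theorem measurable_cons {n : ℕ} :
    Measurable fun z : (X × A × B) × Traj n X A B => (Fin.cons z.1 z.2 : Traj (n + 1) X A B) := by
  refine measurable_pi_iff.2 fun i => ?_
  refine Fin.cases ?_ (fun i => ?_) i
  · simpa using measurable_fst
  · simp only [Fin.cons_succ]
    exact (measurable_pi_apply i).comp measurable_snd

theorem measurable_cons_right {n : ℕ} (z : X × A × B) :
    Measurable fun ζ : Traj n X A B => (Fin.cons z ζ : Traj (n + 1) X A B) :=
  measurable_cons.comp (measurable_prodMk_left (x := z))

instance (M : MarkovGame H X A B) (h : Fin H) {n : ℕ} (K : Kernel X (Traj n X A B))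
    [IsMarkovKernel K] : IsMarkovKernel (consKernel M h K) := by
  have := M.markov h
  exact Kernel.IsMarkovKernel.map _ measurable_cons

theorem consKernel_apply (M : MarkovGame H X A B) (h : Fin H) {n : ℕ}
    (K : Kernel X (Traj n X A B)) [IsMarkovKernel K] (z : X × A × B) :
    consKernel M h K z = ((M.P h z).bind K).map
      fun ζ => (Fin.cons z ζ : Traj (n + 1) X A B) := by
  have := M.markov h
  rw [consKernel, Kernel.map_apply _ measurable_cons, Kernel.prod_apply, Kernel.id_apply,
    Measure.dirac_prod, Measure.map_map measurable_cons measurable_prodMk_left, Kernel.comp_apply]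
  rfl

theorem lintegral_consKernel (M : MarkovGame H X A B) (h : Fin H) {n : ℕ}
    (K : Kernel X (Traj n X A B)) [IsMarkovKernel K] (z : X × A × B)
    {φ : Traj (n + 1) X A B → ℝ≥0∞} (hφ : Measurable φ) :
    ∫⁻ ζ, φ ζ ∂(consKernel M h K z) = ∫⁻ x', ∫⁻ ζ, φ (Fin.cons z ζ) ∂(K x') ∂(M.P h z) := by
  rw [consKernel_apply, lintegral_map hφ (measurable_cons_right z),
    Measure.lintegral_bind (f := fun ζ => φ (Fin.cons z ζ)) K.measurable.aemeasurable
      (hφ.comp (measurable_cons_right z)).aemeasurable]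

theorem integral_consKernel (M : MarkovGame H X A B) (h : Fin H) {n : ℕ}
    (K : Kernel X (Traj n X A B)) [IsMarkovKernel K] (z : X × A × B)
    {φ : Traj (n + 1) X A B → ℝ} (hφ : Measurable φ) {c : ℝ} (hc : ∀ ζ, |φ ζ| ≤ c) :
    ∫ ζ, φ ζ ∂(consKernel M h K z) = ∫ x', ∫ ζ, φ (Fin.cons z ζ) ∂(K x') ∂(M.P h z) := by
  have := M.markov h
  rw [consKernel_apply, integral_map (measurable_cons_right z).aemeasurable
    hφ.aestronglyMeasurable, ← Kernel.comp_apply, Kernel.integral_comp]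
  exact integrable_of_abs_le (hφ.comp (measurable_cons_right z)) fun ζ => hc _

end Cons

section Rollout

variable {H : ℕ} {X A B : Type*} [MeasurableSpace X]
  [Fintype A] [MeasurableSpace A] [Fintype B] [MeasurableSpace B]

instance isMarkovKernel_rollout (M : MarkovGame H X A B) (μ : Policy H X A) (ν : Policy H X B)
    (n h : ℕ) (hh : h + n = H) : IsMarkovKernel (rollout M μ ν n h hh) := by
  induction n generalizing h with
  | zero => unfold rollout; infer_instance
  | succ n ih =>
    have := ih (h + 1) (by omega)
    unfold rollout
    infer_instance

instance (M : MarkovGame H X A B) (μ : Policy H X A) (ν : Policy H X B) :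
    IsProbabilityMeasure (episodeLaw M μ ν) := by
  unfold episodeLaw
  infer_instance

theorem lintegral_rollout_succ_eq_consKernel (M : MarkovGame H X A B) (μ : Policy H X A)
    (ν : Policy H X B) (n h : ℕ) (hh : h + (n + 1) = H) (x : X) {φ : Traj (n + 1) X A B → ℝ≥0∞}
    (hφ : Measurable φ) :
    ∫⁻ ζ, φ ζ ∂(rollout M μ ν (n + 1) h hh x) =
      ∑ a, ∑ b, ENNReal.ofReal (μ.prob ⟨h, by omega⟩ x a * ν.prob ⟨h, by omega⟩ x b) *
        ∫⁻ ζ, φ ζ ∂(consKernel M ⟨h, by omega⟩ (rollout M μ ν n (h + 1) (by omega)) (x, a, b)) := by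
  rw [rollout, Kernel.lintegral_comp _ _ _ hφ, Kernel.prod_apply, Kernel.id_apply,
    Measure.dirac_prod, lintegral_map hφ.lintegral_kernel measurable_prodMk_left,
    lintegral_actKernel]
  exact hφ.lintegral_kernel.comp measurable_prodMk_left

theorem lintegral_rollout_succ (M : MarkovGame H X A B) (μ : Policy H X A) (ν : Policy H X B)
    (n h : ℕ) (hh : h + (n + 1) = H) (x : X) {φ : Traj (n + 1) X A B → ℝ≥0∞} (hφ : Measurable φ) :
    ∫⁻ ζ, φ ζ ∂(rollout M μ ν (n + 1) h hh x) =
      ∑ a, ∑ b, ENNReal.ofReal (μ.prob ⟨h, by omega⟩ x a * ν.prob ⟨h, by omega⟩ x b) *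
        ∫⁻ x', ∫⁻ ζ, φ (Fin.cons (x, a, b) ζ) ∂(rollout M μ ν n (h + 1) (by omega) x')
          ∂(M.P ⟨h, by omega⟩ (x, a, b)) := by
  rw [lintegral_rollout_succ_eq_consKernel M μ ν n h hh x hφ]
  simp only [lintegral_consKernel M _ _ _ hφ]

theorem rollout_succ_apply (M : MarkovGame H X A B) (μ : Policy H X A) (ν : Policy H X B)
    (n h : ℕ) (hh : h + (n + 1) = H) (x : X) :
    rollout M μ ν (n + 1) h hh x =
      ∑ a, ∑ b, ENNReal.ofReal (μ.prob ⟨h, by omega⟩ x a * ν.prob ⟨h, by omega⟩ x b) •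
        consKernel M ⟨h, by omega⟩ (rollout M μ ν n (h + 1) (by omega)) (x, a, b) := by
  ext s hs
  rw [← lintegral_indicator_one hs, lintegral_rollout_succ_eq_consKernel M μ ν n h hh x
    (measurable_one.indicator hs)]
  simp [lintegral_indicator_one hs]

theorem integral_rollout_succ_eq_consKernel (M : MarkovGame H X A B) (μ : Policy H X A)
    (ν : Policy H X B) (n h : ℕ) (hh : h + (n + 1) = H) (x : X) {φ : Traj (n + 1) X A B → ℝ}
    (hφ : Measurable φ) {c : ℝ} (hc : ∀ ζ, |φ ζ| ≤ c) :
    ∫ ζ, φ ζ ∂(rollout M μ ν (n + 1) h hh x) =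
      payoff (μ.prob ⟨h, by omega⟩ x) (fun a b => ∫ ζ, φ ζ
        ∂(consKernel M ⟨h, by omega⟩ (rollout M μ ν n (h + 1) (by omega)) (x, a, b)))
        (ν.prob ⟨h, by omega⟩ x) := by
  have hint : ∀ (h' : Fin H) (n : ℕ) (K : Kernel X (Traj n X A B)) [IsMarkovKernel K]
      (φ : Traj (n + 1) X A B → ℝ) (_ : Measurable φ) (_ : ∀ ζ, |φ ζ| ≤ c) (w : ℝ) z,
      Integrable φ (ENNReal.ofReal w • consKernel M h' K z) :=
    fun h' n K _ φ hφ hc w z => (integrable_of_abs_le hφ hc).smul_measure (by simp)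
  rw [rollout_succ_apply, integral_finsetSum_measure]
  · refine Finset.sum_congr rfl fun a _ => ?_
    rw [integral_finsetSum_measure]
    · refine Finset.sum_congr rfl fun b _ => ?_
      rw [integral_smul_measure, ENNReal.toReal_ofReal (prob_mul_prob_nonneg _ _ _ _ _ _),
        smul_eq_mul]
      ring
    · exact fun b _ => hint _ _ _ _ hφ hc _ _
  · intro a _
    exact integrable_finsetSum_measure.2 fun b _ => hint _ _ _ _ hφ hc _ _

/-! ### The Markov property -/

theorem lintegral_rollout_next (M : MarkovGame H X A B) (μ : Policy H X A) (ν : Policy H X B)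
    (n h : ℕ) (hh : h + n = H) (i j : Fin n) (hij : (i : ℕ) + 1 = j) (k : Fin H)
    (hk : h + (i : ℕ) = k) (x : X) {G : (X × A × B) × X → ℝ≥0∞} (hG : Measurable G) :
    ∫⁻ ζ, G (ζ i, (ζ j).1) ∂(rollout M μ ν n h hh x) =
      ∫⁻ ζ, ∫⁻ x', G (ζ i, x') ∂(M.P k (ζ i)) ∂(rollout M μ ν n h hh x) := by
  have := M.markov
  induction n generalizing h x with
  | zero => exact i.elim0
  | succ n ih =>
    have hG' : Measurable fun z => ∫⁻ x', G (z, x') ∂(M.P k z) := hG.lintegral_kernel_prod_right'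
    rw [lintegral_rollout_succ M μ ν n h hh x (φ := fun ζ => G (ζ i, (ζ j).1))
      (hG.comp (by fun_prop)), lintegral_rollout_succ M μ ν n h hh x
      (φ := fun ζ => ∫⁻ x', G (ζ i, x') ∂(M.P k (ζ i))) (hG'.comp (measurable_pi_apply i))]
    refine Finset.sum_congr rfl fun a _ => Finset.sum_congr rfl fun b _ => ?_
    congr 1
    obtain ⟨j, rfl⟩ := Fin.exists_succ_eq.2 (show j ≠ 0 from fun h0 => by simp [h0] at hij)
    rcases Fin.eq_zero_or_eq_succ i with rfl | ⟨i, rfl⟩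
    · obtain ⟨n, rfl⟩ : ∃ m, n = m + 1 := ⟨n - 1, by have := j.2; omega⟩
      obtain rfl : j = 0 := Fin.ext (by simpa using hij.symm)
      have hk' : (⟨h, by omega⟩ : Fin H) = k := Fin.ext (by simpa using hk)
      simp only [Fin.cons_zero, Fin.cons_succ, lintegral_const, measure_univ, mul_one, hk']
      refine lintegral_congr fun x' => ?_
      rw [lintegral_rollout_succ M μ ν n (h + 1) (by omega) x'
        (φ := fun ζ => G ((x, a, b), (ζ 0).1)) (hG.comp (by fun_prop))]
      simp only [Fin.cons_zero, lintegral_const, measure_univ, mul_one]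
      simp only [← Finset.sum_mul, sum_ofReal_prob_mul_prob, one_mul]
    · simp only [Fin.cons_succ]
      refine lintegral_congr fun x' => ?_
      exact ih (h + 1) (by omega) i j (by simpa using hij) (by simp at hk; omega) x'

/-! ### Reachable states -/

/-- A measure on the states at step `h` that dominates the law of the state under all policies:
the sum over all action sequences of the laws of the state. -/
def reachMeasure (M : MarkovGame H X A B) : ℕ → Measure X
  | 0 => Measure.dirac M.init
  | h + 1 => if hh : h < H then
      ∑ a, ∑ b, (reachMeasure M h).bind fun x => M.P ⟨h, hh⟩ (x, a, b) else 0

instance (M : MarkovGame H X A B) (h : ℕ) : IsFiniteMeasure (reachMeasure M h) := by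
  induction h with
  | zero => unfold reachMeasure; infer_instance
  | succ h ih =>
    unfold reachMeasure
    split_ifs with hh
    · have := M.markov
      have : ∀ a b, IsFiniteMeasure ((reachMeasure M h).bind fun x => M.P ⟨h, hh⟩ (x, a, b)) := by
        intro a b
        refine ⟨?_⟩
        have hm : Measurable fun x => M.P ⟨h, hh⟩ (x, a, b) :=
          (M.P ⟨h, hh⟩).measurable.comp (by fun_prop)
        rw [Measure.bind_apply .univ hm.aemeasurable]
        simp
      infer_instance
    · infer_instance

theorem ae_ae_of_reachMeasure_succ (M : MarkovGame H X A B) (h : Fin H) {p : X → Prop}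
    (hp : ∀ᵐ x ∂(reachMeasure M (h + 1)), p x) :
    ∀ᵐ x ∂(reachMeasure M h), ∀ a b, ∀ᵐ x' ∂(M.P h (x, a, b)), p x' := by
  rw [reachMeasure, dif_pos h.2] at hp
  refine ae_all_iff.2 fun a => ae_all_iff.2 fun b => ?_
  have hm : Measurable fun x => M.P h (x, a, b) := (M.P h).measurable.comp (by fun_prop)
  refine Measure.ae_ae_of_ae_bind hm.aemeasurable ?_
  refine (Measure.absolutelyContinuous_of_le ?_).ae_le hp
  refine le_trans ?_ (Finset.single_le_sum (f := fun a => ∑ b, (reachMeasure M h).bind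
    fun x => M.P h (x, a, b)) (fun _ _ => Measure.zero_le _) (Finset.mem_univ a))
  exact Finset.single_le_sum (f := fun b => (reachMeasure M h).bind
    fun x => M.P h (x, a, b)) (fun _ _ => Measure.zero_le _) (Finset.mem_univ b)

theorem ae_rollout_succ_of_ae (M : MarkovGame H X A B) (μ : Policy H X A) (ν : Policy H X B)
    (n h : ℕ) (hh : h + (n + 1) = H) (x : X) {s : Set (Traj (n + 1) X A B)} (hs : MeasurableSet s)
    (hx : ∀ a b, ∀ᵐ x' ∂(M.P ⟨h, by omega⟩ (x, a, b)),
      ∀ᵐ ζ ∂(rollout M μ ν n (h + 1) (by omega) x'), Fin.cons (x, a, b) ζ ∈ s) :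
    ∀ᵐ ζ ∂(rollout M μ ν (n + 1) h hh x), ζ ∈ s := by
  rw [ae_iff]
  change rollout M μ ν (n + 1) h hh x sᶜ = 0
  rw [← lintegral_indicator_one hs.compl, lintegral_rollout_succ _ _ _ _ _ _ _
    (measurable_one.indicator hs.compl)]
  refine Finset.sum_eq_zero fun a _ => Finset.sum_eq_zero fun b _ => mul_eq_zero.2 <| .inr <|
    lintegral_eq_zero_of_ae_eq_zero ?_
  filter_upwards [hx a b] with x' hx'
  refine lintegral_eq_zero_of_ae_eq_zero ?_
  filter_upwards [hx'] with ζ hζ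
  simpa using hζ

theorem ae_rollout_of_reachMeasure (M : MarkovGame H X A B) (μ : Policy H X A) (ν : Policy H X B)
    (n h : ℕ) (hh : h + n = H) (i : Fin n) {s : Set X} (hs : MeasurableSet s)
    (hp : ∀ᵐ x ∂(reachMeasure M (h + i)), x ∈ s) :
    ∀ᵐ x ∂(reachMeasure M h), ∀ᵐ ζ ∂(rollout M μ ν n h hh x), (ζ i).1 ∈ s := by
  induction n generalizing h with
  | zero => exact i.elim0
  | succ n ih =>
    have hs' : MeasurableSet {ζ : Traj (n + 1) X A B | (ζ i).1 ∈ s} :=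
      (by fun_prop : Measurable fun ζ : Traj (n + 1) X A B => (ζ i).1) hs
    rcases Fin.eq_zero_or_eq_succ i with rfl | ⟨i, rfl⟩
    · filter_upwards [hp] with x hx
      exact ae_rollout_succ_of_ae M μ ν n h hh x hs' fun a b => .of_forall fun _ =>
        .of_forall fun _ => hx
    · have hnext := ih (h + 1) (by omega) i
        (by rwa [Fin.val_succ, add_comm (i : ℕ), ← add_assoc] at hp)
      filter_upwards [ae_ae_of_reachMeasure_succ M ⟨h, by omega⟩ hnext] with x hx
      exact ae_rollout_succ_of_ae M μ ν n h hh x hs' hx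

theorem ae_episodeLaw_of_reachMeasure (M : MarkovGame H X A B) (μ : Policy H X A)
    (ν : Policy H X B) (h : Fin H) {s : Set X} (hs : MeasurableSet s)
    (hp : ∀ᵐ x ∂(reachMeasure M h), x ∈ s) : ∀ᵐ ζ ∂(episodeLaw M μ ν), (ζ h).1 ∈ s := by
  have hrollout := ae_rollout_of_reachMeasure M μ ν H 0 (by omega) h hs (by simpa using hp)
  have hs' : MeasurableSet {ζ : Traj H X A B | (ζ h).1 ∈ s} :=
    (by fun_prop : Measurable fun ζ : Traj H X A B => (ζ h).1) hs
  have hset : MeasurableSet {x | ∀ᵐ ζ ∂(rollout M μ ν H 0 (by omega) x), (ζ h).1 ∈ s} :=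
    Kernel.measurable_coe _ hs'.compl (measurableSet_singleton 0)
  rwa [reachMeasure, ae_dirac_iff hset] at hrollout

end Rollout

/-! ### Bellman equations -/

section Cumulative

variable {H : ℕ} {X A B : Type*}

/-- The sum `∑_{h' ≥ h} φ_{h'}(x^{h'}, a^{h'}, b^{h'})` over the last `n` steps of an episode, whose
first entry belongs to step `h`. -/
def cumulative (φ : Fin H → X × A × B → ℝ) (n h : ℕ) (hh : h + n = H) (ζ : Traj n X A B) : ℝ :=
  ∑ i : Fin n, φ ⟨h + i, by omega⟩ (ζ i)

theorem cumulative_cons (φ : Fin H → X × A × B → ℝ) (n h : ℕ) (hh : h + (n + 1) = H)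
    (z : X × A × B) (ζ : Traj n X A B) :
    cumulative φ (n + 1) h hh (Fin.cons z ζ) =
      φ ⟨h, by omega⟩ z + cumulative φ n (h + 1) (by omega) ζ := by
  simp only [cumulative, Fin.sum_univ_succ, Fin.cons_zero, Fin.cons_succ]
  congr 1
  refine Finset.sum_congr rfl fun i _ => ?_
  congr 2
  simp only [Fin.val_succ]
  omega

theorem abs_cumulative_le {φ : Fin H → X × A × B → ℝ} {c : ℝ} (hc : ∀ k z, |φ k z| ≤ c) (n h : ℕ)
    (hh : h + n = H) (ζ : Traj n X A B) : |cumulative φ n h hh ζ| ≤ n * c := by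
  refine (Finset.abs_sum_le_sum_abs _ _).trans ((Finset.sum_le_sum fun i _ => hc _ _).trans_eq ?_)
  simp

variable [MeasurableSpace X] [MeasurableSpace A] [MeasurableSpace B]

theorem measurable_cumulative {φ : Fin H → X × A × B → ℝ} (hφ : ∀ k, Measurable (φ k)) (n h : ℕ)
    (hh : h + n = H) : Measurable (cumulative φ n h hh) := by
  unfold cumulative
  exact Finset.measurable_sum _ fun i _ => (hφ _).comp (measurable_pi_apply i)

variable [Fintype A] [Fintype B]

/-- `E_{μ,ν}[∑_{h' ≥ h} φ_{h'}(x^{h'}, a^{h'}, b^{h'}) | x^h = x]`, with `n` remaining steps. -/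
def expectedCumulative (M : MarkovGame H X A B) (μ : Policy H X A) (ν : Policy H X B)
    (φ : Fin H → X × A × B → ℝ) (n h : ℕ) (hh : h + n = H) (x : X) : ℝ :=
  ∫ ζ, cumulative φ n h hh ζ ∂(rollout M μ ν n h hh x)

theorem expectedCumulative_zero (M : MarkovGame H X A B) (μ : Policy H X A) (ν : Policy H X B)
    (φ : Fin H → X × A × B → ℝ) (h : ℕ) (hh : h + 0 = H) (x : X) :
    expectedCumulative M μ ν φ 0 h hh x = 0 := by
  simp [expectedCumulative, cumulative]

variable (M : MarkovGame H X A B) (μ : Policy H X A) (ν : Policy H X B)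
  {φ : Fin H → X × A × B → ℝ} {c : ℝ}

theorem measurable_expectedCumulative (hφ : ∀ k, Measurable (φ k)) (n h : ℕ) (hh : h + n = H) :
    Measurable (expectedCumulative M μ ν φ n h hh) :=
  (measurable_cumulative hφ n h hh).stronglyMeasurable.integral_kernel.measurable

theorem abs_expectedCumulative_le (hc : ∀ k z, |φ k z| ≤ c) (n h : ℕ) (hh : h + n = H) (x : X) :
    |expectedCumulative M μ ν φ n h hh x| ≤ n * c :=
  abs_integral_le (abs_cumulative_le hc n h hh)

theorem integral_consKernel_cumulative (hφ : ∀ k, Measurable (φ k)) (hc : ∀ k z, |φ k z| ≤ c)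
    (n h : ℕ) (hh : h + (n + 1) = H) (z : X × A × B) :
    ∫ ζ, cumulative φ (n + 1) h hh ζ
        ∂(consKernel M ⟨h, by omega⟩ (rollout M μ ν n (h + 1) (by omega)) z) =
      φ ⟨h, by omega⟩ z +
        ∫ x', expectedCumulative M μ ν φ n (h + 1) (by omega) x' ∂(M.P ⟨h, by omega⟩ z) := by
  have := M.markov
  have hadd : ∀ x', ∫ ζ, (φ ⟨h, by omega⟩ z + cumulative φ n (h + 1) (by omega) ζ)
      ∂(rollout M μ ν n (h + 1) (by omega) x') =
      φ ⟨h, by omega⟩ z + expectedCumulative M μ ν φ n (h + 1) (by omega) x' := fun x' => by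
    rw [integral_add (integrable_const _) (integrable_of_abs_le
      (measurable_cumulative hφ n _ _) (abs_cumulative_le hc n _ _))]
    simp [expectedCumulative]
  rw [integral_consKernel M _ _ _ (measurable_cumulative hφ _ h hh) (abs_cumulative_le hc _ h hh)]
  simp only [cumulative_cons, hadd]
  rw [integral_add (integrable_const _) (integrable_of_abs_le
    (measurable_expectedCumulative M μ ν hφ n _ _) (abs_expectedCumulative_le M μ ν hc n _ _))]
  simp

theorem expectedCumulative_succ (hφ : ∀ k, Measurable (φ k)) (hc : ∀ k z, |φ k z| ≤ c)
    (n h : ℕ) (hh : h + (n + 1) = H) (x : X) :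
    expectedCumulative M μ ν φ (n + 1) h hh x = payoff (μ.prob ⟨h, by omega⟩ x)
      (fun a b => φ ⟨h, by omega⟩ (x, a, b) + ∫ x',
        expectedCumulative M μ ν φ n (h + 1) (by omega) x' ∂(M.P ⟨h, by omega⟩ (x, a, b)))
      (ν.prob ⟨h, by omega⟩ x) := by
  rw [expectedCumulative, integral_rollout_succ_eq_consKernel M μ ν n h hh x
    (measurable_cumulative hφ _ h hh) (abs_cumulative_le hc _ h hh)]
  simp only [integral_consKernel_cumulative M μ ν hφ hc]

theorem expectedCumulative_init (hφ : ∀ k, Measurable (φ k)) (hc : ∀ k z, |φ k z| ≤ c) :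
    expectedCumulative M μ ν φ H 0 (zero_add H) M.init =
      ∑ h, ∫ ζ, φ h (ζ h) ∂(episodeLaw M μ ν) := by
  have hint : ∀ h : Fin H, Integrable (fun ζ => φ h (ζ h)) (episodeLaw M μ ν) := fun h =>
    integrable_of_abs_le ((hφ h).comp (measurable_pi_apply h)) fun ζ => hc h (ζ h)
  rw [← integral_finsetSum _ fun h _ => hint h]
  simp only [expectedCumulative, cumulative, episodeLaw, zero_add]

end Cumulative

section Values

variable {H : ℕ} {X A B : Type*} [MeasurableSpace X] [MeasurableSpace A] [MeasurableSpace B]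

/-- The reward of step `h` as a function of `(x^h, a^h, b^h)`. -/
def stepReward (M : MarkovGame H X A B) (h : Fin H) (z : X × A × B) : ℝ :=
  M.r h z.1 z.2.1 z.2.2

theorem abs_stepReward_le (M : MarkovGame H X A B) (h : Fin H) (z : X × A × B) :
    |stepReward M h z| ≤ 1 := by
  have hr := M.r_mem h z.1 z.2.1 z.2.2
  exact abs_le.2 ⟨by linarith [hr.1, stepReward.eq_def M h z], hr.2⟩

section Finite

variable [Finite A] [MeasurableSingletonClass A] [Finite B] [MeasurableSingletonClass B]

theorem measurable_stepReward (M : MarkovGame H X A B) (h : Fin H) : Measurable (stepReward M h) :=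
  measurable_reward M h

end Finite

variable [Fintype A] [Fintype B]

/-- The expected total reward of the last `n` steps, which start at step `h` in the state `x`. -/
def valueToGo (M : MarkovGame H X A B) (μ : Policy H X A) (ν : Policy H X B) (n h : ℕ)
    (hh : h + n = H) (x : X) : ℝ :=
  expectedCumulative M μ ν (stepReward M) n h hh x

theorem valueToGo_mem_Icc (M : MarkovGame H X A B) (μ : Policy H X A) (ν : Policy H X B)
    (n h : ℕ) (hh : h + n = H) (x : X) : valueToGo M μ ν n h hh x ∈ Set.Icc (0 : ℝ) n :=
  ⟨integral_nonneg fun _ => Finset.sum_nonneg fun _ _ => (M.r_mem _ _ _ _).1,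
    (le_abs_self _).trans <|
      (abs_expectedCumulative_le M μ ν (abs_stepReward_le M) n h hh x).trans_eq (mul_one _)⟩

theorem value_eq_valueToGo (M : MarkovGame H X A B) (μ : Policy H X A) (ν : Policy H X B) (n : ℕ)
    (h : Fin H) (hh : (h : ℕ) + n = H) (x : X) : value M μ ν h x = valueToGo M μ ν n h hh x := by
  obtain rfl : n = H - h := by omega
  rfl

theorem initValue_eq_valueToGo (M : MarkovGame H X A B) (μ : Policy H X A) (ν : Policy H X B) :
    initValue M μ ν = valueToGo M μ ν H 0 (zero_add H) M.init :=
  rfl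

theorem initValue_nonneg (M : MarkovGame H X A B) (μ : Policy H X A) (ν : Policy H X B) :
    0 ≤ initValue M μ ν :=
  (valueToGo_mem_Icc M μ ν H 0 (zero_add H) M.init).1

theorem initValue_le (M : MarkovGame H X A B) (μ : Policy H X A) (ν : Policy H X B) :
    initValue M μ ν ≤ H :=
  (valueToGo_mem_Icc M μ ν H 0 (zero_add H) M.init).2

variable [MeasurableSingletonClass A] [MeasurableSingletonClass B]

theorem measurable_valueToGo (M : MarkovGame H X A B) (μ : Policy H X A) (ν : Policy H X B)
    (n h : ℕ) (hh : h + n = H) : Measurable (valueToGo M μ ν n h hh) :=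
  measurable_expectedCumulative M μ ν (measurable_stepReward M) n h hh

theorem valueToGo_succ (M : MarkovGame H X A B) (μ : Policy H X A) (ν : Policy H X B) (n h : ℕ)
    (hh : h + (n + 1) = H) (x : X) :
    valueToGo M μ ν (n + 1) h hh x = payoff (μ.prob ⟨h, by omega⟩ x)
      (backup M ⟨h, by omega⟩ (valueToGo M μ ν n (h + 1) (by omega)) x)
      (ν.prob ⟨h, by omega⟩ x) :=
  expectedCumulative_succ M μ ν (measurable_stepReward M) (abs_stepReward_le M) n h hh x

theorem qValue_eq_backup (M : MarkovGame H X A B) (μ : Policy H X A) (ν : Policy H X B) (n : ℕ)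
    (h : Fin H) (hh : (h : ℕ) + 1 + n = H) (x : X) (a : A) (b : B) :
    qValue M μ ν h x a b = backup M h (valueToGo M μ ν n (h + 1) hh) x a b := by
  obtain rfl : n = H - (h + 1) := by omega
  exact integral_consKernel_cumulative M μ ν (measurable_stepReward M) (abs_stepReward_le M) _ h
    (by omega) (x, a, b)

theorem initValue_le_of_qValue_mem {F : FunctionClass H X A B} {M : MarkovGame H X A B}
    {μ : Policy H X A} {ν : Policy H X B} (hQ : ∀ h, qValue M μ ν h ∈ F.carrier h) {β : ℝ}
    (hβ : 1 ≤ β) (hF : BoundedBy F β) : initValue M μ ν ≤ β - 1 := by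
  rw [initValue_eq_valueToGo]
  cases H with
  | zero => simpa [valueToGo, expectedCumulative_zero] using hβ
  | succ n =>
    rw [valueToGo_succ]
    refine (payoff_mem_Icc (c := 0) (μ.mem _ _) (ν.mem _ _) fun a b => ?_).2
    have := hF 0 _ (hQ 0) M.init a b
    rwa [qValue_eq_backup M μ ν n 0 (by simp; omega)] at this

theorem valueToGo_congr (M : MarkovGame H X A B) (μ : Policy H X A) {ν ν' : Policy H X B}
    (n h : ℕ) (hh : h + n = H) (hν : ∀ k : Fin H, h ≤ k → ν.prob k = ν'.prob k) :
    valueToGo M μ ν n h hh = valueToGo M μ ν' n h hh := by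
  induction n generalizing h with
  | zero => funext x; simp only [valueToGo, expectedCumulative_zero]
  | succ n ih =>
    funext x
    rw [valueToGo_succ, valueToGo_succ, ih (h + 1) (by omega) fun k hk => hν k (by omega),
      hν _ le_rfl]

end Values

section Deviation

variable {H : ℕ} {X A B : Type*} [MeasurableSpace X] [Fintype B]

/-- The policy that plays the mixed action `q` at step `h` and follows `ν` otherwise. -/
def Policy.deviate (ν : Policy H X B) (h : Fin H) (q : B → ℝ) (hq : q ∈ stdSimplex ℝ B) :
    Policy H X B where
  prob k x := if k = h then q else ν.prob k x
  mem k x := by split_ifs; exacts [hq, ν.mem k x]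
  measurable_prob k b := by
    split_ifs
    exacts [measurable_const, ν.measurable_prob k b]

variable [Fintype A] [MeasurableSpace A] [MeasurableSingletonClass A]
  [MeasurableSpace B] [MeasurableSingletonClass B]

theorem IsBestResponse.valueToGo_le_payoff {M : MarkovGame H X A B} {μ : Policy H X A}
    {ν : Policy H X B} (hν : IsBestResponse M μ ν) (n h : ℕ) (hh : h + (n + 1) = H) (x : X)
    {q : B → ℝ} (hq : q ∈ stdSimplex ℝ B) :
    valueToGo M μ ν (n + 1) h hh x ≤ payoff (μ.prob ⟨h, by omega⟩ x)
      (backup M ⟨h, by omega⟩ (valueToGo M μ ν n (h + 1) (by omega)) x) q := by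
  have hdev := hν ⟨h, by omega⟩ x (ν.deviate ⟨h, by omega⟩ q hq)
  rw [value_eq_valueToGo M μ ν (n + 1) ⟨h, by omega⟩ hh,
    value_eq_valueToGo M μ _ (n + 1) ⟨h, by omega⟩ hh] at hdev
  refine hdev.trans_eq ?_
  rw [valueToGo_succ, valueToGo_congr M μ (ν' := ν) n (h + 1) _ fun k hk => ?_]
  · simp [Policy.deviate]
  · funext x
    exact if_neg fun hk' => by simp [hk'] at hk

end Deviation

/-! ### Performance difference and optimism -/

section Performance

variable {H : ℕ} {X A B : Type*} [MeasurableSpace X] [Fintype A] [Fintype B]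
  {F : FunctionClass H X A B} {β : ℝ}

theorem integrable_maxminValue (I : InducedPolicies F) (hβ : 1 ≤ β) (hF : BoundedBy F β)
    (f : F.Elems) (h : ℕ) {P : Measure X} [IsFiniteMeasure P] : Integrable (maxminValue f h) P :=
  .of_mem_Icc 0 (β - 1) (measurable_maxminValue_right I f h).aemeasurable
    (.of_forall (maxminValue_mem_Icc I hβ hF f h))

variable [MeasurableSpace A] [MeasurableSpace B] (M : MarkovGame H X A B) (I : InducedPolicies F)

/-- The Bellman residual of `f` plus the reward, which telescopes along an episode. -/
def residualAddReward (f : F.Elems) (h : Fin H) (z : X × A × B) : ℝ :=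
  residual M h f z + stepReward M h z

include I in
theorem abs_residualAddReward_le (hβ : 1 ≤ β) (hF : BoundedBy F β) (f : F.Elems) (h : Fin H)
    (z : X × A × B) : |residualAddReward M f h z| ≤ β + 1 :=
  (abs_add_le _ _).trans (add_le_add (abs_residual_le M I h hβ hF f z) (abs_stepReward_le M h z))

variable [MeasurableSingletonClass A] [MeasurableSingletonClass B]

include I in
theorem measurable_residual_right (h : Fin H) (f : F.Elems) : Measurable (residual M h f) := by
  have := (measurable_residual M I h).comp (measurable_prodMk_left (x := f))
  exact this

include I in
theorem measurable_residualAddReward (f : F.Elems) (h : Fin H) :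
    Measurable (residualAddReward M f h) :=
  (measurable_residual_right M I h f).add (measurable_stepReward M h)

theorem maxminValue_le_expectedCumulative (hβ : 1 ≤ β) (hF : BoundedBy F β) (f : F.Elems)
    (ν : Policy H X B) (n h : ℕ) (hh : h + n = H) (x : X) :
    maxminValue f h x ≤
      expectedCumulative M (I.maxPolicy f) ν (residualAddReward M f) n h hh x := by
  have := M.markov
  have hm := measurable_residualAddReward M I f
  have hb := abs_residualAddReward_le M I hβ hF f
  induction n generalizing h x with
  | zero => rw [maxminValue_of_le f (show H ≤ h by omega), expectedCumulative_zero]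
  | succ n ih =>
    have hlt : h < H := by omega
    rw [expectedCumulative_succ M _ ν hm hb]
    refine (maxminValue_le_payoff I f hlt x (ν.mem ⟨h, hlt⟩ x)).trans ?_
    refine payoff_mono (I.mu_mem _ _ _) (ν.mem _ _) fun a b => ?_
    have hnext : ∫ x', maxminValue f (h + 1) x' ∂(M.P ⟨h, hlt⟩ (x, a, b)) ≤
        ∫ x', expectedCumulative M (I.maxPolicy f) ν (residualAddReward M f) n (h + 1)
          (by omega) x' ∂(M.P ⟨h, hlt⟩ (x, a, b)) :=
      integral_mono (integrable_maxminValue I hβ hF f _)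
        (integrable_of_abs_le (measurable_expectedCumulative M _ ν hm n _ _)
          (abs_expectedCumulative_le M _ ν hb n _ _)) (ih (h + 1) (by omega))
    simp only [residualAddReward, residual, bellman, backup, stepReward]
    linarith

theorem maxminValue_sub_initValue_le (hβ : 1 ≤ β) (hF : BoundedBy F β) (f : F.Elems)
    (ν : Policy H X B) :
    maxminValue f 0 M.init - initValue M (I.maxPolicy f) ν ≤
      ∑ h, ∫ ζ, residual M h f (ζ h) ∂(episodeLaw M (I.maxPolicy f) ν) := by
  have hreward : initValue M (I.maxPolicy f) ν =
      ∑ h, ∫ ζ, stepReward M h (ζ h) ∂(episodeLaw M (I.maxPolicy f) ν) :=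
    expectedCumulative_init M _ ν (measurable_stepReward M) (abs_stepReward_le M)
  have hle := maxminValue_le_expectedCumulative M I hβ hF f ν H 0 (zero_add H) M.init
  rw [expectedCumulative_init M _ ν (measurable_residualAddReward M I f)
    (abs_residualAddReward_le M I hβ hF f)] at hle
  rw [sub_le_iff_le_add, hreward, ← Finset.sum_add_distrib]
  refine hle.trans_eq (Finset.sum_congr rfl fun h _ => integral_add ?_ ?_)
  · exact integrable_of_abs_le ((measurable_residual_right M I h f).comp (measurable_pi_apply h))
      fun ζ => abs_residual_le M I h hβ hF f (ζ h)
  · exact integrable_of_abs_le ((measurable_stepReward M h).comp (measurable_pi_apply h))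
      fun ζ => abs_stepReward_le M h (ζ h)

end Performance

section Optimism

variable {H : ℕ} {X A B : Type*} [MeasurableSpace X]
  [Fintype A] [MeasurableSpace A] [MeasurableSingletonClass A]
  [Fintype B] [MeasurableSpace B] [MeasurableSingletonClass B]
  {F : FunctionClass H X A B}

/-- `f` solves the optimality equation at step `h` up to the error `ε`, at almost every reachable
state. -/
def NearOptimal (M : MarkovGame H X A B) (ε : ℝ) (h : Fin H) (f : F.Elems) : Prop :=
  ∀ᵐ x ∂(reachMeasure M h), ∀ a b, |residual M h f (x, a, b)| ≤ ε

variable [Nonempty B] {M : MarkovGame H X A B}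
  {μ : Policy H X A} {ν : Policy H X B} {β ε : ℝ} {f : F.Elems}

theorem IsBestResponse.valueToGo_le_maxminValue (hν : IsBestResponse M μ ν)
    (I : InducedPolicies F) (hβ : 1 ≤ β) (hF : BoundedBy F β)
    (hf : ∀ h, NearOptimal M ε h f) (n h : ℕ) (hh : h + n = H) :
    ∀ᵐ x ∂(reachMeasure M h), valueToGo M μ ν n h hh x - n * ε ≤ maxminValue f h x := by
  have := M.markov
  induction n generalizing h with
  | zero =>
    refine .of_forall fun x => ?_
    simp [maxminValue_of_le f (show H ≤ h by omega), valueToGo, expectedCumulative_zero]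
  | succ n ih =>
    have hlt : h < H := by omega
    filter_upwards [hf ⟨h, hlt⟩, ae_ae_of_reachMeasure_succ M ⟨h, hlt⟩ (ih (h + 1) (by omega))]
      with x hres hnext
    refine le_trans (le_responseValue fun q hq => ?_)
      (responseValue_le_maxminValue I f hlt x (μ.mem ⟨h, hlt⟩ x))
    refine (sub_le_sub_right (hν.valueToGo_le_payoff n h hh x hq) _).trans ?_
    conv_lhs => rw [← payoff_const (μ.mem ⟨h, hlt⟩ x) hq ((n + 1 : ℕ) * ε)]
    rw [← payoff_sub]
    refine payoff_mono (μ.mem _ _) hq fun a b => ?_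
    have hV : Integrable (valueToGo M μ ν n (h + 1) (by omega)) (M.P ⟨h, hlt⟩ (x, a, b)) :=
      .of_mem_Icc 0 n (measurable_valueToGo M μ ν n _ _).aemeasurable
        (.of_forall (valueToGo_mem_Icc M μ ν n _ _))
    have hint := integral_mono_ae (hV.sub (integrable_const (n * ε)))
      (integrable_maxminValue I hβ hF f _) (hnext a b)
    rw [integral_sub' hV (integrable_const _)] at hint
    have hlow := (abs_le.1 (hres a b)).1
    simp only [residual, bellman, backup, integral_const, probReal_univ, one_smul] at hlow hint ⊢
    push_cast
    linarith

theorem IsBestResponse.initValue_le_maxminValue (hν : IsBestResponse M μ ν)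
    (I : InducedPolicies F) (hβ : 1 ≤ β) (hF : BoundedBy F β)
    (hf : ∀ h, NearOptimal M ε h f) :
    initValue M μ ν - H * ε ≤ maxminValue f 0 M.init := by
  have hae := hν.valueToGo_le_maxminValue I hβ hF hf H 0 (zero_add H)
  rwa [reachMeasure, ae_dirac_iff] at hae
  exact measurableSet_le ((measurable_valueToGo M μ ν H 0 _).sub_const _)
    (measurable_maxminValue_right I f 0)

end Optimism

/-! ### The excess loss over the Bayes predictor -/

section Regression

theorem exp_neg_le_one_sub {y : ℝ} (hy₀ : 0 ≤ y) (hy₁ : y ≤ 1 / 2) :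
    Real.exp (-y) ≤ 1 - 2 / 3 * y := by
  rw [Real.exp_neg]
  refine (inv_anti₀ (by linarith) (by linarith [Real.add_one_le_exp y] :
    1 + y ≤ Real.exp y)).trans ?_
  rw [inv_le_iff_one_le_mul₀ (by linarith)]
  nlinarith

variable {Ω : Type*} [MeasurableSpace Ω] (P : Measure Ω) [IsProbabilityMeasure P] {V : Ω → ℝ}
  {β θ d : ℝ}

theorem lintegral_exp_regression_le (hVm : Measurable V) (hβ : 1 ≤ β)
    (hV : ∀ ω, V ω ∈ Set.Icc 0 (β - 1)) (hd : |d| ≤ β) (hθ₀ : 0 ≤ θ) (hθ : θ * β ^ 2 ≤ 1 / 2) :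
    ∫⁻ ω, ENNReal.ofReal (Real.exp (-θ * (d ^ 2 + 2 * d * (∫ ω', V ω' ∂P - V ω)))) ∂P ≤
      ENNReal.ofReal (1 - θ / 2 * d ^ 2) := by
  have hoeffding := hasSubgaussianMGF_of_mem_Icc (μ := P) hVm.aemeasurable (.of_forall hV)
  have hmgf := hoeffding.mgf_le (2 * θ * d)
  have hvar : (((‖β - 1 - 0‖₊ / 2) ^ 2 : NNReal) : ℝ) = ((β - 1) / 2) ^ 2 := by
    push_cast
    rw [sub_zero, Real.norm_of_nonneg (by linarith)]
  rw [hvar, mgf] at hmgf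
  have hfactor : ∀ ω, Real.exp (-θ * (d ^ 2 + 2 * d * (∫ ω', V ω' ∂P - V ω))) =
      Real.exp (-θ * d ^ 2) * Real.exp (2 * θ * d * (V ω - ∫ ω', V ω' ∂P)) := fun ω => by
    rw [← Real.exp_add]
    ring_nf
  have hd2 : θ * d ^ 2 ≤ 1 / 2 := (mul_le_mul_of_nonneg_left (sq_le_sq.2
    (hd.trans (le_abs_self β))) hθ₀).trans hθ
  have hβ2 : θ * (β - 1) ^ 2 ≤ 1 / 2 := (mul_le_mul_of_nonneg_left (by nlinarith) hθ₀).trans hθ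
  simp only [hfactor]
  rw [← ofReal_integral_eq_lintegral_ofReal ((hoeffding.integrable_exp_mul _).const_mul _)
    (.of_forall fun ω => by positivity), integral_const_mul]
  refine ENNReal.ofReal_le_ofReal ?_
  calc Real.exp (-θ * d ^ 2) * ∫ ω, Real.exp (2 * θ * d * (V ω - ∫ ω', V ω' ∂P)) ∂P
      ≤ Real.exp (-θ * d ^ 2) * Real.exp (((β - 1) / 2) ^ 2 * (2 * θ * d) ^ 2 / 2) := by gcongr
    _ = Real.exp (-(θ * d ^ 2) + θ * d ^ 2 * (θ * (β - 1) ^ 2) / 2) := by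
        rw [← Real.exp_add]
        ring_nf
    _ ≤ Real.exp (-(θ * d ^ 2) + θ * d ^ 2 * (1 / 2) / 2) := by gcongr
    _ = Real.exp (-(3 / 4 * (θ * d ^ 2))) := by ring_nf
    _ ≤ 1 - 2 / 3 * (3 / 4 * (θ * d ^ 2)) := exp_neg_le_one_sub (by positivity) (by linarith)
    _ = 1 - θ / 2 * d ^ 2 := by ring

end Regression

section Excess

variable {H : ℕ} {X A B : Type*} [MeasurableSpace X] [MeasurableSpace A] [MeasurableSpace B]

theorem measurable_nextState (h : Fin H) :
    Measurable fun ζ : Traj H X A B => nextState ζ h := by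
  unfold nextState
  split_ifs <;> fun_prop

variable [Fintype A] [Fintype B] {F : FunctionClass H X A B}

/-- The noise `E[V_{f,h+1}(x^{h+1}) | x^h, a^h, b^h] - V_{f,h+1}(x^{h+1})` of the regression
target. -/
def noise (M : MarkovGame H X A B) (h : Fin H) (f : F.Elems) (ζ : Traj H X A B) : ℝ :=
  ∫ x', maxminValue f (h + 1) x' ∂(M.P h (ζ h)) - maxminValue f (h + 1) (nextState ζ h)

/-- The squared loss of `f^h` on one episode minus that of the Bellman backup `T_h f`; see
`sqLoss_eq_excessLoss`. -/
def excessLoss (M : MarkovGame H X A B) (h : Fin H) (f : F.Elems) (ζ : Traj H X A B) : ℝ :=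
  residual M h f (ζ h) ^ 2 + 2 * residual M h f (ζ h) * noise M h f ζ

theorem sqLoss_eq_excessLoss (M : MarkovGame H X A B) (h : Fin H) (f : F.Elems) {t : ℕ}
    (S : Fin t → Traj H X A B) :
    sqLoss M h (f h).1 (maxminValue f (h + 1)) S =
      ∑ s, excessLoss M h f (S s) + ∑ s, noise M h f (S s) ^ 2 := by
  rw [sqLoss, ← Finset.sum_add_distrib]
  refine Finset.sum_congr rfl fun s _ => ?_
  simp only [excessLoss, noise, residual, bellman, backup]
  ring

variable (M : MarkovGame H X A B) (I : InducedPolicies F) (h : Fin H) {β θ ε : ℝ}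

include I in
theorem abs_noise_le (hβ : 1 ≤ β) (hF : BoundedBy F β) (f : F.Elems) (ζ : Traj H X A B) :
    |noise M h f ζ| ≤ β := by
  have hnext := maxminValue_mem_Icc I hβ hF f (h + 1) (nextState ζ h)
  have hmean := integral_transition_mem_Icc M h (measurable_maxminValue_right I f (h + 1))
    (maxminValue_mem_Icc I hβ hF f (h + 1)) (ζ h)
  rw [noise, abs_le]
  constructor <;> linarith [hnext.1, hnext.2, hmean.1, hmean.2]

include I in
theorem abs_excessLoss_le_of_residual (hβ : 1 ≤ β) (hF : BoundedBy F β) (f : F.Elems)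
    (ζ : Traj H X A B) (hε : |residual M h f (ζ h)| ≤ ε) :
    |excessLoss M h f ζ| ≤ ε ^ 2 + 2 * ε * β := by
  have hε₀ : 0 ≤ ε := (abs_nonneg _).trans hε
  have hnoise := abs_noise_le M I h hβ hF f ζ
  rw [excessLoss]
  refine (abs_add_le _ _).trans (add_le_add ?_ ?_)
  · rw [abs_pow]
    gcongr
  · rw [abs_mul, abs_mul, abs_two]
    gcongr

include I in
theorem abs_excessLoss_le (hβ : 1 ≤ β) (hF : BoundedBy F β) (f : F.Elems) (ζ : Traj H X A B) :
    |excessLoss M h f ζ| ≤ 3 * β ^ 2 :=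
  (abs_excessLoss_le_of_residual M I h hβ hF f ζ (abs_residual_le M I h hβ hF f _)).trans_eq
    (by ring)

include I in
theorem residual_sq_le (hβ : 1 ≤ β) (hF : BoundedBy F β) (f : F.Elems) (z : X × A × B) :
    residual M h f z ^ 2 ≤ β ^ 2 :=
  sq_le_sq.2 ((abs_residual_le M I h hβ hF f z).trans (le_abs_self β))

variable [MeasurableSingletonClass A] [MeasurableSingletonClass B]

include I in
theorem measurable_noise :
    Measurable fun p : F.Elems × Traj H X A B => noise M h p.1 p.2 := by
  have hbellman := (measurable_bellman M I h).comp (by fun_prop :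
    Measurable fun p : F.Elems × Traj H X A B => (p.1, p.2 h))
  have hreward := (measurable_reward M h).comp (by fun_prop :
    Measurable fun p : F.Elems × Traj H X A B => p.2 h)
  have hnext := (measurable_maxminValue I (h + 1)).comp (measurable_fst.prodMk
    ((measurable_nextState h).comp measurable_snd) :
    Measurable fun p : F.Elems × Traj H X A B => (p.1, nextState p.2 h))
  convert (hbellman.sub hreward).sub hnext using 1
  funext p
  simp [noise, bellman, backup]

include I in
theorem measurable_excessLoss :
    Measurable fun p : F.Elems × Traj H X A B => excessLoss M h p.1 p.2 := by
  have hres := (measurable_residual M I h).comp (by fun_prop :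
    Measurable fun p : F.Elems × Traj H X A B => (p.1, p.2 h))
  exact (hres.pow_const 2).add ((hres.const_mul 2).mul (measurable_noise M I h))

include I in
theorem measurable_excessLoss_right (f : F.Elems) :
    Measurable fun ζ : Traj H X A B => excessLoss M h f ζ := by
  have := (measurable_excessLoss M I h).comp (measurable_prodMk_left (x := f))
  exact this

include I in
theorem lintegral_exp_excessLoss_le_lintegral (hβ : 1 ≤ β) (hF : BoundedBy F β) (hθ₀ : 0 ≤ θ)
    (hθ : θ * β ^ 2 ≤ 1 / 2) (f : F.Elems) (μ : Policy H X A) (ν : Policy H X B) :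
    ∫⁻ ζ, ENNReal.ofReal (Real.exp (-θ * excessLoss M h f ζ)) ∂(episodeLaw M μ ν) ≤
      ∫⁻ ζ, ENNReal.ofReal (1 - θ / 2 * residual M h f (ζ h) ^ 2) ∂(episodeLaw M μ ν) := by
  have := M.markov
  have hVm := measurable_maxminValue_right I f (h + 1)
  by_cases hh : (h : ℕ) + 1 < H
  · have hres : Measurable fun w : (X × A × B) × X => residual M h f w.1 :=
      (measurable_residual_right M I h f).comp measurable_fst
    have hmean : Measurable fun w : (X × A × B) × X =>
        ∫ x', maxminValue f (h + 1) x' ∂(M.P h w.1) :=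
      (hVm.stronglyMeasurable.integral_kernel (κ := M.P h)).measurable.comp measurable_fst
    have hloss : Measurable fun w : (X × A × B) × X => ENNReal.ofReal (Real.exp (-θ *
        (residual M h f w.1 ^ 2 + 2 * residual M h f w.1 *
          (∫ x', maxminValue f (h + 1) x' ∂(M.P h w.1) - maxminValue f (h + 1) w.2)))) :=
      (((hres.pow_const 2).add ((hres.const_mul 2).mul
        (hmean.sub (hVm.comp measurable_snd)))).const_mul (-θ)).exp.ennreal_ofReal
    simp only [excessLoss, noise, nextState, dif_pos hh]
    rw [episodeLaw, lintegral_rollout_next M μ ν H 0 (by omega) h ⟨h + 1, hh⟩ rfl h (by simp)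
      M.init hloss]
    exact lintegral_mono fun ζ => lintegral_exp_regression_le _ hVm hβ
      (maxminValue_mem_Icc I hβ hF f (h + 1)) (abs_residual_le M I h hβ hF f _) hθ₀ hθ
  · refine lintegral_mono fun ζ => ENNReal.ofReal_le_ofReal ?_
    have hnoise : noise M h f ζ = 0 := by
      simp [noise, maxminValue_of_le f (show H ≤ (h : ℕ) + 1 by omega)]
    have hsq : 0 ≤ θ * residual M h f (ζ h) ^ 2 := by positivity
    rw [excessLoss, hnoise, mul_zero, add_zero, neg_mul]
    refine (exp_neg_le_one_sub hsq ((mul_le_mul_of_nonneg_left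
      (residual_sq_le M I h hβ hF f (ζ h)) hθ₀).trans hθ)).trans ?_
    linarith

/-- The mean square residual of `f` at step `h` when `(μ, ν)` is played. -/
def meanSq (f : F.Elems) (μ : Policy H X A) (ν : Policy H X B) : ℝ :=
  ∫ ζ, residual M h f (ζ h) ^ 2 ∂(episodeLaw M μ ν)

include I in
theorem integrable_residual_sq (hβ : 1 ≤ β) (hF : BoundedBy F β) (f : F.Elems)
    (μ : Policy H X A) (ν : Policy H X B) :
    Integrable (fun ζ => residual M h f (ζ h) ^ 2) (episodeLaw M μ ν) :=
  integrable_of_abs_le (((measurable_residual_right M I h f).comp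
    (measurable_pi_apply h)).pow_const 2) (c := β ^ 2) fun ζ => by
      rw [abs_of_nonneg (sq_nonneg _)]
      exact residual_sq_le M I h hβ hF f _

include I in
theorem lintegral_exp_excessLoss_le (hβ : 1 ≤ β) (hF : BoundedBy F β) (hθ₀ : 0 ≤ θ)
    (hθ : θ * β ^ 2 ≤ 1 / 2) (f : F.Elems) (μ : Policy H X A) (ν : Policy H X B) :
    ∫⁻ ζ, ENNReal.ofReal (Real.exp (-θ * excessLoss M h f ζ)) ∂(episodeLaw M μ ν) ≤
      ENNReal.ofReal (Real.exp (-(θ / 2) * meanSq M h f μ ν)) := by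
  refine (lintegral_exp_excessLoss_le_lintegral M I h hβ hF hθ₀ hθ f μ ν).trans ?_
  have hint := (integrable_residual_sq M I h hβ hF f μ ν).const_mul (θ / 2)
  have hnonneg : ∀ ζ : Traj H X A B, 0 ≤ 1 - θ / 2 * residual M h f (ζ h) ^ 2 := fun ζ => by
    linarith [mul_le_mul_of_nonneg_left (residual_sq_le M I h hβ hF f (ζ h)) hθ₀]
  rw [← ofReal_integral_eq_lintegral_ofReal (f := fun ζ : Traj H X A B =>
      1 - θ / 2 * residual M h f (ζ h) ^ 2) ((integrable_const _).sub hint) (.of_forall hnonneg),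
    integral_sub (integrable_const _) hint, integral_const_mul]
  refine ENNReal.ofReal_le_ofReal ?_
  have := Real.add_one_le_exp (-(θ / 2) * meanSq M h f μ ν)
  simp only [meanSq, integral_const, probReal_univ, one_smul] at this ⊢
  linarith

end Excess

/-! ### Measurability of the algorithm -/

section Tilted

variable {E : Type*} [MeasurableSpace E] (P : Measure E)

theorem measurable_tilted {Θ : Type*} [MeasurableSpace Θ] [SFinite P] {W : Θ → E → ℝ}
    (hW : Measurable fun p : Θ × E => W p.1 p.2) : Measurable fun θ => P.tilted (W θ) := by
  have hZ : Measurable fun θ => ∫ e, Real.exp (W θ e) ∂P :=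
    (StronglyMeasurable.integral_prod_right (f := fun θ e => Real.exp (W θ e))
      hW.exp.stronglyMeasurable).measurable
  refine Measure.measurable_of_measurable_coe _ fun s hs => ?_
  simp only [Measure.tilted, withDensity_apply _ hs]
  exact Measurable.lintegral_prod_right' (f := fun p : Θ × E =>
    ENNReal.ofReal (Real.exp (W p.1 p.2) / ∫ e, Real.exp (W p.1 e) ∂P))
    (hW.exp.div (hZ.comp measurable_fst)).ennreal_ofReal

theorem integrable_exp_of_abs_le [IsFiniteMeasure P] {W : E → ℝ} (hW : Measurable W) {c : ℝ}
    (hc : ∀ e, |W e| ≤ c) : Integrable (fun e => Real.exp (W e)) P :=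
  integrable_of_abs_le hW.exp (c := Real.exp c) fun e => by
    rw [Real.abs_exp]
    exact Real.exp_le_exp.2 ((le_abs_self _).trans (hc e))

theorem isProbabilityMeasure_tilted_of_abs_le [IsFiniteMeasure P] [NeZero P] {W : E → ℝ}
    (hW : Measurable W) {c : ℝ} (hc : ∀ e, |W e| ≤ c) : IsProbabilityMeasure (P.tilted W) :=
  isProbabilityMeasure_tilted (integrable_exp_of_abs_le P hW hc)

end Tilted

section Play

variable {H : ℕ} {X A B : Type*} [MeasurableSpace X]
  [Fintype A] [MeasurableSpace A] [Fintype B] [MeasurableSpace B]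

theorem measurable_rollout {Θ : Type*} [MeasurableSpace Θ] (M : MarkovGame H X A B)
    (μ : Θ → Policy H X A) (ν : Θ → Policy H X B)
    (hμ : ∀ h a, Measurable fun w : Θ × X => (μ w.1).prob h w.2 a)
    (hν : ∀ h b, Measurable fun w : Θ × X => (ν w.1).prob h w.2 b) (n h : ℕ) (hh : h + n = H) :
    Measurable fun w : Θ × X => rollout M (μ w.1) (ν w.1) n h hh w.2 := by
  have := M.markov
  induction n generalizing h with
  | zero => simp only [rollout, Kernel.const_apply, measurable_const]
  | succ n ih =>
    refine Measure.measurable_of_measurable_coe _ fun s hs => ?_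
    simp only [← lintegral_indicator_one hs,
      lintegral_rollout_succ M _ _ n h hh _ (measurable_one.indicator hs)]
    refine Finset.measurable_sum _ fun a _ => Finset.measurable_sum _ fun b _ => ?_
    refine (((hμ ⟨h, by omega⟩ a).mul (hν ⟨h, by omega⟩ b)).ennreal_ofReal).mul ?_
    let K : Kernel (Θ × X) (Traj n X A B) := ⟨_, ih (h + 1) (by omega)⟩
    have : IsMarkovKernel K := ⟨fun w => inferInstanceAs
      (IsProbabilityMeasure (rollout M (μ w.1) (ν w.1) n (h + 1) (by omega) w.2))⟩
    have hnext : Measurable fun w : (Θ × X) × X => (w.1.1, w.2) := by fun_prop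
    have hcur : Measurable fun w : Θ × X => (w.2, a, b) := by fun_prop
    have hinner : Measurable fun w : (Θ × X) × X =>
        ∫⁻ ζ, s.indicator (1 : Traj (n + 1) X A B → ℝ≥0∞) (Fin.cons (w.1.2, a, b) ζ)
          ∂(K.comap _ hnext w) :=
      Measurable.lintegral_kernel_prod_right (f := fun (w : (Θ × X) × X) ζ =>
        s.indicator (1 : Traj (n + 1) X A B → ℝ≥0∞) (Fin.cons (w.1.2, a, b) ζ))
        ((measurable_one.indicator hs).comp (measurable_cons.comp (by fun_prop :
          Measurable fun p : ((Θ × X) × X) × Traj n X A B => ((p.1.1.2, a, b), p.2))))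
    have houter : Measurable fun w : Θ × X => ∫⁻ x',
        ∫⁻ ζ, s.indicator (1 : Traj (n + 1) X A B → ℝ≥0∞) (Fin.cons (w.2, a, b) ζ)
          ∂(K (w.1, x')) ∂((M.P ⟨h, by omega⟩).comap _ hcur w) :=
      Measurable.lintegral_kernel_prod_right (f := fun (w : Θ × X) x' =>
        ∫⁻ ζ, s.indicator (1 : Traj (n + 1) X A B → ℝ≥0∞) (Fin.cons (w.2, a, b) ζ)
          ∂(K (w.1, x'))) hinner
    exact houter

variable {F : FunctionClass H X A B}

/-- The kernel that sends `(f, g)` to the law of an episode under `(μ_f, ν_{f,g})`. -/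
def playKernel (M : MarkovGame H X A B) (I : InducedPolicies F) :
    Kernel (F.Elems × F.Elems) (Traj H X A B) where
  toFun p := episodeLaw M (I.maxPolicy p.1) (I.minPolicy p.1 p.2)
  measurable' := by
    have hrollout := measurable_rollout M (fun p : F.Elems × F.Elems => I.maxPolicy p.1)
      (fun p => I.minPolicy p.1 p.2)
      (fun h a => (I.measurable_mu h a).comp (by fun_prop : Measurable
        fun w : (F.Elems × F.Elems) × X => (w.1.1 h, w.2)))
      (fun h b => (I.measurable_nu h b).comp (by fun_prop : Measurable
        fun w : (F.Elems × F.Elems) × X => ((w.1.1 h, w.1.2 h), w.2))) H 0 (by omega)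
    exact hrollout.comp (measurable_prodMk_right (y := M.init))

instance (M : MarkovGame H X A B) (I : InducedPolicies F) : IsMarkovKernel (playKernel M I) :=
  ⟨fun p => inferInstanceAs
    (IsProbabilityMeasure (episodeLaw M (I.maxPolicy p.1) (I.minPolicy p.1 p.2)))⟩

end Play

section Likelihood

variable {H : ℕ} {X A B : Type*} [MeasurableSpace X] [MeasurableSpace A] [MeasurableSpace B]
  {F : FunctionClass H X A B} (M : MarkovGame H X A B) (p₀ : (h : Fin H) → Measure (F.Elem h))
  {β η a : ℝ} (h : Fin H) {t : ℕ}

theorem sqLoss_mem_Icc (hF : BoundedBy F β) (u : F.Elem h) {V : X → ℝ}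
    (hV : ∀ x, V x ∈ Set.Icc 0 (β - 1)) (S : Fin t → Traj H X A B) :
    sqLoss M h u.1 V S ∈ Set.Icc 0 (t * β ^ 2) := by
  refine ⟨Finset.sum_nonneg fun s _ => sq_nonneg _, ?_⟩
  calc sqLoss M h u.1 V S ≤ ∑ _s : Fin t, β ^ 2 := Finset.sum_le_sum fun s _ => by
        have hu := hF h _ u.2 (S s h).1 (S s h).2.1 (S s h).2.2
        have hr := M.r_mem h (S s h).1 (S s h).2.1 (S s h).2.2
        have hnext := hV (nextState (S s) h)
        exact sq_le_sq' (by linarith [hu.1, hr.2, hnext.2]) (by linarith [hu.2, hr.1, hnext.1])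
    _ = t * β ^ 2 := by simp

variable [Finite A] [Finite B] [MeasurableSingletonClass A] [MeasurableSingletonClass B]
  {Θ : Type*} [MeasurableSpace Θ]

theorem measurable_sqLoss {u : Θ → F.Elem h} (hu : Measurable u) {V : Θ → X → ℝ}
    (hV : Measurable fun p : Θ × X => V p.1 p.2) {S : Θ → Fin t → Traj H X A B}
    (hS : Measurable S) : Measurable fun θ => sqLoss M h (u θ).1 (V θ) (S θ) := by
  unfold sqLoss
  refine Finset.measurable_sum _ fun s _ => Measurable.pow_const (Measurable.sub
    (Measurable.sub ?_ ?_) ?_) 2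
  · exact (measurable_elem h).comp (by fun_prop : Measurable fun θ => (u θ, S θ s h))
  · exact (measurable_reward M h).comp (by fun_prop : Measurable fun θ => S θ s h)
  · exact hV.comp (measurable_id.prodMk
      ((measurable_nextState h).comp ((measurable_pi_apply s).comp hS)))

variable [∀ h, IsProbabilityMeasure (p₀ h)]

theorem measurable_logLikelihood {u : Θ → F.Elem h} (hu : Measurable u) {V : Θ → X → ℝ}
    (hV : Measurable fun p : Θ × X => V p.1 p.2) {S : Θ → Fin t → Traj H X A B}
    (hS : Measurable S) : Measurable fun θ => logLikelihood M p₀ η h (u θ) (V θ) (S θ) := by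
  have hloss : Measurable fun p : Θ × F.Elem h => sqLoss M h p.2.1 (V p.1) (S p.1) :=
    measurable_sqLoss M h (u := Prod.snd) measurable_snd (V := fun p => V p.1)
      (hV.comp (by fun_prop : Measurable fun p : (Θ × F.Elem h) × X => (p.1.1, p.2)))
      (S := fun p => S p.1) (hS.comp measurable_fst)
  exact ((measurable_sqLoss M h hu hV hS).const_mul _).sub <| Measurable.log <|
    (StronglyMeasurable.integral_prod_right (f := fun θ (u' : F.Elem h) =>
      Real.exp (-η * sqLoss M h u'.1 (V θ) (S θ)))
      (hloss.const_mul (-η)).exp.stronglyMeasurable).measurable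

theorem abs_logLikelihood_le (hF : BoundedBy F β) (hη : 0 ≤ η) (u : F.Elem h) {V : X → ℝ}
    (hVm : Measurable V) (hV : ∀ x, V x ∈ Set.Icc 0 (β - 1)) (S : Fin t → Traj H X A B) :
    |logLikelihood M p₀ η h u V S| ≤ η * (t * β ^ 2) := by
  have hloss : ∀ u : F.Elem h, η * sqLoss M h u.1 V S ∈ Set.Icc 0 (η * (t * β ^ 2)) := fun u =>
    have := sqLoss_mem_Icc M h hF u hV S
    ⟨mul_nonneg hη this.1, mul_le_mul_of_nonneg_left this.2 hη⟩
  have hint : Integrable (fun u' : F.Elem h => Real.exp (-η * sqLoss M h u'.1 V S)) (p₀ h) :=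
    integrable_exp_of_abs_le _ (((measurable_sqLoss M h measurable_id (V := fun _ => V)
      (hVm.comp measurable_snd) (S := fun _ => S) measurable_const).const_mul (-η)))
      (c := η * (t * β ^ 2)) fun u' => by
        rw [neg_mul, abs_neg, abs_of_nonneg (hloss u').1]
        exact (hloss u').2
  have hle : ∫ u' : F.Elem h, Real.exp (-η * sqLoss M h u'.1 V S) ∂(p₀ h) ≤ 1 :=
    (integral_mono hint (integrable_const 1) fun u' =>
      Real.exp_le_one_iff.2 (by linarith [(hloss u').1])).trans_eq (by simp)
  have hge : Real.exp (-(η * (t * β ^ 2))) ≤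
      ∫ u' : F.Elem h, Real.exp (-η * sqLoss M h u'.1 V S) ∂(p₀ h) :=
    Eq.trans_le (by simp) (integral_mono (integrable_const (Real.exp (-(η * (t * β ^ 2))))) hint
      fun u' => Real.exp_le_exp.2 (by linarith [(hloss u').2]))
  have hpos := (Real.exp_pos _).trans_le hge
  have hlog := Real.log_nonpos hpos.le hle
  have hlog' := (Real.le_log_iff_exp_le hpos).2 hge
  rw [logLikelihood, abs_le]
  constructor <;> linarith [(hloss u).1, (hloss u).2]

/-- The exponent in the density of a posterior: the optimistic term `a V_1(x^1)` plus the
log-likelihoods, for value functions `V f h` attached to the members `f` of the class. The main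
agent has `a = lam` and `V_f = V_{f,h}`, the booster agent `a = -lam` and `V_g = V_{g,h}^μ`. -/
def posteriorExponent (η a : ℝ) (V : F.Elems → ℕ → X → ℝ) (S : Fin t → Traj H X A B)
    (f : F.Elems) : ℝ :=
  a * V f 0 M.init + ∑ h, logLikelihood M p₀ η h (f h) (V f (h + 1)) S

theorem measurable_posteriorExponent {V : Θ → F.Elems → ℕ → X → ℝ}
    (hV : ∀ h, Measurable fun p : (Θ × F.Elems) × X => V p.1.1 p.1.2 h p.2)
    {S : Θ → Fin t → Traj H X A B} (hS : Measurable S) :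
    Measurable fun p : Θ × F.Elems => posteriorExponent M p₀ η a (V p.1) (S p.1) p.2 :=
  (((hV 0).comp (measurable_prodMk_right (y := M.init))).const_mul a).add <|
    Finset.measurable_sum _ fun h _ =>
      measurable_logLikelihood M p₀ h (u := fun p : Θ × F.Elems => p.2 h) (by fun_prop)
        (hV (h + 1)) (hS.comp measurable_fst)

theorem abs_posteriorExponent_le (hF : BoundedBy F β) (hη : 0 ≤ η) {V : F.Elems → ℕ → X → ℝ}
    (hVm : ∀ f h, Measurable (V f h)) (hV : ∀ f h x, V f h x ∈ Set.Icc 0 (β - 1))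
    (S : Fin t → Traj H X A B) (f : F.Elems) :
    |posteriorExponent M p₀ η a V S f| ≤ |a| * β + H * (η * (t * β ^ 2)) := by
  refine (abs_add_le _ _).trans (add_le_add ?_ ?_)
  · have hinit := hV f 0 M.init
    rw [abs_mul, abs_of_nonneg hinit.1]
    exact mul_le_mul_of_nonneg_left (by linarith [hinit.2]) (abs_nonneg _)
  · refine (Finset.abs_sum_le_sum_abs _ _).trans ((Finset.sum_le_sum fun h _ =>
      abs_logLikelihood_le M p₀ h hF hη (f h) (hVm f _) (hV f _) S).trans_eq ?_)
    simp

end Likelihood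

section Posteriors

variable {H : ℕ} {X A B : Type*} [MeasurableSpace X]
  [Fintype A] [MeasurableSpace A] [MeasurableSingletonClass A]
  [Fintype B] [MeasurableSpace B] [MeasurableSingletonClass B]
  {F : FunctionClass H X A B} (M : MarkovGame H X A B) (I : InducedPolicies F)
  (p₀ : (h : Fin H) → Measure (F.Elem h)) [∀ h, IsProbabilityMeasure (p₀ h)] {β η lam : ℝ} {t : ℕ}

include I in
theorem measurable_mainExponent : Measurable fun p : (Fin t → Traj H X A B) × F.Elems =>
    posteriorExponent M p₀ η lam maxminValue p.1 p.2 := by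
  have hV : ∀ h, Measurable fun p : ((Fin t → Traj H X A B) × F.Elems) × X =>
      maxminValue p.1.2 h p.2 := fun h => by
    have := (measurable_maxminValue I h).comp (by fun_prop : Measurable
      fun p : ((Fin t → Traj H X A B) × F.Elems) × X => (p.1.2, p.2))
    exact this
  have := measurable_posteriorExponent M p₀ (η := η) (a := lam)
    (V := fun _ : Fin t → Traj H X A B => maxminValue) hV measurable_id
  exact this

include I in
theorem abs_mainExponent_le (hβ : 1 ≤ β) (hF : BoundedBy F β) (hη : 0 ≤ η)
    (S : Fin t → Traj H X A B) (f : F.Elems) :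
    |posteriorExponent M p₀ η lam maxminValue S f| ≤ |lam| * β + H * (η * (t * β ^ 2)) :=
  abs_posteriorExponent_le M p₀ hF hη (fun f h => measurable_maxminValue_right I f h)
    (fun f h x => maxminValue_mem_Icc I hβ hF f h x) S f

include I in
theorem isProbabilityMeasure_mainPosterior (hβ : 1 ≤ β) (hF : BoundedBy F β) (hη : 0 ≤ η)
    (S : Fin t → Traj H X A B) : IsProbabilityMeasure (mainPosterior M p₀ η lam S) := by
  have hm : Measurable fun f => posteriorExponent M p₀ η lam maxminValue S f := by
    have := (measurable_mainExponent M I p₀ (η := η) (lam := lam)).comp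
      (measurable_prodMk_left (x := S))
    exact this
  have := isProbabilityMeasure_tilted_of_abs_le (Measure.pi p₀) hm
    (abs_mainExponent_le M I p₀ hβ hF hη S)
  exact this

theorem measurable_boosterExponent :
    Measurable fun p : ((Fin t → Traj H X A B) × F.Elems) × F.Elems =>
      posteriorExponent M p₀ η (-lam) (policyValue (I.maxPolicy p.1.2)) p.1.1 p.2 := by
  have hV : ∀ h, Measurable fun p : (((Fin t → Traj H X A B) × F.Elems) × F.Elems) × X =>
      policyValue (I.maxPolicy p.1.1.2) p.1.2 h p.2 := fun h => by
    have := (measurable_policyValue I h).comp (by fun_prop : Measurable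
      fun p : (((Fin t → Traj H X A B) × F.Elems) × F.Elems) × X => ((p.1.1.2, p.1.2), p.2))
    exact this
  have := measurable_posteriorExponent M p₀ (η := η) (a := -lam)
    (V := fun p : (Fin t → Traj H X A B) × F.Elems => policyValue (I.maxPolicy p.2)) hV
    measurable_fst
  exact this

theorem isProbabilityMeasure_boosterPosterior (hβ : 1 ≤ β) (hF : BoundedBy F β) (hη : 0 ≤ η)
    (S : Fin t → Traj H X A B) (f : F.Elems) :
    IsProbabilityMeasure (boosterPosterior M p₀ η lam (I.maxPolicy f) S) := by
  have hm : Measurable fun g =>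
      posteriorExponent M p₀ η (-lam) (policyValue (I.maxPolicy f)) S g := by
    have := (measurable_boosterExponent M I p₀ (η := η) (lam := lam)).comp
      (measurable_prodMk_left (x := (S, f)))
    exact this
  have := isProbabilityMeasure_tilted_of_abs_le (Measure.pi p₀) hm
    (abs_posteriorExponent_le M p₀ hF hη (fun g h => measurable_policyValue_right I f g h)
      (fun g h x => policyValue_mem_Icc I hβ hF f g h x) S)
  exact this

/-- The posterior of the main agent as a kernel from histories. -/
def mainKernel (η lam : ℝ) (t : ℕ) : Kernel (Fin t → Traj H X A B) F.Elems where
  toFun S := mainPosterior M p₀ η lam S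
  measurable' := by
    have := measurable_tilted (Measure.pi p₀)
      (measurable_mainExponent M I p₀ (η := η) (lam := lam) (t := t))
    exact this

/-- The posterior of the booster agent as a kernel from histories and choices of the main agent. -/
def boosterKernel (η lam : ℝ) (t : ℕ) :
    Kernel ((Fin t → Traj H X A B) × F.Elems) F.Elems where
  toFun p := boosterPosterior M p₀ η lam (I.maxPolicy p.2) p.1
  measurable' := by
    have := measurable_tilted (Measure.pi p₀)
      (W := fun (p : (Fin t → Traj H X A B) × F.Elems) (g : F.Elems) =>
        posteriorExponent M p₀ η (-lam) (policyValue (I.maxPolicy p.2)) p.1 g)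
      (measurable_boosterExponent M I p₀)
    exact this

end Posteriors

/-! ### Adaptive sampling -/

section AdaptiveSampling

variable {E E' : Type*} [MeasurableSpace E] [MeasurableSpace E']

theorem measurable_snoc (t : ℕ) :
    Measurable fun p : (Fin t → E) × E => (Fin.snoc p.1 p.2 : Fin (t + 1) → E) := by
  refine measurable_pi_iff.2 <| Fin.lastCases ?_ fun i => ?_
  · simpa only [Fin.snoc_last] using measurable_snd
  · simp only [Fin.snoc_castSucc]
    exact (measurable_pi_apply i).comp measurable_fst

theorem measurable_snoc_right {t : ℕ} (ω : Fin t → E) :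
    Measurable fun w => (Fin.snoc ω w : Fin (t + 1) → E) :=
  (measurable_snoc t).comp measurable_prodMk_left

/-- The joint law of `t` successive draws, where the draw after `ω` has the law `κ ω`. -/
def adaptiveLaw (κ : (t : ℕ) → Kernel (Fin t → E) E) : (t : ℕ) → Measure (Fin t → E)
  | 0 => Measure.dirac Fin.elim0
  | t + 1 => (adaptiveLaw κ t).bind fun ω =>
      (κ t ω).map fun w => (Fin.snoc ω w : Fin (t + 1) → E)

variable (κ : (t : ℕ) → Kernel (Fin t → E) E)

theorem measurable_map_snoc (t : ℕ) [IsSFiniteKernel (κ t)] :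
    Measurable fun ω => (κ t ω).map fun w => (Fin.snoc ω w : Fin (t + 1) → E) := by
  have hmap : ⇑((Kernel.id ×ₖ κ t).map fun p => (Fin.snoc p.1 p.2 : Fin (t + 1) → E)) =
      fun ω => (κ t ω).map fun w => (Fin.snoc ω w : Fin (t + 1) → E) := by
    ext1 ω
    rw [Kernel.map_apply _ (measurable_snoc t), Kernel.prod_apply, Kernel.id_apply,
      Measure.dirac_prod, Measure.map_map (measurable_snoc t) measurable_prodMk_left]
    rfl
  exact hmap ▸ Kernel.measurable _

variable [∀ t, IsMarkovKernel (κ t)]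

theorem lintegral_adaptiveLaw_succ (t : ℕ) {φ : (Fin (t + 1) → E) → ℝ≥0∞} (hφ : Measurable φ) :
    ∫⁻ ω, φ ω ∂(adaptiveLaw κ (t + 1)) =
      ∫⁻ ω, ∫⁻ w, φ (Fin.snoc ω w) ∂(κ t ω) ∂(adaptiveLaw κ t) := by
  rw [adaptiveLaw, Measure.lintegral_bind (measurable_map_snoc κ t).aemeasurable hφ.aemeasurable]
  exact lintegral_congr fun ω => lintegral_map hφ (measurable_snoc_right ω)

theorem adaptiveLaw_succ_eq_map_compProd (t : ℕ) [SFinite (adaptiveLaw κ t)] :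
    adaptiveLaw κ (t + 1) = (adaptiveLaw κ t ⊗ₘ κ t).map fun p => Fin.snoc p.1 p.2 := by
  refine Measure.ext_of_lintegral _ fun φ hφ => ?_
  rw [lintegral_adaptiveLaw_succ κ t hφ, lintegral_map hφ (measurable_snoc t)]
  exact (Measure.lintegral_compProd (hφ.comp (measurable_snoc t))).symm

instance isProbabilityMeasure_adaptiveLaw (t : ℕ) : IsProbabilityMeasure (adaptiveLaw κ t) := by
  induction t with
  | zero => unfold adaptiveLaw; infer_instance
  | succ t ih =>
    constructor
    simpa using lintegral_adaptiveLaw_succ κ t (φ := 1) measurable_one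

theorem map_adaptiveLaw {κ' : (t : ℕ) → Kernel (Fin t → E') E'} [∀ t, IsMarkovKernel (κ' t)]
    {g : E → E'} (hg : Measurable g) (hκ : ∀ t ω, (κ t ω).map g = κ' t (g ∘ ω)) (t : ℕ) :
    (adaptiveLaw κ t).map (g ∘ ·) = adaptiveLaw κ' t := by
  have hcomp : ∀ t, Measurable fun ω : Fin t → E => g ∘ ω := fun t =>
    measurable_pi_iff.2 fun i => hg.comp (measurable_pi_apply i)
  induction t with
  | zero =>
    rw [adaptiveLaw, adaptiveLaw, Measure.map_dirac' (hcomp 0), Subsingleton.elim (g ∘ _)]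
  | succ t ih =>
    refine Measure.ext_of_lintegral _ fun φ hφ => ?_
    have hsnoc : Measurable fun ω => ∫⁻ w, φ (Fin.snoc ω w) ∂(κ' t ω) :=
      Measurable.lintegral_kernel_prod_right' (κ := κ' t) (hφ.comp (measurable_snoc t))
    rw [lintegral_map hφ (hcomp _), lintegral_adaptiveLaw_succ κ t
        (φ := fun ω => φ (g ∘ ω)) (hφ.comp (hcomp _)),
      lintegral_adaptiveLaw_succ κ' t hφ, ← ih, lintegral_map hsnoc (hcomp t)]
    refine lintegral_congr fun ω => ?_
    simp only [← hκ, Fin.comp_snoc]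
    exact (lintegral_map (hφ.comp (measurable_snoc_right (g ∘ ω))) hg).symm

theorem map_castLE_adaptiveLaw {t T : ℕ} (htT : t ≤ T) :
    (adaptiveLaw κ T).map (fun ω (s : Fin t) => ω (Fin.castLE htT s)) = adaptiveLaw κ t := by
  induction T, htT using Nat.le_induction with
  | base => exact Measure.map_id
  | succ T htT ih =>
    rw [← ih]
    refine Measure.ext_of_lintegral _ fun φ hφ => ?_
    rw [lintegral_map hφ (by fun_prop), lintegral_map hφ (by fun_prop),
      lintegral_adaptiveLaw_succ κ T (φ := fun ω => φ fun s => ω (Fin.castLE _ s))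
        (hφ.comp (by fun_prop))]
    refine lintegral_congr fun ω => ?_
    have hinit : ∀ w, (fun s : Fin t => (Fin.snoc ω w : Fin (T + 1) → E)
        (Fin.castLE (htT.trans T.le_succ) s)) = fun s => ω (Fin.castLE htT s) := fun w =>
      funext fun s => Fin.snoc_castSucc (α := fun _ => E) w ω (Fin.castLE htT s)
    simp only [hinit, lintegral_const, measure_univ, mul_one]

theorem lintegral_prod_adaptiveLaw_le {φ : E → ℝ≥0∞} (hφ : Measurable φ)
    (hκ : ∀ t ω, ∫⁻ w, φ w ∂(κ t ω) ≤ 1) (t : ℕ) : ∫⁻ ω, ∏ s, φ (ω s) ∂(adaptiveLaw κ t) ≤ 1 := by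
  induction t with
  | zero => simp [adaptiveLaw]
  | succ t ih =>
    rw [lintegral_adaptiveLaw_succ κ t (φ := fun ω => ∏ s, φ (ω s))
      (Finset.measurable_prod _ fun s _ => hφ.comp (measurable_pi_apply s))]
    refine (lintegral_mono fun ω => ?_).trans ih
    simp only [Fin.prod_univ_castSucc, Fin.snoc_castSucc, Fin.snoc_last]
    rw [lintegral_const_mul _ hφ]
    exact mul_le_of_le_one_right' (hκ t ω)

theorem ae_forall_adaptiveLaw {s : Set E} (hs : MeasurableSet s)
    (hκ : ∀ t ω, ∀ᵐ w ∂(κ t ω), w ∈ s) (t : ℕ) : ∀ᵐ ω ∂(adaptiveLaw κ t), ∀ i, ω i ∈ s := by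
  induction t with
  | zero => exact Filter.Eventually.of_forall fun ω i => i.elim0
  | succ t ih =>
    have hall : MeasurableSet {ω : Fin (t + 1) → E | ∀ i, ω i ∈ s} := by
      rw [Set.ofPred_forall]
      exact MeasurableSet.iInter fun i => measurable_pi_apply i hs
    have hbind := Measure.bind_apply (m := adaptiveLaw κ t) hall.compl
      (measurable_map_snoc κ t).aemeasurable
    refine ae_iff.2 (hbind.trans (lintegral_eq_zero_of_ae_eq_zero ?_))
    filter_upwards [ih] with ω hω
    refine (ae_map_iff (measurable_snoc_right ω).aemeasurable hall).2 ?_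
    filter_upwards [hκ t ω] with w hw
    exact Fin.lastCases (by simpa only [Fin.snoc_last] using hw)
      fun i => by simpa only [Fin.snoc_castSucc] using hω i

theorem integral_adaptiveLaw_castLE {t T : ℕ} (htT : t < T) {φ : (Fin t → E) → E → ℝ}
    (hφ : Measurable fun p : (Fin t → E) × E => φ p.1 p.2) {c : ℝ} (hc : ∀ ω w, |φ ω w| ≤ c) :
    ∫ ω, φ (fun s => ω (Fin.castLE htT.le s)) (ω ⟨t, htT⟩) ∂(adaptiveLaw κ T) =
      ∫ ω, ∫ w, φ ω w ∂(κ t ω) ∂(adaptiveLaw κ t) := by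
  have hsplit : Measurable fun ω : Fin (t + 1) → E =>
      φ (fun s => ω s.castSucc) (ω (Fin.last t)) :=
    hφ.comp (by fun_prop : Measurable
      fun ω : Fin (t + 1) → E => ((fun s : Fin t => ω s.castSucc), ω (Fin.last t)))
  have hrestrict : Measurable fun (ω : Fin T → E) (s : Fin (t + 1)) =>
      ω (Fin.castLE (Nat.succ_le_of_lt htT) s) := by fun_prop
  calc _ = ∫ ω, φ (fun s => ω s.castSucc) (ω (Fin.last t)) ∂(adaptiveLaw κ (t + 1)) := by
        rw [← map_castLE_adaptiveLaw κ (Nat.succ_le_of_lt htT),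
          integral_map hrestrict.aemeasurable hsplit.aestronglyMeasurable]
        rfl
    _ = ∫ p, φ p.1 p.2 ∂(adaptiveLaw κ t ⊗ₘ κ t) := by
        rw [adaptiveLaw_succ_eq_map_compProd, integral_map (measurable_snoc t).aemeasurable
          hsplit.aestronglyMeasurable]
        simp only [Fin.snoc_castSucc, Fin.snoc_last]
    _ = ∫ ω, ∫ w, φ ω w ∂(κ t ω) ∂(adaptiveLaw κ t) :=
        Measure.integral_compProd (integrable_of_abs_le hφ fun p => hc p.1 p.2)

end AdaptiveSampling

/-! ### The joint law of the sampled functions and the episodes -/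

section BindCompProd

variable {α γ δ : Type*} [MeasurableSpace α] [MeasurableSpace γ] [MeasurableSpace δ]

theorem bind_compProd (m : Measure α) [SFinite m] (b : Kernel α γ) [IsSFiniteKernel b]
    (K : Kernel (α × γ) δ) :
    (m ⊗ₘ b).bind K = m.bind fun x => (b x).bind fun y => K (x, y) := by
  rw [Measure.compProd_eq_comp_prod, Measure.bind_bind (Kernel.aemeasurable _) K.aemeasurable]
  congr 1 with x s hs
  rw [Kernel.prod_apply, Kernel.id_apply, Measure.dirac_prod, Measure.bind_apply hs K.aemeasurable,
    lintegral_map (Kernel.measurable_coe _ hs) measurable_prodMk_left, Measure.bind_apply hs]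
  exact (K.measurable.comp measurable_prodMk_left).aemeasurable

end BindCompProd

/-- The record `((f, g), ζ)` of one round: the sampled functions and the episode. -/
abbrev Round {H : ℕ} {X A B : Type*} [MeasurableSpace X] (F : FunctionClass H X A B) : Type _ :=
  (F.Elems × F.Elems) × Traj H X A B

section Records

variable {H : ℕ} {X A B : Type*} [MeasurableSpace X] [MeasurableSpace A] [MeasurableSpace B]
  {F : FunctionClass H X A B}

/-- The history of episodes in a sequence of rounds. -/
def episodes {t : ℕ} (ω : Fin t → Round F) : Fin t → Traj H X A B := Prod.snd ∘ ω

theorem measurable_episodes (t : ℕ) : Measurable (episodes : (Fin t → Round F) → _) := by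
  unfold episodes
  fun_prop

theorem measurable_episodes_prod (t : ℕ) :
    Measurable fun p : (Fin t → Round F) × F.Elems => (episodes p.1, p.2) :=
  ((measurable_episodes t).comp measurable_fst).prodMk measurable_snd

variable [Fintype A] [MeasurableSingletonClass A] [Fintype B] [MeasurableSingletonClass B]
  (M : MarkovGame H X A B) (I : InducedPolicies F)
  (p₀ : (h : Fin H) → Measure (F.Elem h)) [∀ h, IsProbabilityMeasure (p₀ h)] (η lam : ℝ)

/-- One round of the algorithm, given the episodes so far. -/
def stepKernel (t : ℕ) : Kernel (Fin t → Traj H X A B) (Round F) :=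
  (mainKernel M I p₀ η lam t ⊗ₖ boosterKernel M I p₀ η lam t) ⊗ₖ
    (playKernel M I).comap Prod.snd measurable_snd

/-- The joint law of the first `t` rounds. -/
def recordLaw (t : ℕ) : Measure (Fin t → Round F) :=
  adaptiveLaw (fun t => (stepKernel M I p₀ η lam t).comap episodes (measurable_episodes t)) t

variable {β : ℝ}

theorem isMarkovKernel_mainKernel (hβ : 1 ≤ β) (hF : BoundedBy F β) {η : ℝ} (hη : 0 ≤ η) (t : ℕ) :
    IsMarkovKernel (mainKernel M I p₀ η lam t) :=
  ⟨fun S => isProbabilityMeasure_mainPosterior M I p₀ hβ hF hη S⟩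

theorem isMarkovKernel_boosterKernel (hβ : 1 ≤ β) (hF : BoundedBy F β) {η : ℝ} (hη : 0 ≤ η)
    (t : ℕ) : IsMarkovKernel (boosterKernel M I p₀ η lam t) :=
  ⟨fun p => isProbabilityMeasure_boosterPosterior M I p₀ hβ hF hη p.1 p.2⟩

variable [∀ t, IsMarkovKernel (mainKernel M I p₀ η lam t)]
  [∀ t, IsMarkovKernel (boosterKernel M I p₀ η lam t)]

instance (t : ℕ) : IsMarkovKernel (stepKernel M I p₀ η lam t) := by
  unfold stepKernel
  infer_instance

instance (t : ℕ) : IsProbabilityMeasure (recordLaw M I p₀ η lam t) := by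
  unfold recordLaw
  infer_instance

theorem stepKernel_apply (t : ℕ) (S : Fin t → Traj H X A B) :
    stepKernel M I p₀ η lam t S =
      (mainKernel M I p₀ η lam t S ⊗ₘ (boosterKernel M I p₀ η lam t).sectR S) ⊗ₘ
        playKernel M I := by
  rw [stepKernel, Kernel.compProd_apply_eq_compProd_sectR,
    Kernel.compProd_apply_eq_compProd_sectR]
  congr 1

theorem map_snd_stepKernel (t : ℕ) (S : Fin t → Traj H X A B) {E : Type*} [MeasurableSpace E]
    {ψ : Traj H X A B → E} (hψ : Measurable ψ) :
    ((stepKernel M I p₀ η lam t S).map Prod.snd).map ψ =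
      (mainPosterior M p₀ η lam S).bind fun f =>
        (boosterPosterior M p₀ η lam (I.maxPolicy f) S).bind fun g =>
          (episodeLaw M (I.maxPolicy f) (I.minPolicy f g)).map ψ := by
  have hlaw := bind_compProd (mainKernel M I p₀ η lam t S)
    ((boosterKernel M I p₀ η lam t).sectR S) ((playKernel M I).map ψ)
  simp only [Kernel.map_apply _ hψ] at hlaw
  rw [stepKernel_apply, ← Measure.snd, Measure.snd_compProd, Measure.map_comp _ _ hψ, hlaw]
  rfl

theorem map_episodes_recordLaw (t : ℕ) :
    (recordLaw M I p₀ η lam t).map episodes = historyLaw M I p₀ η lam t := by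
  have hmarkov : ∀ t, IsMarkovKernel ((stepKernel M I p₀ η lam t).map Prod.snd) :=
    fun t => Kernel.IsMarkovKernel.map _ measurable_snd
  have hepisode := map_adaptiveLaw
    (fun t => (stepKernel M I p₀ η lam t).comap episodes (measurable_episodes t))
    (κ' := fun t => (stepKernel M I p₀ η lam t).map Prod.snd) (g := Prod.snd) measurable_snd
    (fun t ω => (Kernel.map_apply (stepKernel M I p₀ η lam t) measurable_snd (episodes ω)).symm) t
  refine hepisode.trans ?_
  clear hepisode
  induction t with
  | zero => rw [adaptiveLaw, historyLaw]
  | succ t ih =>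
    rw [adaptiveLaw, historyLaw, ih]
    congr 1 with S : 1
    rw [Kernel.map_apply _ measurable_snd,
      map_snd_stepKernel M I p₀ η lam t S (measurable_snoc_right S)]

theorem lintegral_stepKernel_le {φ : Round F → ℝ≥0∞} (hφ : Measurable φ) {c : ℝ≥0∞}
    (hc : ∀ f g, ∫⁻ ζ, φ ((f, g), ζ) ∂(episodeLaw M (I.maxPolicy f) (I.minPolicy f g)) ≤ c)
    (t : ℕ) (S : Fin t → Traj H X A B) : ∫⁻ w, φ w ∂(stepKernel M I p₀ η lam t S) ≤ c := by
  rw [stepKernel_apply, Measure.lintegral_compProd hφ]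
  exact lintegral_le_const (Filter.Eventually.of_forall fun p => hc p.1 p.2)

theorem lintegral_prod_recordLaw_le {φ : Round F → ℝ≥0∞} (hφ : Measurable φ)
    (hone : ∀ f g, ∫⁻ ζ, φ ((f, g), ζ) ∂(episodeLaw M (I.maxPolicy f) (I.minPolicy f g)) ≤ 1)
    (t : ℕ) : ∫⁻ ω, ∏ s, φ (ω s) ∂(recordLaw M I p₀ η lam t) ≤ 1 :=
  lintegral_prod_adaptiveLaw_le _ hφ
    (fun t ω => lintegral_stepKernel_le M I p₀ η lam hφ hone t (episodes ω)) t

theorem ae_recordLaw_of_ae_episodeLaw {s : Set (Traj H X A B)} (hs : MeasurableSet s)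
    (hae : ∀ f g, ∀ᵐ ζ ∂(episodeLaw M (I.maxPolicy f) (I.minPolicy f g)), ζ ∈ s) (t : ℕ) :
    ∀ᵐ ω ∂(recordLaw M I p₀ η lam t), ∀ i, (ω i).2 ∈ s := by
  refine ae_forall_adaptiveLaw _ (s := Prod.snd ⁻¹' s) (measurable_snd hs) (fun t ω => ?_) t
  have hround : ∀ᵐ w ∂(stepKernel M I p₀ η lam t (episodes ω)), w ∈ Prod.snd ⁻¹' s := by
    rw [stepKernel_apply]
    exact Measure.ae_compProd_of_ae_ae (measurable_snd hs)
      (Filter.Eventually.of_forall fun p => hae p.1 p.2)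
  exact hround

theorem integral_stepKernel (t : ℕ) (S : Fin t → Traj H X A B) {φ : F.Elems × F.Elems → ℝ}
    (hφ : Measurable φ) {c : ℝ} (hc : ∀ p, |φ p| ≤ c) :
    ∫ w, φ w.1 ∂(stepKernel M I p₀ η lam t S) =
      ∫ f, ∫ g, φ (f, g) ∂(boosterPosterior M p₀ η lam (I.maxPolicy f) S)
        ∂(mainPosterior M p₀ η lam S) := by
  rw [stepKernel_apply, Measure.integral_compProd (f := fun w : Round F => φ w.1)
    (integrable_of_abs_le (hφ.comp measurable_fst) fun w => hc w.1)]
  simp only [integral_const, probReal_univ, one_smul]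
  rw [Measure.integral_compProd (integrable_of_abs_le hφ hc)]
  rfl

theorem integral_recordLaw {t T : ℕ} (htT : t < T)
    {φ : (Fin t → Round F) → F.Elems × F.Elems → ℝ}
    (hφ : Measurable fun p : (Fin t → Round F) × (F.Elems × F.Elems) => φ p.1 p.2) {c : ℝ}
    (hc : ∀ ω p, |φ ω p| ≤ c) :
    ∫ ω, φ (fun s => ω (Fin.castLE htT.le s)) (ω ⟨t, htT⟩).1 ∂(recordLaw M I p₀ η lam T) =
      ∫ ω, ∫ f, ∫ g, φ ω (f, g) ∂(boosterPosterior M p₀ η lam (I.maxPolicy f) (episodes ω))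
        ∂(mainPosterior M p₀ η lam (episodes ω)) ∂(recordLaw M I p₀ η lam t) := by
  have hround : Measurable fun p : (Fin t → Round F) × Round F => φ p.1 p.2.1 :=
    hφ.comp (by fun_prop : Measurable fun p : (Fin t → Round F) × Round F => (p.1, p.2.1))
  have hsplit := integral_adaptiveLaw_castLE
    (fun t => (stepKernel M I p₀ η lam t).comap episodes (measurable_episodes t)) htT hround
    fun ω w => hc ω w.1
  exact hsplit.trans <| integral_congr_ae <| Filter.Eventually.of_forall fun ω =>
    integral_stepKernel M I p₀ η lam t (episodes ω) (hφ.comp measurable_prodMk_left) (hc ω)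

end Records

/-! ### Gibbs variational inequality -/

section Gibbs

variable {E : Type*} [MeasurableSpace E] {P : Measure E} [IsProbabilityMeasure P]

theorem integral_le_log_integral_exp {W : E → ℝ} (hW : Integrable W P)
    (hexp : Integrable (fun e => Real.exp (W e)) P) :
    ∫ e, W e ∂P ≤ Real.log (∫ e, Real.exp (W e) ∂P) := by
  rw [Real.le_log_iff_exp_le (integral_exp_pos hexp)]
  exact convexOn_exp.map_integral_le Real.continuous_exp.continuousOn isClosed_univ
    (Filter.Eventually.of_forall fun _ => Set.mem_univ _) hW hexp

theorem integral_tilted_sub_le {G W : E → ℝ} (hG : Measurable G) (hW : Measurable W) {c d : ℝ}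
    (hc : ∀ e, |G e| ≤ c) (hd : ∀ e, |W e| ≤ d) :
    ∫ e, (G e - W e) ∂(P.tilted W) ≤
      Real.log (∫ e, Real.exp (G e) ∂P) - Real.log (∫ e, Real.exp (W e) ∂P) := by
  have := isProbabilityMeasure_tilted_of_abs_le P hW hd
  have hbound : ∀ e, |G e - W e| ≤ c + d := fun e =>
    (abs_sub _ _).trans (add_le_add (hc e) (hd e))
  refine (integral_le_log_integral_exp (integrable_of_abs_le (hG.sub hW) hbound)
    (integrable_exp_of_abs_le _ (hG.sub hW) hbound)).trans_eq ?_
  rw [← Real.log_div (integral_exp_pos (integrable_exp_of_abs_le P hG hc)).ne'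
    (integral_exp_pos (integrable_exp_of_abs_le P hW hd)).ne', integral_exp_tilted]
  simp only [Pi.add_apply, Pi.sub_apply, add_sub_cancel]

theorem neg_log_integral_exp_le {Q : Measure E} [IsProbabilityMeasure Q] {k : ℝ}
    (hQ : Q ≤ ENNReal.ofReal (Real.exp k) • P) {W : E → ℝ} (hW : Measurable W) {d : ℝ}
    (hd : ∀ e, |W e| ≤ d) :
    -Real.log (∫ e, Real.exp (W e) ∂P) ≤ k + ∫ e, -W e ∂Q := by
  have hPpos := integral_exp_pos (integrable_exp_of_abs_le P hW hd)
  have hQexp := integrable_exp_of_abs_le Q hW hd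
  have hdensity : ∫ e, Real.exp (W e) ∂Q ≤ Real.exp k * ∫ e, Real.exp (W e) ∂P := by
    calc ∫ e, Real.exp (W e) ∂Q ≤ ∫ e, Real.exp (W e) ∂(ENNReal.ofReal (Real.exp k) • P) :=
          integral_mono_measure hQ (Filter.Eventually.of_forall fun e => (Real.exp_pos _).le)
            ((integrable_exp_of_abs_le P hW hd).smul_measure ENNReal.ofReal_ne_top)
      _ = Real.exp k * ∫ e, Real.exp (W e) ∂P := by
          rw [integral_smul_measure, ENNReal.toReal_ofReal (Real.exp_pos k).le, smul_eq_mul]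
  have hlog := Real.log_le_log (integral_exp_pos hQexp) hdensity
  rw [Real.log_mul (Real.exp_pos k).ne' hPpos.ne', Real.log_exp] at hlog
  rw [integral_neg]
  linarith [integral_le_log_integral_exp (integrable_of_abs_le hW hd) hQexp]

theorem abs_log_integral_exp_le {W : E → ℝ} (hW : Measurable W) {c : ℝ} (hc : ∀ e, |W e| ≤ c) :
    |Real.log (∫ e, Real.exp (W e) ∂P)| ≤ c := by
  have hint := integrable_exp_of_abs_le P hW hc
  have hpos : 0 < ∫ e, Real.exp (W e) ∂P := integral_exp_pos hint
  refine abs_le.2 ⟨(Real.le_log_iff_exp_le hpos).2 ?_, (Real.log_le_iff_le_exp hpos).2 ?_⟩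
  · simpa using integral_mono (integrable_const (Real.exp (-c))) hint fun e =>
      Real.exp_le_exp.2 (abs_le.1 (hc e)).1
  · simpa using integral_mono hint (integrable_const (Real.exp c)) fun e =>
      Real.exp_le_exp.2 (abs_le.1 (hc e)).2

theorem integrable_log_integral_exp {Θ : Type*} [MeasurableSpace Θ] {ρ : Measure Θ}
    [IsFiniteMeasure ρ] {W : Θ → E → ℝ} (hW : Measurable fun p : Θ × E => W p.1 p.2) {c : ℝ}
    (hc : ∀ θ e, |W θ e| ≤ c) : Integrable (fun θ => Real.log (∫ e, Real.exp (W θ e) ∂P)) ρ := by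
  have hexp : StronglyMeasurable fun p : Θ × E => Real.exp (W p.1 p.2) :=
    hW.exp.stronglyMeasurable
  refine integrable_of_abs_le hexp.integral_prod_right.measurable.log (c := c) fun θ =>
    abs_log_integral_exp_le ?_ (hc θ)
  have := hW.comp (measurable_prodMk_left (x := θ))
  exact this

-- Jensen's inequality for the logarithm, then Fubini.
theorem integral_log_integral_exp_nonpos {Θ : Type*} [MeasurableSpace Θ] {ρ : Measure Θ}
    [IsProbabilityMeasure ρ] {W : Θ → E → ℝ} (hW : Measurable fun p : Θ × E => W p.1 p.2) {c : ℝ}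
    (hc : ∀ θ e, |W θ e| ≤ c) (hone : ∀ e, ∫ θ, Real.exp (W θ e) ∂ρ ≤ 1) :
    ∫ θ, Real.log (∫ e, Real.exp (W θ e) ∂P) ∂ρ ≤ 0 := by
  have hint : Integrable (fun p : Θ × E => Real.exp (W p.1 p.2)) (ρ.prod P) :=
    integrable_exp_of_abs_le _ hW fun p => hc p.1 p.2
  have hle : ∫ θ, ∫ e, Real.exp (W θ e) ∂P ∂ρ ≤ 1 := by
    rw [integral_integral_swap hint]
    exact (integral_mono hint.integral_prod_right (integrable_const 1) hone).trans_eq (by simp)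
  have hlog : ∫ θ, Real.log (∫ e, Real.exp (W θ e) ∂P) ∂ρ ≤
      ∫ θ, (∫ e, Real.exp (W θ e) ∂P - 1) ∂ρ := by
    refine integral_mono (integrable_log_integral_exp hW hc)
      (hint.integral_prod_left.sub (integrable_const 1)) fun θ =>
        Real.log_le_sub_one_of_pos (integral_exp_pos (integrable_exp_of_abs_le P ?_ (hc θ)))
    have := hW.comp (measurable_prodMk_left (x := θ))
    exact this
  rw [integral_sub hint.integral_prod_left (integrable_const 1)] at hlog
  simp only [integral_const, probReal_univ, one_smul] at hlog
  linarith

end Gibbs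

/-! ### Product measures -/

section Product

variable {ι : Type*} {E : ι → Type*} [∀ i, MeasurableSpace (E i)] (p : (i : ι) → Measure (E i))

theorem lmarginal_prod_eq_one [LinearOrder ι] [∀ i, SigmaFinite (p i)]
    {K : ι → ((i : ι) → E i) → ℝ≥0∞} (hKm : ∀ i, Measurable (K i))
    (hK : ∀ i, DependsOn (K i) (Set.Ici i))
    (hone : ∀ i f, ∫⁻ u, K i (Function.update f i u) ∂(p i) = 1) (s : Finset ι)
    (f : (i : ι) → E i) : lmarginal p s (fun f => ∏ i ∈ s, K i f) f = 1 := by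
  induction s using Finset.induction_on_max generalizing f with
  | empty => simp
  | insert a s hs ih =>
    have ha : a ∉ s := fun ha => (hs a ha).false
    have hfactor : ∀ g, lmarginal p s (fun f => ∏ i ∈ insert a s, K i f) g = K a g := fun g => by
      have hfixed : ∀ y, K a (Function.updateFinset g s y) = K a g := fun y =>
        hK a fun i hi => dif_neg fun his => ((hs i his).trans_le hi).false
      simp only [lmarginal, Finset.prod_insert ha, hfixed]
      have hmeas : Measurable fun y => ∏ i ∈ s, K i (Function.updateFinset g s y) :=
        (Finset.measurable_fun_prod s fun i _ => hKm i).comp measurable_updateFinset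
      rw [lintegral_const_mul _ hmeas]
      exact (congrArg (K a g * ·) (ih g)).trans (mul_one _)
    rw [lmarginal_insert _ (Finset.measurable_fun_prod _ fun i _ => hKm i) ha]
    simp only [hfactor, hone]

variable [Fintype ι] [∀ i, IsProbabilityMeasure (p i)]

theorem lintegral_prod_eq_one [LinearOrder ι] {K : ι → ((i : ι) → E i) → ℝ≥0∞}
    (hKm : ∀ i, Measurable (K i)) (hK : ∀ i, DependsOn (K i) (Set.Ici i))
    (hone : ∀ i f, ∫⁻ u, K i (Function.update f i u) ∂(p i) = 1) :
    ∫⁻ f, ∏ i, K i f ∂(Measure.pi p) = 1 := by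
  obtain ⟨f⟩ := nonempty_of_isProbabilityMeasure (Measure.pi p)
  simpa only [lmarginal_univ] using lmarginal_prod_eq_one p hKm hK hone Finset.univ f

theorem indepFun_of_dependsOn {γ γ' : Type*} [MeasurableSpace γ] [MeasurableSpace γ']
    {g : ((i : ι) → E i) → γ} {g' : ((i : ι) → E i) → γ'} (hg : Measurable g)
    (hg' : Measurable g') {s s' : Finset ι} (hs : DependsOn g s) (hs' : DependsOn g' s')
    (hd : Disjoint s s') : IndepFun g g' (Measure.pi p) := by
  classical
  obtain ⟨f₀⟩ := nonempty_of_isProbabilityMeasure (Measure.pi p)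
  have hcoord : iIndepFun (fun i (f : (i : ι) → E i) => f i) (Measure.pi p) :=
    iIndepFun_pi (X := fun _ => id) fun _ => aemeasurable_id
  have hblocks := (hcoord.indepFun_finset s s' hd measurable_pi_apply).comp
    (hg.comp (measurable_updateFinset (x := f₀))) (hg'.comp (measurable_updateFinset (x := f₀)))
  convert hblocks using 1
  · exact funext fun f => hs fun i hi => by simp [Function.updateFinset, Finset.mem_coe.1 hi]
  · exact funext fun f => hs' fun i hi => by simp [Function.updateFinset, Finset.mem_coe.1 hi]

theorem integral_prod_of_dependsOn {κ : Type*} {g : κ → ((i : ι) → E i) → ℝ}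
    (hg : ∀ k, Measurable (g k)) {S : κ → Finset ι} (hS : ∀ k, DependsOn (g k) (S k))
    (s : Finset κ) (hd : (s : Set κ).PairwiseDisjoint S) :
    ∫ f, ∏ k ∈ s, g k f ∂(Measure.pi p) = ∏ k ∈ s, ∫ f, g k f ∂(Measure.pi p) := by
  classical
  induction s using Finset.induction_on with
  | empty => simp
  | insert a s ha ih =>
    have hrest : DependsOn (fun f => ∏ k ∈ s, g k f) (s.biUnion S) := fun f f' hff =>
      Finset.prod_congr rfl fun k hk => hS k fun i hi =>
        hff i (Finset.mem_coe.2 (Finset.mem_biUnion.2 ⟨k, hk, hi⟩))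
    have hdisj : Disjoint (S a) (s.biUnion S) := (Finset.disjoint_biUnion_right _ _ _).2
      fun k hk => hd (by simp) (by simp [hk]) fun h => ha (h ▸ hk)
    have hmeas : Measurable fun f => ∏ k ∈ s, g k f := Finset.measurable_fun_prod s fun k _ => hg k
    simp only [Finset.prod_insert ha]
    rw [(indepFun_of_dependsOn p (hg a) hmeas (hS a) hrest hdisj).integral_fun_mul_eq_mul_integral
      (hg a).aestronglyMeasurable hmeas.aestronglyMeasurable,
      ih (hd.subset (by simp))]

theorem integral_tilted_sum_sub_le {κ : Type*} {G : κ → ((i : ι) → E i) → ℝ}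
    (hG : ∀ k, Measurable (G k)) {S : κ → Finset ι} (hS : ∀ k, DependsOn (G k) (S k))
    {s : Finset κ} (hd : (s : Set κ).PairwiseDisjoint S) {W : ((i : ι) → E i) → ℝ}
    (hW : Measurable W) {c d : ℝ} (hGc : ∀ k f, |G k f| ≤ c) (hWd : ∀ f, |W f| ≤ d) :
    ∫ f, (∑ k ∈ s, G k f - W f) ∂((Measure.pi p).tilted W) ≤
      ∑ k ∈ s, Real.log (∫ f, Real.exp (G k f) ∂(Measure.pi p)) -
        Real.log (∫ f, Real.exp (W f) ∂(Measure.pi p)) := by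
  have hsum : ∀ f, |∑ k ∈ s, G k f| ≤ ∑ _k ∈ s, c := fun f =>
    (Finset.abs_sum_le_sum_abs _ _).trans (Finset.sum_le_sum fun k _ => hGc k f)
  refine (integral_tilted_sub_le (Finset.measurable_fun_sum s fun k _ => hG k) hW hsum
    hWd).trans_eq ?_
  simp only [Real.exp_sum]
  rw [integral_prod_of_dependsOn p (fun k => (hG k).exp)
    (fun k f f' hff => congrArg Real.exp (hS k hff)) s hd, Real.log_prod fun k _ =>
      (integral_exp_pos (integrable_exp_of_abs_le _ (hG k) (hGc k))).ne']

end Product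

section Chain

variable {H : ℕ} {E : Fin H → Type*} [∀ h, MeasurableSpace (E h)]
  (p : (h : Fin H) → Measure (E h)) [∀ h, IsProbabilityMeasure (p h)]

theorem pairwiseDisjoint_links {s : Finset (Fin H)} (hs : ∀ i ∈ s, ∀ j ∈ s, (i : ℕ) + 1 ≠ j) :
    (s : Set (Fin H)).PairwiseDisjoint
      fun h => Finset.univ.filter fun j : Fin H => j = h ∨ (j : ℕ) = h + 1 := by
  intro i hi j hj hij
  refine Finset.disjoint_left.2 fun k hki hkj => ?_
  simp only [Finset.mem_filter, Finset.mem_univ, true_and, Fin.ext_iff] at hki hkj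
  have hne : (i : ℕ) ≠ j := Fin.val_ne_of_ne hij
  have := hs i hi j hj
  have := hs j hj i hi
  omega

-- The links at even steps are independent under the product measure, and so are those at odd steps.
theorem integral_tilted_chain_le {G : Fin H → ((h : Fin H) → E h) → ℝ}
    (hG : ∀ h, Measurable (G h)) (hGd : ∀ h, DependsOn (G h) {j : Fin H | j = h ∨ (j : ℕ) = h + 1})
    {W : ((h : Fin H) → E h) → ℝ} (hW : Measurable W) {c d : ℝ} (hc : ∀ h f, |G h f| ≤ c)
    (hd : ∀ f, |W f| ≤ d) :
    ∫ f, (∑ h, G h f - W f) ∂((Measure.pi p).tilted W) ≤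
      1 / 2 * ∑ h, Real.log (∫ f, Real.exp (2 * G h f) ∂(Measure.pi p)) -
        Real.log (∫ f, Real.exp (W f) ∂(Measure.pi p)) := by
  let Q := (Measure.pi p).tilted W
  have : IsProbabilityMeasure Q := isProbabilityMeasure_tilted_of_abs_le (Measure.pi p) hW hd
  let even : Finset (Fin H) := Finset.univ.filter fun h => Even (h : ℕ)
  let odd : Finset (Fin H) := Finset.univ.filter fun h => ¬ Even (h : ℕ)
  have hhalf : ∀ s : Finset (Fin H), (∀ i ∈ s, ∀ j ∈ s, (i : ℕ) + 1 ≠ j) →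
      ∫ f, (∑ h ∈ s, 2 * G h f - W f) ∂Q ≤
        ∑ h ∈ s, Real.log (∫ f, Real.exp (2 * G h f) ∂(Measure.pi p)) -
          Real.log (∫ f, Real.exp (W f) ∂(Measure.pi p)) := fun s hs =>
    integral_tilted_sum_sub_le p (G := fun h f => 2 * G h f) (fun h => (hG h).const_mul 2)
      (fun h f f' hff => congrArg (2 * ·) (hGd h fun j hj => hff j (by simpa using hj)))
      (pairwiseDisjoint_links hs) hW (c := 2 * c)
      (fun h f => by simpa [abs_mul] using hc h f) hd
  have heven := hhalf even fun i hi j hj hij => by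
    simp only [even, Finset.mem_filter, Finset.mem_univ, true_and] at hi hj
    exact Nat.even_add_one.1 (hij ▸ hj) hi
  have hodd := hhalf odd fun i hi j hj hij => by
    simp only [odd, Finset.mem_filter, Finset.mem_univ, true_and] at hi hj
    exact hj (hij ▸ Nat.even_add_one.2 hi)
  have hint : ∀ s : Finset (Fin H), Integrable (fun f => ∑ h ∈ s, 2 * G h f - W f) Q := fun s =>
    (integrable_finsetSum _ fun h _ => (integrable_of_abs_le (hG h) (hc h)).const_mul 2).sub
      (integrable_of_abs_le hW hd)
  have hsplit : ∀ φ : Fin H → ℝ, ∑ h, φ h = ∑ h ∈ even, φ h + ∑ h ∈ odd, φ h := fun φ =>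
    (Finset.sum_filter_add_sum_filter_not _ _ _).symm
  have haverage : ∀ f, ∑ h, G h f - W f =
      1 / 2 * ((∑ h ∈ even, 2 * G h f - W f) + (∑ h ∈ odd, 2 * G h f - W f)) := fun f => by
    rw [hsplit, ← Finset.mul_sum, ← Finset.mul_sum]
    ring
  simp only [haverage]
  rw [integral_const_mul, integral_add (hint _) (hint _), hsplit]
  linarith

end Chain

/-! ### The prior mass of approximate solutions -/

section Dependence

variable {H : ℕ} {X A B : Type*} [MeasurableSpace X] {F : FunctionClass H X A B}

theorem update_apply_of_succ {f : F.Elems} {h j : Fin H} (u : F.Elem h) (hj : (j : ℕ) = h + 1) :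
    Function.update f h u j = f j :=
  Function.update_of_ne (by rintro rfl; omega) _ _

variable [Fintype A] [Fintype B]

theorem dependsOn_maxminValue (h : Fin H) :
    DependsOn (fun f : F.Elems => maxminValue f (h + 1)) {j : Fin H | (j : ℕ) = h + 1} :=
  fun _ _ hfg => maxminValue_congr fun _ => hfg _ rfl

variable [MeasurableSpace A] [MeasurableSpace B] (M : MarkovGame H X A B)

theorem dependsOn_residual (h : Fin H) :
    DependsOn (residual (F := F) M h) {j : Fin H | j = h ∨ (j : ℕ) = h + 1} := by
  intro f g hfg
  have hV : maxminValue f (h + 1) = maxminValue g (h + 1) :=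
    dependsOn_maxminValue h fun j hj => hfg j (Or.inr hj)
  funext z
  rw [residual, residual, bellman, bellman, hfg h (Or.inl rfl), hV]

theorem dependsOn_noise (h : Fin H) :
    DependsOn (noise (F := F) M h) {j : Fin H | (j : ℕ) = h + 1} := by
  intro f g hfg
  have hV : maxminValue f (h + 1) = maxminValue g (h + 1) := dependsOn_maxminValue h hfg
  funext ζ
  rw [noise, noise, hV]

theorem dependsOn_excessLoss (h : Fin H) :
    DependsOn (excessLoss (F := F) M h) {j : Fin H | j = h ∨ (j : ℕ) = h + 1} := by
  intro f g hfg
  funext ζ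
  rw [excessLoss, excessLoss, dependsOn_residual M h hfg,
    dependsOn_noise M h fun j hj => hfg j (Or.inr hj)]

theorem dependsOn_nearOptimal (ε : ℝ) (h : Fin H) :
    DependsOn (NearOptimal (F := F) M ε h) {j : Fin H | j = h ∨ (j : ℕ) = h + 1} := by
  intro f g hfg
  rw [NearOptimal, NearOptimal, dependsOn_residual M h hfg]

theorem residual_update (f : F.Elems) (h : Fin H) (u : F.Elem h) (z : X × A × B) :
    residual M h (Function.update f h u) z =
      u.1 z.1 z.2.1 z.2.2 - bellman M h f z.1 z.2.1 z.2.2 := by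
  have hV : maxminValue (Function.update f h u) (h + 1) = maxminValue f (h + 1) :=
    dependsOn_maxminValue h fun _ => update_apply_of_succ u
  rw [residual, Function.update_self, bellman, hV, ← bellman]

/-- The functions of `F_h` in the `ε`-ball around `T_h f` for the supremum norm. -/
def bellmanBall (ε : ℝ) (h : Fin H) (f : F.Elems) : Set (F.Elem h) :=
  {u | ∀ x a b, |u.1 x a b - bellman M h f x a b| ≤ ε}

theorem abs_residual_update_le {ε : ℝ} {h : Fin H} {f : F.Elems} {u : F.Elem h}
    (hu : u ∈ bellmanBall M ε h f) (z : X × A × B) :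
    |residual M h (Function.update f h u) z| ≤ ε := by
  rw [residual_update]
  exact hu _ _ _

end Dependence

theorem ennreal_log_prod {ι : Type*} (s : Finset ι) (φ : ι → ℝ≥0∞) :
    ENNReal.log (∏ i ∈ s, φ i) = ∑ i ∈ s, ENNReal.log (φ i) := by
  classical
  induction s using Finset.induction_on with
  | empty => simp
  | insert a s ha ih => rw [Finset.prod_insert ha, Finset.sum_insert ha, ENNReal.log_mul_add, ih]

section Kappa

variable {H : ℕ} {X A B : Type*} [MeasurableSpace X] [Fintype A] [MeasurableSpace A]
  [Fintype B] [MeasurableSpace B] {F : FunctionClass H X A B} (M : MarkovGame H X A B)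
  (I : InducedPolicies F) (p₀ : (h : Fin H) → Measure (F.Elem h))
  [∀ h, IsProbabilityMeasure (p₀ h)] {ε : ℝ}

theorem prod_inv_bellmanBall_le (hκ : kappa M I p₀ ε < ⊤) (f : F.Elems) :
    ∏ h, (p₀ h (bellmanBall M ε h f))⁻¹ ≤
      ENNReal.ofReal (Real.exp (kappa M I p₀ ε).toReal) := by
  have hlog : ENNReal.log (∏ h, (p₀ h (bellmanBall M ε h f))⁻¹) ≤ kappa M I p₀ ε := by
    rw [ennreal_log_prod]
    refine le_trans (le_of_eq ?_) ((le_iSup (fun g : F.Elems => ∑ h, ENNReal.log (1 / p₀ h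
      {u | ∀ x a b, |u.1 x a b - bellmanPolicy M (I.maxPolicy f) h g x a b| ≤ ε})) f).trans
      (le_iSup (fun f => kappaPolicy M p₀ (I.maxPolicy f) ε) f))
    simp only [bellmanBall, one_div, bellman_eq_bellmanPolicy M I]
  have hone : (1 : ℝ≥0∞) ≤ ∏ h, (p₀ h (bellmanBall M ε h f))⁻¹ :=
    Finset.one_le_prod' fun h _ => ENNReal.one_le_inv.2 prob_le_one
  have hbot : kappa M I p₀ ε ≠ ⊥ := fun hb => by
    rw [hb, le_bot_iff, ENNReal.log_eq_bot_iff] at hlog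
    simp [hlog] at hone
  rwa [← ENNReal.log_le_log_iff, ENNReal.log_ofReal_of_pos (Real.exp_pos _), Real.log_exp,
    EReal.coe_toReal hκ.ne hbot]

theorem bellmanBall_ne_zero (hκ : kappa M I p₀ ε < ⊤) (h : Fin H) (f : F.Elems) :
    p₀ h (bellmanBall M ε h f) ≠ 0 := by
  intro hzero
  have hle : (p₀ h (bellmanBall M ε h f))⁻¹ ≤ ∏ h, (p₀ h (bellmanBall M ε h f))⁻¹ :=
    Finset.single_le_prod' (f := fun h => (p₀ h (bellmanBall M ε h f))⁻¹)
      (fun h _ => ENNReal.one_le_inv.2 prob_le_one) (Finset.mem_univ h)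
  rw [hzero, ENNReal.inv_zero] at hle
  exact absurd (hle.trans (prod_inv_bellmanBall_le M I p₀ hκ f)) (by simp)

theorem neg_kappa_le_sum_log (hκ : kappa M I p₀ ε < ⊤) (f : F.Elems) :
    -(kappa M I p₀ ε).toReal ≤ ∑ h, Real.log ((p₀ h).real (bellmanBall M ε h f)) := by
  have hpos : ∀ h, 0 < (p₀ h).real (bellmanBall M ε h f) := fun h =>
    ENNReal.toReal_pos (bellmanBall_ne_zero M I p₀ hκ h f) (measure_ne_top _ _)
  have hprod : ∏ h, ((p₀ h).real (bellmanBall M ε h f))⁻¹ ≤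
      Real.exp (kappa M I p₀ ε).toReal := by
    have := ENNReal.toReal_mono ENNReal.ofReal_ne_top (prod_inv_bellmanBall_le M I p₀ hκ f)
    rw [ENNReal.toReal_prod, ENNReal.toReal_ofReal (Real.exp_pos _).le] at this
    simpa only [ENNReal.toReal_inv, measureReal_def] using this
  have hlog := Real.log_le_log (Finset.prod_pos fun h _ => inv_pos.2 (hpos h)) hprod
  rw [Real.log_exp, Real.log_prod fun h _ => (inv_pos.2 (hpos h)).ne'] at hlog
  simp only [Real.log_inv, Finset.sum_neg_distrib] at hlog
  linarith

end Kappa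

section Comparator

variable {H : ℕ} {X A B : Type*} [MeasurableSpace X] [Fintype A] [MeasurableSpace A]
  [Fintype B] [MeasurableSpace B] {F : FunctionClass H X A B} (M : MarkovGame H X A B)
  (I : InducedPolicies F) (p₀ : (h : Fin H) → Measure (F.Elem h)) (ε : ℝ)

/-- The prior mass of the `u ∈ F_h` that make `f` an approximate solution at step `h` when they
replace `f^h`. -/
def nearOptimalMass (h : Fin H) (f : F.Elems) : ℝ≥0∞ :=
  p₀ h {u | NearOptimal M ε h (Function.update f h u)}

/-- The density, with respect to the prior on `F_h`, of the prior conditioned on `f^h` being an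
approximate solution at step `h` given `f^{h+1}`. -/
def comparatorDensity (h : Fin H) : F.Elems → ℝ≥0∞ :=
  {f | NearOptimal M ε h f}.indicator fun f => (nearOptimalMass M p₀ ε h f)⁻¹

variable {ε}

theorem bellmanBall_le_nearOptimalMass (h : Fin H) (f : F.Elems) :
    p₀ h (bellmanBall M ε h f) ≤ nearOptimalMass M p₀ ε h f :=
  measure_mono fun u hu => show NearOptimal M ε h (Function.update f h u) from
    .of_forall fun x a b => abs_residual_update_le M hu (x, a, b)

theorem dependsOn_comparatorDensity (h : Fin H) :
    DependsOn (comparatorDensity M p₀ ε h) (Set.Ici h) := by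
  classical
  have hlink : ({j : Fin H | j = h ∨ (j : ℕ) = h + 1} : Set (Fin H)) ⊆ Set.Ici h := by
    rintro j (rfl | hj)
    · exact Set.mem_Ici.2 le_rfl
    · exact Set.mem_Ici.2 (Fin.le_def.2 (by omega))
  have hnear := (dependsOn_nearOptimal (F := F) M ε h).mono hlink
  intro f g hfg
  have hmass : nearOptimalMass M p₀ ε h f = nearOptimalMass M p₀ ε h g := by
    unfold nearOptimalMass
    congr 1
    ext u
    refine (hnear fun j hj => ?_).to_iff
    by_cases hjh : j = h
    · subst hjh
      simp
    · rw [Function.update_of_ne hjh, Function.update_of_ne hjh, hfg j hj]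
  have hiff : NearOptimal M ε h f ↔ NearOptimal M ε h g := (hnear hfg).to_iff
  simp only [comparatorDensity, Set.indicator_apply, Set.mem_ofPred_eq, hiff, hmass]

include I in
theorem prod_comparatorDensity_le [∀ h, IsProbabilityMeasure (p₀ h)]
    (hκ : kappa M I p₀ ε < ⊤) (f : F.Elems) :
    ∏ h, comparatorDensity M p₀ ε h f ≤ ENNReal.ofReal (Real.exp (kappa M I p₀ ε).toReal) :=
  (Finset.prod_le_prod' fun h _ => (Set.indicator_le_self' (fun _ _ => zero_le) f).trans
    (ENNReal.inv_le_inv.2 (bellmanBall_le_nearOptimalMass M p₀ h f))).trans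
    (prod_inv_bellmanBall_le M I p₀ hκ f)

variable [MeasurableSingletonClass A] [MeasurableSingletonClass B]

include I in
theorem measurableSet_nearOptimal (h : Fin H) :
    MeasurableSet {f : F.Elems | NearOptimal M ε h f} := by
  have hs : MeasurableSet {p : F.Elems × X | ∀ a b, |residual M h p.1 (p.2, a, b)| ≤ ε} := by
    simp only [Set.ofPred_forall]
    refine MeasurableSet.iInter fun a => MeasurableSet.iInter fun b =>
      measurableSet_le (Measurable.abs ?_) measurable_const
    exact (measurable_residual M I h).comp (by fun_prop : Measurable fun p : F.Elems × X =>
      (p.1, (p.2, a, b)))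
  have := measurable_measure_prodMk_left (ν := reachMeasure M h) hs.compl
  exact this (measurableSet_singleton 0)

variable [∀ h, IsProbabilityMeasure (p₀ h)]

include I in
theorem measurable_comparatorDensity (h : Fin H) : Measurable (comparatorDensity M p₀ ε h) := by
  have hnear := measurableSet_nearOptimal M I (ε := ε) h
  have hpair : MeasurableSet {p : F.Elems × F.Elem h |
      NearOptimal M ε h (Function.update p.1 h p.2)} := measurable_update' hnear
  have hmass : Measurable (nearOptimalMass M p₀ ε h) := measurable_measure_prodMk_left hpair
  exact hmass.inv.indicator hnear

theorem lintegral_comparatorDensity (hκ : kappa M I p₀ ε < ⊤) (h : Fin H) (f : F.Elems) :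
    ∫⁻ u, comparatorDensity M p₀ ε h (Function.update f h u) ∂(p₀ h) = 1 := by
  have hnear : MeasurableSet {u : F.Elem h | NearOptimal M ε h (Function.update f h u)} :=
    measurable_update f (measurableSet_nearOptimal M I h)
  have hdensity : ∀ u, comparatorDensity M p₀ ε h (Function.update f h u) =
      {u : F.Elem h | NearOptimal M ε h (Function.update f h u)}.indicator
        (fun _ => (nearOptimalMass M p₀ ε h f)⁻¹) u := fun u => by
    simp only [comparatorDensity, nearOptimalMass, Set.indicator, Set.mem_ofPred_eq,
      Function.update_idem]
  have hpos : nearOptimalMass M p₀ ε h f ≠ 0 :=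
    ((pos_iff_ne_zero.2 (bellmanBall_ne_zero M I p₀ hκ h f)).trans_le
      (bellmanBall_le_nearOptimalMass M p₀ h f)).ne'
  simp only [hdensity]
  rw [lintegral_indicator_const hnear]
  exact ENNReal.inv_mul_cancel hpos (measure_ne_top _ _)

-- The comparator draws `f^h`, backwards in `h`, from the prior conditioned on `NearOptimal`.
theorem exists_comparator (hκ : kappa M I p₀ ε < ⊤) :
    ∃ Q : Measure F.Elems, IsProbabilityMeasure Q ∧
      Q ≤ ENNReal.ofReal (Real.exp (kappa M I p₀ ε).toReal) • Measure.pi p₀ ∧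
      ∀ᵐ f ∂Q, ∀ h, NearOptimal M ε h f := by
  have hmeas := measurable_comparatorDensity M I p₀ (ε := ε)
  refine ⟨(Measure.pi p₀).withDensity fun f => ∏ h, comparatorDensity M p₀ ε h f, ⟨?_⟩, ?_, ?_⟩
  · rw [withDensity_apply _ .univ, Measure.restrict_univ]
    exact lintegral_prod_eq_one p₀ hmeas (dependsOn_comparatorDensity M p₀)
      (lintegral_comparatorDensity M I p₀ hκ)
  · rw [← withDensity_const]
    exact withDensity_mono (.of_forall (prod_comparatorDensity_le M I p₀ hκ))
  · rw [ae_withDensity_iff (Finset.measurable_fun_prod _ fun h _ => hmeas h)]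
    refine .of_forall fun f hf h => ?_
    have := Finset.prod_ne_zero_iff.1 hf h (Finset.mem_univ h)
    exact (Set.mem_of_indicator_ne_zero this : f ∈ {f | NearOptimal M ε h f})

end Comparator

/-! ### The normalizing factors of the likelihood -/

section Normalizer

variable {H : ℕ} {X A B : Type*} [MeasurableSpace X] [MeasurableSpace A] [MeasurableSpace B]
  [Fintype A] [Fintype B] {F : FunctionClass H X A B} (M : MarkovGame H X A B)

/-- The normalizing factor of the likelihood at step `h`, with every loss measured relative to that
of `T_h f`; see `logLikelihood_eq`. -/
def normalizer (p₀ : (h : Fin H) → Measure (F.Elem h)) (η : ℝ) (h : Fin H) {t : ℕ}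
    (S : Fin t → Traj H X A B) (f : F.Elems) : ℝ :=
  ∫ u, Real.exp (-η * ∑ s, excessLoss M h (Function.update f h u) (S s)) ∂(p₀ h)

theorem sqLoss_eq_excessLoss_update (h : Fin H) {t : ℕ} (S : Fin t → Traj H X A B) (f : F.Elems)
    (u : F.Elem h) :
    sqLoss M h u.1 (maxminValue f (h + 1)) S =
      ∑ s, excessLoss M h (Function.update f h u) (S s) + ∑ s, noise M h f (S s) ^ 2 := by
  have hV : maxminValue (Function.update f h u) (h + 1) = maxminValue f (h + 1) :=
    dependsOn_maxminValue h fun _ => update_apply_of_succ u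
  have hnoise : noise M h (Function.update f h u) = noise M h f :=
    dependsOn_noise M h fun _ => update_apply_of_succ u
  have hloss := sqLoss_eq_excessLoss M h (Function.update f h u) S
  rwa [Function.update_self, hV, hnoise] at hloss

theorem logLikelihood_eq (p₀ : (h : Fin H) → Measure (F.Elem h)) {η : ℝ} (h : Fin H) {t : ℕ}
    (S : Fin t → Traj H X A B) (f : F.Elems) (hpos : 0 < normalizer M p₀ η h S f) :
    logLikelihood M p₀ η h (f h) (maxminValue f (h + 1)) S =
      -η * ∑ s, excessLoss M h f (S s) - Real.log (normalizer M p₀ η h S f) := by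
  have hexp : ∀ u : F.Elem h, Real.exp (-η * sqLoss M h u.1 (maxminValue f (h + 1)) S) =
      Real.exp (-η * ∑ s, noise M h f (S s) ^ 2) *
        Real.exp (-η * ∑ s, excessLoss M h (Function.update f h u) (S s)) := fun u => by
    rw [sqLoss_eq_excessLoss_update, ← Real.exp_add]
    ring_nf
  rw [logLikelihood]
  simp only [hexp, integral_const_mul]
  rw [← normalizer, Real.log_mul (Real.exp_pos _).ne' hpos.ne', Real.log_exp,
    sqLoss_eq_excessLoss]
  ring

variable (I : InducedPolicies F) (p₀ : (h : Fin H) → Measure (F.Elem h)) (h : Fin H)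
  {β η ε : ℝ} {t : ℕ}

include I in
theorem abs_sum_excessLoss_le (hβ : 1 ≤ β) (hF : BoundedBy F β) (hη : 0 ≤ η)
    (S : Fin t → Traj H X A B) (f : F.Elems) :
    |-η * ∑ s, excessLoss M h f (S s)| ≤ η * (t * (3 * β ^ 2)) := by
  rw [abs_mul, abs_neg, abs_of_nonneg hη]
  refine mul_le_mul_of_nonneg_left ((Finset.abs_sum_le_sum_abs _ _).trans ?_) hη
  exact (Finset.sum_le_sum fun s _ => abs_excessLoss_le M I h hβ hF f (S s)).trans_eq (by simp)

variable [MeasurableSingletonClass A] [MeasurableSingletonClass B]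

include I in
theorem measurable_sum_excessLoss : Measurable fun p : (Fin t → Traj H X A B) × F.Elems =>
    ∑ s, excessLoss M h p.2 (p.1 s) := by
  refine Finset.measurable_fun_sum _ fun s _ => ?_
  exact (measurable_excessLoss M I h).comp (by fun_prop : Measurable
    fun p : (Fin t → Traj H X A B) × F.Elems => (p.2, p.1 s))

include I in
theorem measurable_sum_excessLoss_update :
    Measurable fun p : ((Fin t → Traj H X A B) × F.Elems) × F.Elem h =>
      ∑ s, excessLoss M h (Function.update p.1.2 h p.2) (p.1.1 s) := by
  have hupdate : Measurable fun p : ((Fin t → Traj H X A B) × F.Elems) × F.Elem h =>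
      Function.update p.1.2 h p.2 :=
    measurable_update'.comp ((measurable_snd.comp measurable_fst).prodMk measurable_snd)
  have := (measurable_sum_excessLoss M I h (t := t)).comp
    ((measurable_fst.comp measurable_fst).prodMk hupdate)
  exact this

include I in
theorem measurable_sum_excessLoss_update_right (S : Fin t → Traj H X A B) (f : F.Elems) :
    Measurable fun u : F.Elem h => ∑ s, excessLoss M h (Function.update f h u) (S s) := by
  have := (measurable_sum_excessLoss_update M I h (t := t)).comp
    (measurable_prodMk_left (x := (S, f)))
  exact this

variable [∀ h, IsProbabilityMeasure (p₀ h)]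

include I in
theorem measurable_normalizer : Measurable fun p : (Fin t → Traj H X A B) × F.Elems =>
    normalizer M p₀ η h p.1 p.2 :=
  (StronglyMeasurable.integral_prod_right
    (f := fun (p : (Fin t → Traj H X A B) × F.Elems) (u : F.Elem h) =>
      Real.exp (-η * ∑ s, excessLoss M h (Function.update p.2 h u) (p.1 s)))
    ((measurable_sum_excessLoss_update M I h).const_mul (-η)).exp.stronglyMeasurable).measurable

include I in
theorem integrable_exp_sum_excessLoss (hβ : 1 ≤ β) (hF : BoundedBy F β) (hη : 0 ≤ η)
    (S : Fin t → Traj H X A B) (f : F.Elems) :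
    Integrable (fun u : F.Elem h =>
      Real.exp (-η * ∑ s, excessLoss M h (Function.update f h u) (S s))) (p₀ h) :=
  integrable_exp_of_abs_le _ ((measurable_sum_excessLoss_update_right M I h S f).const_mul (-η))
    fun _ => abs_sum_excessLoss_le M I h hβ hF hη S _

include I in
theorem normalizer_pos (hβ : 1 ≤ β) (hF : BoundedBy F β) (hη : 0 ≤ η)
    (S : Fin t → Traj H X A B) (f : F.Elems) : 0 < normalizer M p₀ η h S f :=
  integral_exp_pos (integrable_exp_sum_excessLoss M I p₀ h hβ hF hη S f)

include I in
theorem abs_log_normalizer_le (hβ : 1 ≤ β) (hF : BoundedBy F β) (hη : 0 ≤ η)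
    (S : Fin t → Traj H X A B) (f : F.Elems) :
    |Real.log (normalizer M p₀ η h S f)| ≤ η * (t * (3 * β ^ 2)) :=
  abs_log_integral_exp_le
    ((measurable_sum_excessLoss_update_right M I h S f).const_mul (-η))
    fun _ => abs_sum_excessLoss_le M I h hβ hF hη S _

include I in
theorem log_bellmanBall_sub_le_log_normalizer (hβ : 1 ≤ β) (hF : BoundedBy F β) (hη : 0 ≤ η)
    (S : Fin t → Traj H X A B) (f : F.Elems) (hb : p₀ h (bellmanBall M ε h f) ≠ 0) :
    Real.log ((p₀ h).real (bellmanBall M ε h f)) - η * (t * (ε ^ 2 + 2 * ε * β)) ≤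
      Real.log (normalizer M p₀ η h S f) := by
  have hpos : 0 < (p₀ h).real (bellmanBall M ε h f) :=
    ENNReal.toReal_pos hb (measure_ne_top _ _)
  -- The ball need not be measurable; this set contains it and is.
  let D : Set (F.Elem h) := {u | ∀ s, |residual M h (Function.update f h u) (S s h)| ≤ ε}
  have hD : MeasurableSet D := by
    simp only [D, Set.ofPred_forall]
    refine MeasurableSet.iInter fun s => measurableSet_le (Measurable.abs ?_) measurable_const
    exact (measurable_residual M I h).comp ((measurable_update f).prodMk measurable_const)
  have hsub : (p₀ h).real (bellmanBall M ε h f) ≤ (p₀ h).real D :=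
    measureReal_mono fun u hu s => abs_residual_update_le M hu _
  have hloss : ∀ u ∈ D, -(η * (t * (ε ^ 2 + 2 * ε * β))) ≤
      -η * ∑ s, excessLoss M h (Function.update f h u) (S s) := fun u hu => by
    have hsum : ∑ s, excessLoss M h (Function.update f h u) (S s) ≤ t * (ε ^ 2 + 2 * ε * β) :=
      (Finset.sum_le_sum fun s _ => (le_abs_self _).trans
        (abs_excessLoss_le_of_residual M I h hβ hF _ (S s) (hu s))).trans_eq (by simp [mul_add])
    linarith [mul_le_mul_of_nonneg_left hsum hη]
  have hint := integrable_exp_sum_excessLoss M I p₀ h hβ hF hη S f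
  have hmass : (p₀ h).real D * Real.exp (-(η * (t * (ε ^ 2 + 2 * ε * β)))) ≤
      normalizer M p₀ η h S f := by
    calc _ = ∫ _u in D, Real.exp (-(η * (t * (ε ^ 2 + 2 * ε * β)))) ∂(p₀ h) := by simp
      _ ≤ ∫ u in D, Real.exp (-η * ∑ s, excessLoss M h (Function.update f h u) (S s)) ∂(p₀ h) :=
          setIntegral_mono_on (integrable_const _).integrableOn hint.integrableOn hD
            fun u hu => Real.exp_le_exp.2 (hloss u hu)
      _ ≤ _ := setIntegral_le_integral hint (.of_forall fun u => (Real.exp_pos _).le)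
  have hlog := Real.log_le_log (mul_pos hpos (Real.exp_pos _))
    ((mul_le_mul_of_nonneg_right hsub (Real.exp_pos _).le).trans hmass)
  rw [Real.log_mul hpos.ne' (Real.exp_pos _).ne', Real.log_exp] at hlog
  linarith

end Normalizer

/-! ### The in-sample error of the posterior of the main agent -/

section CumSq

variable {H : ℕ} {X A B : Type*} [MeasurableSpace X] [Fintype A] [MeasurableSpace A]
  [Fintype B] [MeasurableSpace B] {F : FunctionClass H X A B} (M : MarkovGame H X A B)
  (I : InducedPolicies F) (h : Fin H) {β η : ℝ} {t : ℕ}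

/-- The sum over the rounds of `ω` of the mean square residuals of `f` under the policies played,
the in-sample error in the decoupling inequality. -/
def cumSq (ω : Fin t → Round F) (f : F.Elems) : ℝ :=
  ∑ s, meanSq M h f (I.maxPolicy (ω s).1.1) (I.minPolicy (ω s).1.1 (ω s).1.2)

/-- The potential `-η ΔL^h(f) + (η / 2) ∑_s E_s [E_h(f)²]` of the link `(f^h, f^{h+1})`, whose
exponential is a supermartingale along the rounds. -/
def linkPotential (η : ℝ) (ω : Fin t → Round F) (f : F.Elems) : ℝ :=
  -η * ∑ s, excessLoss M h f (episodes ω s) + η / 2 * cumSq M I h ω f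

/-- The in-sample error of `f` minus `λ` times its predicted value, which is small on average for a
sample from the posterior of the main agent. -/
def optimisticLoss (η lam : ℝ) (ω : Fin t → Round F) (f : F.Elems) : ℝ :=
  η / 2 * ∑ h, cumSq M I h ω f - lam * maxminValue f 0 M.init

theorem cumSq_nonneg (ω : Fin t → Round F) (f : F.Elems) : 0 ≤ cumSq M I h ω f :=
  Finset.sum_nonneg fun _ _ => integral_nonneg fun _ => sq_nonneg _

theorem two_mul_linkPotential (ω : Fin t → Round F) (f : F.Elems) :
    2 * linkPotential M I h η ω f = linkPotential M I h (2 * η) ω f := by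
  simp only [linkPotential]
  ring

theorem neg_mul_sum_excessLoss_le_linkPotential (hη : 0 ≤ η) (ω : Fin t → Round F)
    (f : F.Elems) :
    -η * ∑ s, excessLoss M h f (episodes ω s) ≤ linkPotential M I h η ω f :=
  le_add_of_nonneg_right (mul_nonneg (by linarith) (cumSq_nonneg M I h ω f))

theorem dependsOn_linkPotential (ω : Fin t → Round F) :
    DependsOn (linkPotential M I h η ω) {j : Fin H | j = h ∨ (j : ℕ) = h + 1} := by
  intro f g hfg
  simp only [linkPotential, cumSq, meanSq, dependsOn_excessLoss M h hfg,
    dependsOn_residual M h hfg]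

variable [MeasurableSingletonClass A] [MeasurableSingletonClass B]

theorem measurable_meanSq :
    Measurable fun p : F.Elems × (F.Elems × F.Elems) =>
      meanSq M h p.1 (I.maxPolicy p.2.1) (I.minPolicy p.2.1 p.2.2) := by
  have hsq : Measurable fun q : (F.Elems × (F.Elems × F.Elems)) × Traj H X A B =>
      residual M h q.1.1 (q.2 h) ^ 2 := by
    have := (measurable_residual M I h).comp (by fun_prop : Measurable
      fun q : (F.Elems × (F.Elems × F.Elems)) × Traj H X A B => (q.1.1, q.2 h))
    exact this.pow_const 2
  exact (StronglyMeasurable.integral_kernel_prod_right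
    (κ := (playKernel M I).comap (Prod.snd : F.Elems × (F.Elems × F.Elems) → _) measurable_snd)
    (f := fun (p : F.Elems × (F.Elems × F.Elems)) ζ => residual M h p.1 (ζ h) ^ 2)
    hsq.stronglyMeasurable).measurable

theorem measurable_meanSq_right (f : F.Elems) :
    Measurable fun p : F.Elems × F.Elems =>
      meanSq M h f (I.maxPolicy p.1) (I.minPolicy p.1 p.2) := by
  have := (measurable_meanSq M I h).comp (measurable_prodMk_left (x := f))
  exact this

theorem measurable_cumSq :
    Measurable fun p : (Fin t → Round F) × F.Elems => cumSq M I h p.1 p.2 := by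
  refine Finset.measurable_fun_sum _ fun s _ => ?_
  have := (measurable_meanSq M I h).comp (by fun_prop : Measurable
    fun p : (Fin t → Round F) × F.Elems => (p.2, (p.1 s).1))
  exact this

theorem measurable_linkPotential :
    Measurable fun p : (Fin t → Round F) × F.Elems => linkPotential M I h η p.1 p.2 := by
  have hloss := (measurable_sum_excessLoss M I h).comp (measurable_episodes_prod t)
  exact (hloss.const_mul _).add ((measurable_cumSq M I h).const_mul _)

theorem measurable_linkPotential_left (f : F.Elems) :
    Measurable fun ω : Fin t → Round F => linkPotential M I h η ω f := by
  have := (measurable_linkPotential M I h (η := η) (t := t)).comp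
    (measurable_prodMk_right (y := f))
  exact this

theorem measurable_linkPotential_right (ω : Fin t → Round F) :
    Measurable (linkPotential M I h η ω) := by
  have := (measurable_linkPotential M I h (η := η)).comp (measurable_prodMk_left (x := ω))
  exact this

theorem measurable_optimisticLoss {lam : ℝ} : Measurable fun p : (Fin t → Round F) × F.Elems =>
    optimisticLoss M I η lam p.1 p.2 := by
  have hV := (measurable_maxminValue I 0).comp (measurable_snd.prodMk measurable_const :
    Measurable fun p : (Fin t → Round F) × F.Elems => (p.2, M.init))
  exact ((Finset.measurable_fun_sum _ fun h _ => measurable_cumSq M I h).const_mul _).sub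
    (hV.const_mul _)

include I in
theorem meanSq_le (hβ : 1 ≤ β) (hF : BoundedBy F β) (f : F.Elems) (μ : Policy H X A)
    (ν : Policy H X B) : meanSq M h f μ ν ≤ β ^ 2 :=
  (integral_mono (integrable_residual_sq M I h hβ hF f μ ν) (integrable_const (β ^ 2))
    fun _ => residual_sq_le M I h hβ hF f _).trans_eq (by simp)

theorem cumSq_le (hβ : 1 ≤ β) (hF : BoundedBy F β) (ω : Fin t → Round F) (f : F.Elems) :
    cumSq M I h ω f ≤ t * β ^ 2 :=
  (Finset.sum_le_sum fun s _ => meanSq_le M I h hβ hF f _ _).trans_eq (by simp)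

theorem abs_linkPotential_le (hβ : 1 ≤ β) (hF : BoundedBy F β) (hη : 0 ≤ η)
    (ω : Fin t → Round F) (f : F.Elems) :
    |linkPotential M I h η ω f| ≤ η * (t * (3 * β ^ 2)) + η / 2 * (t * β ^ 2) := by
  refine (abs_add_le _ _).trans (add_le_add (abs_sum_excessLoss_le M I h hβ hF hη _ f) ?_)
  rw [abs_of_nonneg (mul_nonneg (by linarith) (cumSq_nonneg M I h ω f))]
  exact mul_le_mul_of_nonneg_left (cumSq_le M I h hβ hF ω f) (by linarith)

theorem abs_optimisticLoss_le (hβ : 1 ≤ β) (hF : BoundedBy F β) (hη : 0 ≤ η) {lam : ℝ}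
    (ω : Fin t → Round F) (f : F.Elems) :
    |optimisticLoss M I η lam ω f| ≤ η / 2 * (H * (t * β ^ 2)) + |lam| * (β - 1) := by
  have hV := maxminValue_mem_Icc I hβ hF f 0 M.init
  have hsum : ∑ h, cumSq M I h ω f ≤ H * (t * β ^ 2) :=
    (Finset.sum_le_sum fun h _ => cumSq_le M I h hβ hF ω f).trans_eq (by simp)
  refine (abs_sub _ _).trans (add_le_add ?_ ?_)
  · rw [abs_of_nonneg (mul_nonneg (by linarith) (Finset.sum_nonneg fun h _ =>
      cumSq_nonneg M I h ω f))]
    exact mul_le_mul_of_nonneg_left hsum (by linarith)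
  · rw [abs_mul, abs_of_nonneg hV.1]
    exact mul_le_mul_of_nonneg_left hV.2 (abs_nonneg _)

end CumSq

section Posterior

variable {H : ℕ} {X A B : Type*} [MeasurableSpace X]
  [Fintype A] [MeasurableSpace A] [MeasurableSingletonClass A]
  [Fintype B] [MeasurableSpace B] [MeasurableSingletonClass B]
  {F : FunctionClass H X A B} (M : MarkovGame H X A B) (I : InducedPolicies F)
  (p₀ : (h : Fin H) → Measure (F.Elem h)) [∀ h, IsProbabilityMeasure (p₀ h)]
  {β ε η lam : ℝ} {t : ℕ}

include I in
theorem mainExponent_eq (hβ : 1 ≤ β) (hF : BoundedBy F β) (hη : 0 ≤ η)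
    (S : Fin t → Traj H X A B) (f : F.Elems) :
    posteriorExponent M p₀ η lam maxminValue S f = lam * maxminValue f 0 M.init +
      ∑ h, (-η * ∑ s, excessLoss M h f (S s) - Real.log (normalizer M p₀ η h S f)) := by
  rw [posteriorExponent]
  congr 1
  exact Finset.sum_congr rfl fun h _ => logLikelihood_eq M p₀ h S f
    (normalizer_pos M I p₀ h hβ hF hη S f)

theorem optimisticLoss_le (hβ : 1 ≤ β) (hF : BoundedBy F β) (hη : 0 ≤ η)
    (hκ : kappa M I p₀ ε < ⊤) (ω : Fin t → Round F) (f : F.Elems) :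
    optimisticLoss M I η lam ω f ≤
      ∑ h, linkPotential M I h η ω f - posteriorExponent M p₀ η lam maxminValue (episodes ω) f +
        ((kappa M I p₀ ε).toReal + H * (η * (t * (ε ^ 2 + 2 * ε * β)))) := by
  have hnormalizer := Finset.sum_le_sum fun (h : Fin H) (_ : h ∈ Finset.univ) =>
    log_bellmanBall_sub_le_log_normalizer M I p₀ h hβ hF hη (episodes ω) f
      (bellmanBall_ne_zero M I p₀ hκ h f)
  rw [mainExponent_eq M I p₀ hβ hF hη]
  simp only [optimisticLoss, linkPotential, Finset.sum_add_distrib, Finset.sum_sub_distrib,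
    ← Finset.mul_sum, Finset.sum_const, Finset.card_univ, Fintype.card_fin,
    nsmul_eq_mul] at hnormalizer ⊢
  linarith [neg_kappa_le_sum_log M I p₀ hκ f]

theorem integral_optimisticLoss_le (hβ : 1 ≤ β) (hF : BoundedBy F β) (hη : 0 ≤ η)
    (hκ : kappa M I p₀ ε < ⊤) (ω : Fin t → Round F) :
    ∫ f, optimisticLoss M I η lam ω f ∂(mainPosterior M p₀ η lam (episodes ω)) ≤
      1 / 2 * ∑ h, Real.log (∫ f, Real.exp (2 * linkPotential M I h η ω f) ∂(Measure.pi p₀)) -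
        Real.log (∫ f, Real.exp (posteriorExponent M p₀ η lam maxminValue (episodes ω) f)
          ∂(Measure.pi p₀)) +
        ((kappa M I p₀ ε).toReal + H * (η * (t * (ε ^ 2 + 2 * ε * β)))) := by
  have := isProbabilityMeasure_mainPosterior M I p₀ (lam := lam) hβ hF hη (episodes ω)
  have hlink := fun h => measurable_linkPotential_right M I h (η := η) ω
  have hlinkBound := fun h f => abs_linkPotential_le M I h hβ hF hη ω f
  have hexponent : Measurable (posteriorExponent M p₀ η lam maxminValue (episodes ω)) := by
    have := (measurable_mainExponent M I p₀ (η := η) (lam := lam)).comp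
      (measurable_prodMk_left (x := episodes ω))
    exact this
  have hexponentBound := abs_mainExponent_le M I p₀ (lam := lam) hβ hF hη (episodes ω)
  have hloss : Measurable (optimisticLoss M I η lam ω) := by
    have := (measurable_optimisticLoss M I (η := η) (lam := lam)).comp
      (measurable_prodMk_left (x := ω))
    exact this
  have hint : Integrable (fun f => ∑ h, linkPotential M I h η ω f -
      posteriorExponent M p₀ η lam maxminValue (episodes ω) f)
      (mainPosterior M p₀ η lam (episodes ω)) :=
    (integrable_finsetSum _ fun h _ => integrable_of_abs_le (hlink h) (hlinkBound h)).sub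
      (integrable_of_abs_le hexponent hexponentBound)
  have hchain := integral_tilted_chain_le p₀ (G := fun h => linkPotential M I h η ω) hlink
    (fun h => dependsOn_linkPotential M I h ω) hexponent hlinkBound hexponentBound
  have hmono := integral_mono
    (integrable_of_abs_le hloss (abs_optimisticLoss_le M I hβ hF hη ω))
    (hint.add (integrable_const _)) (optimisticLoss_le M I p₀ hβ hF hη hκ ω)
  simp only [Pi.add_apply] at hmono
  rw [integral_add hint (integrable_const _), integral_const, probReal_univ, one_smul] at hmono
  exact hmono.trans (add_le_add_left hchain _)

include I in
theorem lintegral_exp_excessLoss_add_meanSq_le (hβ : 1 ≤ β) (hF : BoundedBy F β) {θ : ℝ}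
    (hθ₀ : 0 ≤ θ) (hθ : θ * β ^ 2 ≤ 1 / 2) (h : Fin H) (f : F.Elems) (μ : Policy H X A)
    (ν : Policy H X B) :
    ∫⁻ ζ, ENNReal.ofReal (Real.exp (-θ * excessLoss M h f ζ + θ / 2 * meanSq M h f μ ν))
      ∂(episodeLaw M μ ν) ≤ 1 := by
  simp only [Real.exp_add, ENNReal.ofReal_mul (Real.exp_pos _).le]
  rw [lintegral_mul_const _
    ((measurable_excessLoss_right M I h f).const_mul _).exp.ennreal_ofReal]
  refine (mul_le_mul_left (lintegral_exp_excessLoss_le M I h hβ hF hθ₀ hθ f μ ν) _).trans_eq ?_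
  rw [← ENNReal.ofReal_mul (Real.exp_pos _).le, ← Real.exp_add]
  simp

variable [∀ t, IsMarkovKernel (mainKernel M I p₀ η lam t)]
  [∀ t, IsMarkovKernel (boosterKernel M I p₀ η lam t)]

theorem integral_exp_linkPotential_le (hβ : 1 ≤ β) (hF : BoundedBy F β) {θ : ℝ} (hθ₀ : 0 ≤ θ)
    (hθ : θ * β ^ 2 ≤ 1 / 2) (h : Fin H) (f : F.Elems) :
    ∫ ω, Real.exp (linkPotential M I h θ ω f) ∂(recordLaw M I p₀ η lam t) ≤ 1 := by
  let φ : Round F → ℝ≥0∞ := fun w => ENNReal.ofReal (Real.exp (-θ * excessLoss M h f w.2 +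
    θ / 2 * meanSq M h f (I.maxPolicy w.1.1) (I.minPolicy w.1.1 w.1.2)))
  have hφ : Measurable φ :=
    ((((measurable_excessLoss_right M I h f).comp measurable_snd).const_mul (-θ)).add
      (((measurable_meanSq_right M I h f).comp measurable_fst).const_mul
        (θ / 2))).exp.ennreal_ofReal
  have hexp : ∀ ω : Fin t → Round F,
      ENNReal.ofReal (Real.exp (linkPotential M I h θ ω f)) = ∏ s, φ (ω s) := fun ω => by
    rw [← ENNReal.ofReal_prod_of_nonneg fun _ _ => (Real.exp_pos _).le, ← Real.exp_sum,
      Finset.sum_add_distrib, ← Finset.mul_sum, ← Finset.mul_sum]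
    rfl
  rw [integral_eq_lintegral_of_nonneg_ae (.of_forall fun ω => (Real.exp_pos _).le)
    (measurable_linkPotential_left M I h f).exp.aestronglyMeasurable]
  refine ENNReal.toReal_le_of_le_ofReal zero_le_one ?_
  simp only [hexp, ENNReal.ofReal_one]
  exact lintegral_prod_recordLaw_le M I p₀ η lam hφ (fun f' g =>
    lintegral_exp_excessLoss_add_meanSq_le M I hβ hF hθ₀ hθ h f (I.maxPolicy f')
      (I.minPolicy f' g)) t

theorem integral_log_linkPotential_nonpos (hβ : 1 ≤ β) (hF : BoundedBy F β) (hη : 0 ≤ η)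
    (hηβ : 2 * η * β ^ 2 ≤ 1 / 2) (h : Fin H) :
    ∫ ω, Real.log (∫ f, Real.exp (2 * linkPotential M I h η ω f) ∂(Measure.pi p₀))
      ∂(recordLaw M I p₀ η lam t) ≤ 0 := by
  simp only [two_mul_linkPotential]
  exact integral_log_integral_exp_nonpos (measurable_linkPotential M I h)
    (abs_linkPotential_le M I h hβ hF (by linarith))
    (integral_exp_linkPotential_le M I p₀ hβ hF (by linarith) hηβ h)

theorem integral_log_normalizer_nonpos (hβ : 1 ≤ β) (hF : BoundedBy F β) (hη : 0 ≤ η)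
    (hηβ : η * β ^ 2 ≤ 1 / 2) (h : Fin H) (f : F.Elems) :
    ∫ ω, Real.log (normalizer M p₀ η h (episodes ω) f) ∂(recordLaw M I p₀ η lam t) ≤ 0 := by
  have hloss : Measurable fun p : (Fin t → Round F) × F.Elem h =>
      -η * ∑ s, excessLoss M h (Function.update f h p.2) (episodes p.1 s) := by
    have := (measurable_sum_excessLoss_update M I h (t := t)).comp
      ((((measurable_episodes t).comp measurable_fst).prodMk measurable_const).prodMk
        measurable_snd : Measurable fun p : (Fin t → Round F) × F.Elem h =>
          ((episodes p.1, f), p.2))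
    exact this.const_mul (-η)
  have hbound : ∀ (ω : Fin t → Round F) (u : F.Elem h),
      |-η * ∑ s, excessLoss M h (Function.update f h u) (episodes ω s)| ≤
        η * (t * (3 * β ^ 2)) :=
    fun ω u => abs_sum_excessLoss_le M I h hβ hF hη (episodes ω) (Function.update f h u)
  refine integral_log_integral_exp_nonpos hloss hbound fun u => ?_
  have hlossLeft := hloss.comp (measurable_prodMk_right (y := u))
  exact (integral_mono (integrable_exp_of_abs_le _ hlossLeft fun ω => hbound ω u)
    (integrable_exp_of_abs_le _ (measurable_linkPotential_left M I h (Function.update f h u))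
      fun ω => abs_linkPotential_le M I h hβ hF hη ω _) fun ω => Real.exp_le_exp.2
        (neg_mul_sum_excessLoss_le_linkPotential M I h hη ω _)).trans
    (integral_exp_linkPotential_le M I p₀ hβ hF hη hηβ h _)

end Posterior

/-! ### The evidence of the main agent -/

section Evidence

variable {H : ℕ} {X A B : Type*} [MeasurableSpace X]
  [Fintype A] [MeasurableSpace A] [MeasurableSingletonClass A]
  [Fintype B] [MeasurableSpace B] [MeasurableSingletonClass B]
  {F : FunctionClass H X A B} (M : MarkovGame H X A B) (I : InducedPolicies F)
  (p₀ : (h : Fin H) → Measure (F.Elem h)) [∀ h, IsProbabilityMeasure (p₀ h)]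
  {β ε η lam : ℝ} {t : ℕ}

include I in
theorem measurable_mainExponent_episodes :
    Measurable fun p : (Fin t → Round F) × F.Elems =>
      posteriorExponent M p₀ η lam maxminValue (episodes p.1) p.2 := by
  have := (measurable_mainExponent M I p₀ (η := η) (lam := lam)).comp (measurable_episodes_prod t)
  exact this

include I in
theorem measurable_mainExponent_episodes_left (f : F.Elems) :
    Measurable fun ω : Fin t → Round F =>
      posteriorExponent M p₀ η lam maxminValue (episodes ω) f := by
  have := (measurable_mainExponent_episodes M I p₀ (η := η) (lam := lam) (t := t)).comp
    (measurable_prodMk_right (y := f))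
  exact this

include I in
theorem measurable_log_normalizer_episodes (h : Fin H) (f : F.Elems) :
    Measurable fun ω : Fin t → Round F => Real.log (normalizer M p₀ η h (episodes ω) f) := by
  have := (measurable_normalizer M I p₀ h (η := η)).comp
    ((measurable_episodes t).prodMk measurable_const :
      Measurable fun ω : Fin t → Round F => (episodes ω, f))
  exact this.log

include I in
theorem neg_mainExponent_le [Nonempty B] (hβ : 1 ≤ β) (hF : BoundedBy F β) (hη : 0 ≤ η)
    (hlam : 0 ≤ lam) {μs : Policy H X A} {νs : Policy H X B} (hν : IsBestResponse M μs νs)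
    {f : F.Elems} (hf : ∀ h, NearOptimal M ε h f) {S : Fin t → Traj H X A B}
    (hS : ∀ h s, |residual M h f (S s h)| ≤ ε) :
    -posteriorExponent M p₀ η lam maxminValue S f ≤
      H * (η * (t * (ε ^ 2 + 2 * ε * β))) - lam * (initValue M μs νs - H * ε) +
        ∑ h, Real.log (normalizer M p₀ η h S f) := by
  have hloss : ∀ h : Fin H,
      η * ∑ s, excessLoss M h f (S s) ≤ η * (t * (ε ^ 2 + 2 * ε * β)) :=
    fun h => mul_le_mul_of_nonneg_left ((Finset.sum_le_sum fun s _ => (le_abs_self _).trans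
      (abs_excessLoss_le_of_residual M I h hβ hF f _ (hS h s))).trans_eq
        (by rw [Fin.sum_const, nsmul_eq_mul])) hη
  have hlossSum := Finset.sum_le_sum fun (h : Fin H) (_ : h ∈ Finset.univ) => hloss h
  rw [Finset.sum_const, Finset.card_univ, Fintype.card_fin, nsmul_eq_mul] at hlossSum
  have hvalue := mul_le_mul_of_nonneg_left (hν.initValue_le_maxminValue I hβ hF hf) hlam
  rw [mainExponent_eq M I p₀ hβ hF hη]
  simp only [Finset.sum_sub_distrib, neg_mul, Finset.sum_neg_distrib]
  linarith

variable [∀ t, IsMarkovKernel (mainKernel M I p₀ η lam t)]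
  [∀ t, IsMarkovKernel (boosterKernel M I p₀ η lam t)]

theorem NearOptimal.ae_abs_residual_le {h : Fin H} {f : F.Elems} (hf : NearOptimal M ε h f) :
    ∀ᵐ ω ∂(recordLaw M I p₀ η lam t), ∀ s, |residual M h f (episodes ω s h)| ≤ ε := by
  let N : Set X := {x | ∀ a b, |residual M h f (x, a, b)| ≤ ε}
  have hN : MeasurableSet N := by
    simp only [N, Set.ofPred_forall]
    refine MeasurableSet.iInter fun a => MeasurableSet.iInter fun b => ?_
    have hres : Measurable fun x : X => residual M h f (x, a, b) :=
      (measurable_residual_right M I h f).comp (by fun_prop)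
    exact measurableSet_le hres.abs measurable_const
  have hpreimage : MeasurableSet {ζ : Traj H X A B | (ζ h).1 ∈ N} :=
    (by fun_prop : Measurable fun ζ : Traj H X A B => (ζ h).1) hN
  filter_upwards [ae_recordLaw_of_ae_episodeLaw M I p₀ η lam hpreimage
    (fun f' g => ae_episodeLaw_of_reachMeasure M (I.maxPolicy f') (I.minPolicy f' g) h hN hf) t]
    with ω hω s using hω s _ _

theorem integrable_integral_optimisticLoss (hβ : 1 ≤ β) (hF : BoundedBy F β) (hη : 0 ≤ η) :
    Integrable (fun ω : Fin t → Round F => ∫ f, optimisticLoss M I η lam ω f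
      ∂(mainPosterior M p₀ η lam (episodes ω))) (recordLaw M I p₀ η lam t) := by
  have hmeas := StronglyMeasurable.integral_kernel_prod_right
    (κ := (mainKernel M I p₀ η lam t).comap episodes (measurable_episodes t))
    (f := fun ω f => optimisticLoss M I η lam ω f)
    (measurable_optimisticLoss M I).stronglyMeasurable
  refine integrable_of_abs_le hmeas.measurable
    (c := η / 2 * (H * (t * β ^ 2)) + |lam| * (β - 1)) fun ω => ?_
  have := isProbabilityMeasure_mainPosterior M I p₀ (lam := lam) hβ hF hη (episodes ω)
  exact abs_integral_le (P := mainPosterior M p₀ η lam (episodes ω))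
    (abs_optimisticLoss_le M I hβ hF hη ω)

variable [Nonempty B]

theorem integral_neg_mainExponent_le (hβ : 1 ≤ β) (hF : BoundedBy F β) (hη : 0 ≤ η)
    (hlam : 0 ≤ lam) {μs : Policy H X A} {νs : Policy H X B} (hν : IsBestResponse M μs νs)
    (hηβ : η * β ^ 2 ≤ 1 / 2) {f : F.Elems} (hf : ∀ h, NearOptimal M ε h f) :
    ∫ ω, -posteriorExponent M p₀ η lam maxminValue (episodes ω) f
        ∂(recordLaw M I p₀ η lam t) ≤
      H * (η * (t * (ε ^ 2 + 2 * ε * β))) - lam * (initValue M μs νs - H * ε) := by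
  have hlog : ∀ h ∈ Finset.univ, Integrable (fun ω : Fin t → Round F =>
      Real.log (normalizer M p₀ η h (episodes ω) f)) (recordLaw M I p₀ η lam t) := fun h _ =>
    integrable_of_abs_le (measurable_log_normalizer_episodes M I p₀ h f)
      fun ω => abs_log_normalizer_le M I p₀ h hβ hF hη _ f
  have hexponent : Integrable (fun ω : Fin t → Round F =>
      posteriorExponent M p₀ η lam maxminValue (episodes ω) f) (recordLaw M I p₀ η lam t) :=
    integrable_of_abs_le (measurable_mainExponent_episodes_left M I p₀ f)
      fun ω => abs_mainExponent_le M I p₀ hβ hF hη (episodes ω) f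
  have hae : ∀ᵐ ω ∂(recordLaw M I p₀ η lam t),
      -posteriorExponent M p₀ η lam maxminValue (episodes ω) f ≤
        H * (η * (t * (ε ^ 2 + 2 * ε * β))) - lam * (initValue M μs νs - H * ε) +
          ∑ h, Real.log (normalizer M p₀ η h (episodes ω) f) := by
    filter_upwards [ae_all_iff.2 fun h => (hf h).ae_abs_residual_le M I p₀] with ω hω
    exact neg_mainExponent_le M I p₀ hβ hF hη hlam hν hf hω
  have hmono := integral_mono_ae hexponent.neg
    ((integrable_const _).add (integrable_finsetSum _ hlog)) hae
  have hlogNonpos := Finset.sum_nonpos fun (h : Fin H) (_ : h ∈ Finset.univ) =>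
    integral_log_normalizer_nonpos M I p₀ hβ hF hη hηβ h f (lam := lam) (t := t)
  rw [integral_add' (integrable_const _) (integrable_finsetSum _ hlog),
    integral_finsetSum _ hlog, integral_const, probReal_univ, one_smul] at hmono
  exact hmono.trans (by linarith)

/-- The Donsker-Varadhan formula, tested against the comparator `Q` of near optimal functions. -/
theorem integral_neg_log_evidence_le (hβ : 1 ≤ β) (hF : BoundedBy F β) (hη : 0 ≤ η)
    (hlam : 0 ≤ lam) {μs : Policy H X A} {νs : Policy H X B} (hν : IsBestResponse M μs νs)
    (hηβ : η * β ^ 2 ≤ 1 / 2) (hκ : kappa M I p₀ ε < ⊤) :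
    ∫ ω, -Real.log (∫ f, Real.exp (posteriorExponent M p₀ η lam maxminValue (episodes ω) f)
        ∂(Measure.pi p₀)) ∂(recordLaw M I p₀ η lam t) ≤
      (kappa M I p₀ ε).toReal +
        (H * (η * (t * (ε ^ 2 + 2 * ε * β))) - lam * (initValue M μs νs - H * ε)) := by
  obtain ⟨Q, _, hQP, hQ⟩ := exists_comparator M I p₀ hκ
  let W : (Fin t → Round F) → F.Elems → ℝ := fun ω =>
    posteriorExponent M p₀ η lam maxminValue (episodes ω)
  have hW : Measurable fun p : (Fin t → Round F) × F.Elems => W p.1 p.2 :=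
    measurable_mainExponent_episodes M I p₀
  have hWbound : ∀ ω f, |W ω f| ≤ _ := fun ω f =>
    abs_mainExponent_le M I p₀ hβ hF hη (episodes ω) f
  have hint : Integrable (fun p : (Fin t → Round F) × F.Elems => -W p.1 p.2)
      ((recordLaw M I p₀ η lam t).prod Q) :=
    (integrable_of_abs_le hW fun p => hWbound p.1 p.2).neg
  calc ∫ ω, -Real.log (∫ f, Real.exp (W ω f) ∂(Measure.pi p₀)) ∂(recordLaw M I p₀ η lam t)
      ≤ ∫ ω, ((kappa M I p₀ ε).toReal + ∫ f, -W ω f ∂Q) ∂(recordLaw M I p₀ η lam t) :=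
        integral_mono (integrable_log_integral_exp hW hWbound).neg
          ((integrable_const _).add hint.integral_prod_left) fun ω =>
            neg_log_integral_exp_le hQP (hW.of_uncurry_left (x := ω)) (hWbound ω)
    _ = (kappa M I p₀ ε).toReal + ∫ f, ∫ ω, -W ω f ∂(recordLaw M I p₀ η lam t) ∂Q := by
        rw [integral_add (integrable_const _) hint.integral_prod_left,
          integral_integral_swap hint]
        simp
    _ ≤ (kappa M I p₀ ε).toReal + ∫ _f : F.Elems, (H * (η * (t * (ε ^ 2 + 2 * ε * β))) -
          lam * (initValue M μs νs - H * ε)) ∂Q := by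
        refine add_le_add le_rfl
          (integral_mono_ae hint.integral_prod_right (integrable_const _) ?_)
        filter_upwards [hQ] with f hf
        exact integral_neg_mainExponent_le M I p₀ hβ hF hη hlam hν hηβ hf
    _ = _ := by simp

theorem integral_integral_optimisticLoss_le (hβ : 1 ≤ β) (hF : BoundedBy F β) (hη : 0 ≤ η)
    (hlam : 0 ≤ lam) {μs : Policy H X A} {νs : Policy H X B} (hν : IsBestResponse M μs νs)
    (hηβ : 2 * η * β ^ 2 ≤ 1 / 2) (hκ : kappa M I p₀ ε < ⊤) :
    ∫ ω, ∫ f, optimisticLoss M I η lam ω f ∂(mainPosterior M p₀ η lam (episodes ω))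
        ∂(recordLaw M I p₀ η lam t) ≤
      2 * (kappa M I p₀ ε).toReal + 2 * (H * (η * (t * (ε ^ 2 + 2 * ε * β)))) +
        lam * (H * ε) - lam * initValue M μs νs := by
  have hevidence := integrable_log_integral_exp (P := Measure.pi p₀)
    (ρ := recordLaw M I p₀ η lam t)
    (measurable_mainExponent_episodes M I p₀ (η := η) (lam := lam))
    fun ω f => abs_mainExponent_le M I p₀ (lam := lam) hβ hF hη (episodes ω) f
  have hlink := fun h (_ : h ∈ Finset.univ) => integrable_log_integral_exp (P := Measure.pi p₀)
    (ρ := recordLaw M I p₀ η lam t) (W := fun ω f => 2 * linkPotential M I h η ω f)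
    ((measurable_linkPotential M I h).const_mul 2)
    (c := 2 * (η * (t * (3 * β ^ 2)) + η / 2 * (t * β ^ 2))) fun ω f => by
      rw [abs_mul, abs_two]
      exact mul_le_mul_of_nonneg_left (abs_linkPotential_le M I h hβ hF hη ω f) zero_le_two
  have hlinkSum := (integrable_finsetSum Finset.univ hlink).const_mul (1 / 2)
  have hmono := integral_mono (integrable_integral_optimisticLoss M I p₀ hβ hF hη)
    ((hlinkSum.sub hevidence).add (integrable_const _))
    (integral_optimisticLoss_le M I p₀ hβ hF hη hκ)
  rw [integral_add' (hlinkSum.sub hevidence) (integrable_const _),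
    integral_sub' hlinkSum hevidence, integral_const_mul, integral_finsetSum _ hlink,
    integral_const, probReal_univ, one_smul] at hmono
  have hlinkNonpos := Finset.sum_nonpos fun (h : Fin H) (_ : h ∈ Finset.univ) =>
    integral_log_linkPotential_nonpos M I p₀ hβ hF hη hηβ h (lam := lam) (t := t)
  have hevidenceLe := integral_neg_log_evidence_le M I p₀ hβ hF hη hlam hν
    (by nlinarith [mul_nonneg hη (sq_nonneg β)]) hκ (t := t)
  rw [integral_neg] at hevidenceLe
  exact hmono.trans (by linarith)

end Evidence

/-! ### The decoupling inequality -/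

theorem sum_Iio_eq_sum_castLE {α : Type*} [AddCommMonoid α] {n : ℕ} (i : Fin n) (φ : Fin n → α) :
    ∑ j ∈ Finset.Iio i, φ j = ∑ j : Fin i, φ (Fin.castLE i.2.le j) := by
  symm
  refine Finset.sum_nbij (Fin.castLE i.2.le) (fun j _ => Finset.mem_Iio.2 (Fin.lt_def.2 j.2))
    (Fin.castLE_injective _).injOn (fun j hj => ?_) fun _ _ => rfl
  have hji : (j : ℕ) < i := Fin.lt_def.1 (Finset.mem_Iio.1 (Finset.mem_coe.1 hj))
  exact ⟨⟨j, hji⟩, Finset.mem_coe.2 (Finset.mem_univ _), rfl⟩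

section Decoupling

variable {H : ℕ} {X A B : Type*} [MeasurableSpace X] [MeasurableSpace A] [MeasurableSpace B]

theorem decouples_of_abs_le {T : ℕ} (π : Fin T → Measure (Traj H X A B))
    [∀ t, IsProbabilityMeasure (π t)] {e : Fin T → Fin H → X × A × B → ℝ} {c m : ℝ} (hm : 0 < m)
    (he : ∀ t h z, |e t h z| ≤ c) {K : ℤ} (hK : 4 * m * (H * (T * c)) ≤ K) :
    Decouples π e m K := by
  have herror : ∑ h, ∑ t, ∫ ζ, e t h (ζ h) ∂(π t) ≤ H * (T * c) := by
    calc _ ≤ ∑ _h : Fin H, ∑ _t : Fin T, c := Finset.sum_le_sum fun h _ =>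
          Finset.sum_le_sum fun t _ => (le_abs_self _).trans
            (abs_integral_le fun ζ => he t h (ζ h))
      _ = H * (T * c) := by simp
  have hinSample : 0 ≤ ∑ h, ∑ t, ∑ s ∈ Finset.Iio t, ∫ ζ, (e t h (ζ h)) ^ 2 ∂(π s) :=
    Finset.sum_nonneg fun h _ => Finset.sum_nonneg fun t _ => Finset.sum_nonneg fun s _ =>
      integral_nonneg fun ζ => sq_nonneg _
  have hcoeff : H * (T * c) ≤ K / (4 * m) := by
    rw [le_div_iff₀ (by positivity)]
    linarith
  exact herror.trans (hcoeff.trans (le_add_of_nonneg_left (mul_nonneg hm.le hinSample)))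

theorem Decouples.floor_le {T : ℕ} {π : Fin T → Measure (Traj H X A B)}
    {e : Fin T → Fin H → X × A × B → ℝ} {m : ℝ} {K : ℤ} (hm : 0 < m) (h : Decouples π e m K) :
    ⌊4 * m * (∑ h, ∑ t, ∫ ζ, e t h (ζ h) ∂(π t) -
      m * ∑ h, ∑ t, ∑ s ∈ Finset.Iio t, ∫ ζ, (e t h (ζ h)) ^ 2 ∂(π s))⌋ ≤ K := by
  rw [Decouples, ← sub_le_iff_le_add', le_div_iff₀ (by positivity), mul_comm] at h
  exact_mod_cast (Int.floor_le _).trans h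

variable [Fintype A] [Fintype B]
  {F : FunctionClass H X A B} (M : MarkovGame H X A B) (I : InducedPolicies F)
  {β : ℝ} (hβ : 1 ≤ β) (hF : BoundedBy F β) {T : ℕ} {m : ℝ} (hm : 0 < m)

include hβ hF hm

theorem decouples_residual (f g : Fin T → F.Elems) :
    Decouples (fun t => episodeLaw M (I.maxPolicy (f t)) (I.minPolicy (f t) (g t)))
      (fun t h => residual M h (f t)) m (decouplingCoeff M I T m) := by
  -- The infimum defining the coefficient is attained, being over a nonempty set of integers that
  -- is bounded below.
  have hmem : decouplingCoeff M I T m ∈ {K : ℤ | ∀ f g : Fin T → F.Elems,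
      Decouples (fun t => episodeLaw M (I.maxPolicy (f t)) (I.minPolicy (f t) (g t)))
        (fun t h => residualPolicy M (I.maxPolicy (f t)) h (g t)) m K ∧
      Decouples (fun t => episodeLaw M (I.maxPolicy (f t)) (I.minPolicy (f t) (g t)))
        (fun t h => residual M h (f t)) m K} := by
    refine Int.csInf_mem ⟨⌈4 * m * (H * (T * β))⌉, fun f g => ⟨?booster, ?main⟩⟩
      ⟨_, fun K hK => (hK f g).2.floor_le hm⟩
    case booster =>
      exact decouples_of_abs_le _ hm
        (fun t h z => abs_residualPolicy_le M I h hβ hF (f t) (g t) z) (Int.le_ceil _)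
    case main =>
      exact decouples_of_abs_le _ hm (fun t h z => abs_residual_le M I h hβ hF (f t) z)
        (Int.le_ceil _)
  exact (hmem f g).2

variable [MeasurableSingletonClass A] [MeasurableSingletonClass B]

theorem sum_maxminValue_sub_initValue_le {D : ℝ} (hD : (decouplingCoeff M I T m : ℝ) ≤ D)
    (ω : Fin T → Round F) :
    ∑ t, (maxminValue (ω t).1.1 0 M.init - initValue M (I.maxPolicy (ω t).1.1)
        (I.minPolicy (ω t).1.1 (ω t).1.2)) ≤
      m * ∑ t, ∑ h, cumSq M I h (fun s => ω (Fin.castLE t.2.le s)) (ω t).1.1 + D / (4 * m) := by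
  have hdecouples := decouples_residual M I hβ hF hm (fun t => (ω t).1.1) (fun t => (ω t).1.2)
  have hcoeff : (decouplingCoeff M I T m : ℝ) / (4 * m) ≤ D / (4 * m) := by gcongr
  have hvalue := Finset.sum_le_sum fun (t : Fin T) (_ : t ∈ Finset.univ) =>
    maxminValue_sub_initValue_le M I hβ hF (ω t).1.1 (I.minPolicy (ω t).1.1 (ω t).1.2)
  rw [Finset.sum_comm] at hvalue
  have hinSample : ∑ h, ∑ t, ∑ s ∈ Finset.Iio t, ∫ ζ, (residual M h (ω t).1.1 (ζ h)) ^ 2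
      ∂(episodeLaw M (I.maxPolicy (ω s).1.1) (I.minPolicy (ω s).1.1 (ω s).1.2)) =
      ∑ t, ∑ h, cumSq M I h (fun s => ω (Fin.castLE t.2.le s)) (ω t).1.1 := by
    rw [Finset.sum_comm]
    refine Finset.sum_congr rfl fun t _ => Finset.sum_congr rfl fun h _ => ?_
    rw [sum_Iio_eq_sum_castLE]
    rfl
  rw [Decouples, hinSample] at hdecouples
  exact hvalue.trans (hdecouples.trans (add_le_add_right hcoeff _))

end Decoupling

/-! ### The regret as an integral over the joint law of all rounds -/

theorem abs_initValue_sub_le {H : ℕ} {X A B : Type*} [MeasurableSpace X] [MeasurableSpace A]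
    [MeasurableSpace B] [Fintype A] [Fintype B] (M : MarkovGame H X A B)
    (μ μ' : Policy H X A) (ν ν' : Policy H X B) :
    |initValue M μ ν - initValue M μ' ν'| ≤ H :=
  abs_sub_le_of_nonneg_of_le (initValue_nonneg M μ ν) (initValue_le M μ ν)
    (initValue_nonneg M μ' ν') (initValue_le M μ' ν')

section Regret

variable {H : ℕ} {X A B : Type*} [MeasurableSpace X]
  [Fintype A] [MeasurableSpace A] [MeasurableSingletonClass A]
  [Fintype B] [MeasurableSpace B] [MeasurableSingletonClass B]
  {F : FunctionClass H X A B} (M : MarkovGame H X A B) (I : InducedPolicies F)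
  (p₀ : (h : Fin H) → Measure (F.Elem h)) [∀ h, IsProbabilityMeasure (p₀ h)]
  {β ε η lam : ℝ} (μs : Policy H X A) (νs : Policy H X B) {T : ℕ}

theorem measurable_initValue : Measurable fun p : F.Elems × F.Elems =>
    initValue M (I.maxPolicy p.1) (I.minPolicy p.1 p.2) := by
  have hreward : Measurable fun q : (F.Elems × F.Elems) × Traj H X A B =>
      totalReward M H 0 (by omega) q.2 :=
    (measurable_cumulative (measurable_stepReward M) H 0 (by omega)).comp measurable_snd
  exact (StronglyMeasurable.integral_kernel_prod_right (κ := playKernel M I)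
    (f := fun (_ : F.Elems × F.Elems) ζ => totalReward M H 0 (by omega) ζ)
    hreward.stronglyMeasurable).measurable

theorem stronglyMeasurable_integral_posterior {t : ℕ} {φ : F.Elems × F.Elems → ℝ}
    (hφ : Measurable φ) [IsMarkovKernel (mainKernel M I p₀ η lam t)]
    [IsMarkovKernel (boosterKernel M I p₀ η lam t)] :
    StronglyMeasurable fun S : Fin t → Traj H X A B =>
      ∫ f, ∫ g, φ (f, g) ∂(boosterPosterior M p₀ η lam (I.maxPolicy f) S)
        ∂(mainPosterior M p₀ η lam S) := by
  have huncurried : Measurable fun q : ((Fin t → Traj H X A B) × F.Elems) × F.Elems =>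
      φ (q.1.2, q.2) := hφ.comp (by fun_prop)
  have hbooster := StronglyMeasurable.integral_kernel_prod_right
    (κ := boosterKernel M I p₀ η lam t)
    (f := fun (q : (Fin t → Traj H X A B) × F.Elems) g => φ (q.2, g))
    huncurried.stronglyMeasurable
  exact StronglyMeasurable.integral_kernel_prod_right (κ := mainKernel M I p₀ η lam t)
    (f := fun S f => ∫ g, φ (f, g) ∂(boosterKernel M I p₀ η lam t (S, f))) hbooster

section MarkovKernels

variable [∀ t, IsMarkovKernel (mainKernel M I p₀ η lam t)]
  [∀ t, IsMarkovKernel (boosterKernel M I p₀ η lam t)]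

theorem integrable_initValue_sub (t : Fin T) :
    Integrable (fun ω : Fin T → Round F => initValue M μs νs - initValue M
      (I.maxPolicy (ω t).1.1) (I.minPolicy (ω t).1.1 (ω t).1.2)) (recordLaw M I p₀ η lam T) := by
  have hvalue := (measurable_initValue M I).comp
    (by fun_prop : Measurable fun ω : Fin T → Round F => (ω t).1)
  exact integrable_of_abs_le (hvalue.const_sub _) fun ω => abs_initValue_sub_le M μs _ νs _

theorem mainRegret_eq :
    mainRegret M I p₀ η lam μs νs T =
      ∑ t : Fin T, ∫ ω, (initValue M μs νs - initValue M (I.maxPolicy (ω t).1.1)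
        (I.minPolicy (ω t).1.1 (ω t).1.2)) ∂(recordLaw M I p₀ η lam T) := by
  let φ : F.Elems × F.Elems → ℝ := fun p =>
    initValue M μs νs - initValue M (I.maxPolicy p.1) (I.minPolicy p.1 p.2)
  have hφ : Measurable φ := (measurable_initValue M I).const_sub _
  rw [mainRegret, Finset.sum_range]
  refine Finset.sum_congr rfl fun t _ => ?_
  have hround := integral_recordLaw M I p₀ η lam t.2 (φ := fun _ => φ) (hφ.comp measurable_snd)
    fun _ p => abs_initValue_sub_le M μs _ νs _
  rw [← map_episodes_recordLaw M I p₀ η lam t,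
    integral_map (measurable_episodes _).aemeasurable
      (stronglyMeasurable_integral_posterior M I p₀ hφ).aestronglyMeasurable]
  exact hround.symm

end MarkovKernels

/-! ### The regret bound -/

theorem mainRegret_le_of_initValue_le (hβ : 1 ≤ β) (hF : BoundedBy F β) (hη : 0 ≤ η) {c : ℝ}
    (hc : initValue M μs νs ≤ c) : mainRegret M I p₀ η lam μs νs T ≤ T * c := by
  have := isMarkovKernel_mainKernel M I p₀ lam hβ hF hη
  have := isMarkovKernel_boosterKernel M I p₀ lam hβ hF hη
  rw [mainRegret_eq M I p₀]
  calc _ ≤ ∑ _t : Fin T, ∫ _ω, c ∂(recordLaw M I p₀ η lam T) :=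
        Finset.sum_le_sum fun t _ => integral_mono (integrable_initValue_sub M I p₀ μs νs t)
          (integrable_const c) fun ω => (sub_le_self _ (initValue_nonneg M _ _)).trans hc
    _ = T * c := by simp

theorem measurable_optimisticLoss_round (t : Fin T) : Measurable fun ω : Fin T → Round F =>
    optimisticLoss M I η lam (fun s : Fin t => ω (Fin.castLE t.2.le s)) (ω t).1.1 := by
  have := (measurable_optimisticLoss M I (η := η) (lam := lam)).comp
    ((measurable_pi_lambda _ fun s => measurable_pi_apply _).prodMk (by fun_prop) :
      Measurable fun ω : Fin T → Round F =>
        ((fun s : Fin t => ω (Fin.castLE t.2.le s)), (ω t).1.1))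
  exact this

variable {μs νs}

theorem integral_optimisticLoss_round_le [Nonempty B] (hβ : 1 ≤ β) (hF : BoundedBy F β)
    (hη : 0 ≤ η) (hlam : 0 ≤ lam) (hν : IsBestResponse M μs νs) (hηβ : 2 * η * β ^ 2 ≤ 1 / 2)
    (hε : 0 ≤ ε) (hκ : kappa M I p₀ ε < ⊤) (t : Fin T) :
    ∫ ω, optimisticLoss M I η lam (fun s : Fin t => ω (Fin.castLE t.2.le s)) (ω t).1.1
        ∂(recordLaw M I p₀ η lam T) ≤
      2 * (kappa M I p₀ ε).toReal + 2 * (H * (η * (T * (ε ^ 2 + 2 * ε * β)))) +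
        lam * (H * ε) - lam * initValue M μs νs := by
  have := isMarkovKernel_mainKernel M I p₀ lam hβ hF hη
  have := isMarkovKernel_boosterKernel M I p₀ lam hβ hF hη
  have hmeas : Measurable fun p : (Fin t → Round F) × (F.Elems × F.Elems) =>
      optimisticLoss M I η lam p.1 p.2.1 := by
    have := (measurable_optimisticLoss M I (η := η) (lam := lam)).comp (by fun_prop : Measurable
      fun p : (Fin t → Round F) × (F.Elems × F.Elems) => (p.1, p.2.1))
    exact this
  have hround := integral_recordLaw M I p₀ η lam t.2 hmeas
    fun ω p => abs_optimisticLoss_le M I hβ hF hη ω p.1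
  have := fun (ω : Fin t → Round F) f =>
    isProbabilityMeasure_boosterPosterior M I p₀ (lam := lam) hβ hF hη (episodes ω) f
  simp only [integral_const, probReal_univ, one_smul] at hround
  refine hround.le.trans
    ((integral_integral_optimisticLoss_le M I p₀ hβ hF hη hlam hν hηβ hκ).trans ?_)
  have htT : ((t : ℕ) : ℝ) ≤ T := by exact_mod_cast t.2.le
  have := zero_le_one.trans hβ
  gcongr

theorem mul_sum_initValue_sub_le (hβ : 1 ≤ β) (hF : BoundedBy F β)
    (hη : 0 < η) (hlam : 0 < lam) {D : ℝ}
    (hD : (decouplingCoeff M I T (η / (2 * lam)) : ℝ) ≤ D) (ω : Fin T → Round F) :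
    lam * ∑ t, (initValue M μs νs - initValue M (I.maxPolicy (ω t).1.1)
        (I.minPolicy (ω t).1.1 (ω t).1.2)) ≤
      ∑ t : Fin T, optimisticLoss M I η lam (fun s => ω (Fin.castLE t.2.le s)) (ω t).1.1 +
        (T * (lam * initValue M μs νs) + D * lam ^ 2 / (2 * η)) := by
  have hoptimism := mul_le_mul_of_nonneg_left
    (sum_maxminValue_sub_initValue_le M I hβ hF (by positivity) hD ω) hlam.le
  have hcoeff : lam * (D / (4 * (η / (2 * lam)))) = D * lam ^ 2 / (2 * η) := by
    field_simp
    ring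
  have hscale : ∀ c : ℝ, lam * (η / (2 * lam) * c) = η / 2 * c := fun c => by field_simp
  rw [mul_add, hcoeff, hscale] at hoptimism
  simp only [optimisticLoss, Finset.sum_sub_distrib, ← Finset.mul_sum, mul_sub, Finset.sum_const,
    Finset.card_univ, Fintype.card_fin, nsmul_eq_mul] at hoptimism ⊢
  linarith

theorem mainRegret_le [Nonempty B] (hβ : 1 ≤ β) (hF : BoundedBy F β) (hη : 0 < η)
    (hlam : 0 < lam) (hν : IsBestResponse M μs νs) (hηβ : 2 * η * β ^ 2 ≤ 1 / 2) (hε : 0 ≤ ε)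
    (hκ : kappa M I p₀ ε < ⊤) {D : ℝ} (hD : (decouplingCoeff M I T (η / (2 * lam)) : ℝ) ≤ D) :
    mainRegret M I p₀ η lam μs νs T ≤
      T * (2 * (kappa M I p₀ ε).toReal + 2 * (H * (η * (T * (ε ^ 2 + 2 * ε * β)))) +
        lam * (H * ε)) / lam + D * lam / (2 * η) := by
  have := isMarkovKernel_mainKernel M I p₀ lam hβ hF hη.le
  have := isMarkovKernel_boosterKernel M I p₀ lam hβ hF hη.le
  have hvalue := fun t (_ : t ∈ Finset.univ) =>
    integrable_initValue_sub M I p₀ μs νs t (η := η) (lam := lam) (T := T)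
  have hloss := fun t (_ : t ∈ Finset.univ) => integrable_of_abs_le (P := recordLaw M I p₀ η lam T)
    (measurable_optimisticLoss_round M I t (η := η) (lam := lam))
    fun ω => abs_optimisticLoss_le M I hβ hF hη.le (lam := lam) _ _
  have hmono := integral_mono ((integrable_finsetSum _ hvalue).const_mul lam)
    ((integrable_finsetSum _ hloss).add (integrable_const _))
    (mul_sum_initValue_sub_le M I hβ hF hη hlam hD)
  rw [integral_const_mul, integral_finsetSum _ hvalue,
    integral_add' (integrable_finsetSum _ hloss) (integrable_const _),
    integral_finsetSum _ hloss, ← mainRegret_eq M I p₀, integral_const, probReal_univ,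
    one_smul] at hmono
  have hlossSum := Finset.sum_le_sum fun (t : Fin T) (_ : t ∈ Finset.univ) =>
    integral_optimisticLoss_round_le M I p₀ hβ hF hη.le hlam.le hν hηβ hε hκ t
  rw [Finset.sum_const, Finset.card_univ, Fintype.card_fin, nsmul_eq_mul] at hlossSum
  have hdiv : D * lam / (2 * η) = D * lam ^ 2 / (2 * η) / lam := by field_simp
  rw [hdiv, ← add_div, le_div_iff₀ hlam, mul_comm]
  linarith

end Regret

/-! ### Tuning the parameters -/

section Tuning

variable {β D κ lam T H : ℝ}

theorem tuned_mul_eq_sqrt (hβ : 0 < β) (hD : 0 < D) (hT : 0 ≤ T) (hκ : 0 ≤ κ) :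
    √(T * κ / (β ^ 2 * D)) * (β * D) = √(D * κ * T) := by
  rw [← Real.sqrt_sq (by positivity : 0 ≤ β * D), ← Real.sqrt_mul (by positivity)]
  congr 1
  field_simp

theorem mul_div_eq_mul_sqrt (hD : 0 < D) (hT : 0 ≤ T) (hκ : 0 ≤ κ) (hlam : 0 < lam)
    (hs : lam * (β * D) = √(D * κ * T)) : T * κ / lam = β * √(D * κ * T) := by
  have hsq : (lam * (β * D)) ^ 2 = D * κ * T := by rw [hs, Real.sq_sqrt (by positivity)]
  rw [div_eq_iff hlam.ne', ← hs]
  exact mul_left_cancel₀ hD.ne' (by linarith)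

theorem tuned_bound_le (hβ : 0 < β) (hD : 0 < D) (hT : 1 ≤ T) (hκ : 0 ≤ κ) (hH : 0 ≤ H)
    (hlam : 0 < lam) (hs : lam * (β * D) = √(D * κ * T)) :
    T * (2 * κ + 2 * (H * (1 / (4 * β ^ 2) * (T * ((β / T ^ 2) ^ 2 + 2 * (β / T ^ 2) * β)))) +
        lam * (H * (β / T ^ 2))) / lam + D * lam / (2 * (1 / (4 * β ^ 2))) ≤
      4 * (β * √(D * κ * T)) + 3 / 2 * (H / lam) + H * β / T := by
  have hT₀ : 0 < T := by linarith
  have hdecoupling : D * lam / (2 * (1 / (4 * β ^ 2))) = 2 * (β * √(D * κ * T)) := by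
    rw [← hs]
    field_simp
    ring
  have hexpand : T * (2 * κ + 2 * (H * (1 / (4 * β ^ 2) * (T * ((β / T ^ 2) ^ 2 +
      2 * (β / T ^ 2) * β)))) + lam * (H * (β / T ^ 2))) / lam =
      2 * (T * κ / lam) + (1 / 2 * (1 / T ^ 2) + 1) * (H / lam) + H * β / T := by
    field_simp
    ring
  have hcoeff : (1 / 2 * (1 / T ^ 2) + 1) * (H / lam) ≤ 3 / 2 * (H / lam) := by
    have := (div_le_one (by positivity)).2 (one_le_pow₀ hT : (1 : ℝ) ≤ T ^ 2)
    exact mul_le_mul_of_nonneg_right (by linarith) (by positivity)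
  rw [hdecoupling, hexpand, mul_div_eq_mul_sqrt hD hT₀.le hκ hlam hs]
  linarith

theorem tuned_bound_le_of_one_le {s : ℝ} (hβ : 0 ≤ β) (hD : 1 ≤ D) (hT : 1 ≤ T) (hH : 0 ≤ H)
    (hlam : 0 < lam) (hlamβ : 1 ≤ lam * β ^ 2) (hs : 0 ≤ s) :
    4 * (β * s) + 3 / 2 * (H / lam) + H * β / T ≤
      (4 + 2 * H * β ^ 2 + H * β) * (β * s + D) := by
  have hdivlam : H / lam ≤ H * β ^ 2 := by
    rw [div_le_iff₀ hlam]
    linarith [mul_le_mul_of_nonneg_left hlamβ hH]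
  have hdivT : H * β / T ≤ H * β := div_le_self (by positivity) hT
  have hscale : 0 ≤ 2 * H * β ^ 2 + H * β := by positivity
  linarith [mul_nonneg hscale (mul_nonneg hβ hs), mul_le_mul_of_nonneg_left hD hscale,
    mul_nonneg hH (sq_nonneg β)]

theorem tuned_bound_le_of_le (hβ : 0 ≤ β) (hD : 0 ≤ D) (hT : 0 < T) (hκ : 0 ≤ κ)
    (hlam : 0 < lam) (hTκ : T * κ / lam = β * √(D * κ * T)) (hH : H ≤ T * κ)
    (hκD : κ ≤ D * T) :
    4 * (β * √(D * κ * T)) + 3 / 2 * (H / lam) + H * β / T ≤ 7 * (β * √(D * κ * T) + D) := by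
  have hdivlam : H / lam ≤ β * √(D * κ * T) := by
    rw [← hTκ]
    gcongr
  have hdivT : H * β / T ≤ β * κ := by
    rw [div_le_iff₀ hT]
    linarith [mul_le_mul_of_nonneg_right hH hβ]
  have hκ_sqrt : κ ≤ √(D * κ * T) :=
    Real.le_sqrt_of_sq_le (by linarith [mul_le_mul_of_nonneg_left hκD hκ])
  have := mul_le_mul_of_nonneg_left hκ_sqrt hβ
  have : 0 ≤ β * √(D * κ * T) := by positivity
  linarith

theorem mul_sub_one_le_of_le (hβ : 0 ≤ β) (hD : 1 ≤ D) (hT : 0 ≤ T) (hκD : D * T ≤ κ) :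
    T * (β - 1) ≤ β * √(D * κ * T) := by
  have hT_le : T ≤ D * κ :=
    calc T ≤ D * T := le_mul_of_one_le_left hT hD
      _ ≤ κ := hκD
      _ ≤ D * κ := le_mul_of_one_le_left ((by positivity : 0 ≤ D * T).trans hκD) hD
  have hT_sqrt : T ≤ √(D * κ * T) :=
    Real.le_sqrt_of_sq_le ((sq T).trans_le (mul_le_mul_of_nonneg_right hT_le hT))
  linarith [mul_le_mul_of_nonneg_left hT_sqrt hβ]

end Tuning

theorem mainRegret_tuned_le {H : ℕ} {X A B : Type*} [MeasurableSpace X]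
    [Fintype A] [MeasurableSpace A] [MeasurableSingletonClass A]
    [Fintype B] [Nonempty B] [MeasurableSpace B] [MeasurableSingletonClass B]
    (M : MarkovGame H X A B) {F : FunctionClass H X A B} (I : InducedPolicies F)
    (p₀ : (h : Fin H) → Measure (F.Elem h)) [∀ h, IsProbabilityMeasure (p₀ h)]
    {μs : Policy H X A} {νs : Policy H X B} (hν : IsBestResponse M μs νs)
    {β D lam κ : ℝ} {T : ℕ} (hβ : 1 ≤ β) (hF : BoundedBy F β) (hT : 0 < T)
    (hfin : kappa M I p₀ (β / T ^ 2) < ⊤) (hκ : κ = (kappa M I p₀ (β / T ^ 2)).toReal)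
    (hκ₀ : 0 ≤ κ) (hD : 0 < D) (hlam : 0 < lam) (hs : lam * (β * D) = √(D * κ * T))
    (hcoeff : (decouplingCoeff M I T (1 / (4 * β ^ 2) / (2 * lam)) : ℝ) ≤ D) :
    mainRegret M I p₀ (1 / (4 * β ^ 2)) lam μs νs T ≤
      4 * (β * √(D * κ * T)) + 3 / 2 * (H / lam) + H * β / T := by
  have hβ₀ : 0 < β := by linarith
  have hηβ : 2 * (1 / (4 * β ^ 2)) * β ^ 2 ≤ 1 / 2 := by
    field_simp
    norm_num
  refine (mainRegret_le M I p₀ hβ hF (by positivity) hlam hν hηβ (by positivity) hfin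
    hcoeff).trans ?_
  rw [← hκ]
  exact tuned_bound_le hβ₀ hD (Nat.one_le_cast.2 hT) hκ₀ H.cast_nonneg hlam hs

end SelfPlay

end

theorem theorem2_general {H : ℕ} {X A B : Type*} [MeasurableSpace X]
    [Fintype A] [MeasurableSpace A] [MeasurableSingletonClass A]
    [Fintype B] [Nonempty B] [MeasurableSpace B] [MeasurableSingletonClass B]
    (M : MarkovGame H X A B) {F : FunctionClass H X A B} (I : InducedPolicies F)
    (p₀ : (h : Fin H) → Measure (F.Elem h)) [∀ h, IsProbabilityMeasure (p₀ h)]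
    {μs : Policy H X A} {νs : Policy H X B} (hν : IsBestResponse M μs νs)
    (hQ : ∀ h, qValue M μs νs h ∈ F.carrier h) {β : ℝ} (hβ : 1 ≤ β) (hF : BoundedBy F β) {T : ℕ}
    (hfin : kappa M I p₀ (β / (T : ℝ) ^ 2) < ⊤) {D : ℝ} (hD₁ : 1 ≤ D)
    (hD : ∀ m : ℝ, 0 < m → m ≤ 1 → (decouplingCoeff M I T m : ℝ) ≤ D)
    {κ : ℝ} (hκ : κ = (kappa M I p₀ (β / (T : ℝ) ^ 2)).toReal)
    {η lam : ℝ} (hη : η = 1 / (4 * β ^ 2)) (hlam : lam = √(T * κ / (β ^ 2 * D)))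
    (hlamβ : 1 ≤ lam * β ^ 2) :
    mainRegret M I p₀ η lam μs νs T ≤
        (4 + 2 * H * β ^ 2 + H * β) * (β * √(D * κ * T) + D) ∧
      ((H : ℝ) ≤ T * κ → mainRegret M I p₀ η lam μs νs T ≤ 7 * (β * √(D * κ * T) + D)) := by
  have hβ₀ : 0 < β := by linarith
  have hD₀ : 0 < D := by linarith
  have hlam₀ : 0 < lam := pos_of_mul_pos_left (by linarith) (sq_nonneg β)
  have hT : 0 < T := T.pos_of_ne_zero fun h => by simp [hlam, h] at hlam₀
  have hratio : 0 < T * κ / (β ^ 2 * D) := Real.sqrt_pos.1 (hlam ▸ hlam₀)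
  have hκ₀ : 0 ≤ κ := (pos_of_mul_pos_right ((div_pos_iff_of_pos_right (by positivity)).1 hratio)
    T.cast_nonneg).le
  have hT₁ : (1 : ℝ) ≤ T := Nat.one_le_cast.2 hT
  have hs : lam * (β * D) = √(D * κ * T) := hlam ▸ tuned_mul_eq_sqrt hβ₀ hD₀ T.cast_nonneg hκ₀
  have hm : 1 / (4 * β ^ 2) / (2 * lam) ≤ 1 := by
    rw [div_div, div_le_one (by positivity)]
    linarith
  have hregret := mainRegret_tuned_le M I p₀ hν hβ hF hT hfin hκ hκ₀ hD₀ hlam₀ hs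
    (hD _ (by positivity) hm)
  rw [hη]
  refine ⟨hregret.trans (tuned_bound_le_of_one_le hβ₀.le hD₁ hT₁ H.cast_nonneg hlam₀ hlamβ
    (Real.sqrt_nonneg _)), fun hH => ?_⟩
  rcases le_total κ (D * T) with hκD | hκD
  · exact hregret.trans (tuned_bound_le_of_le hβ₀.le hD₀.le (by linarith) hκ₀ hlam₀
      (mul_div_eq_mul_sqrt hD₀ T.cast_nonneg hκ₀ hlam₀ hs) hH hκD)
  · have hvalue := mainRegret_le_of_initValue_le M I p₀ μs νs hβ hF (η := 1 / (4 * β ^ 2))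
      (lam := lam) (T := T) (by positivity) (initValue_le_of_qValue_mem hQ hβ hF)
    have := mul_sub_one_le_of_le hβ₀.le hD₁ T.cast_nonneg hκD
    linarith [mul_nonneg hβ₀.le (Real.sqrt_nonneg (D * κ * T))]

theorem theorem2 :
    ∃ (C : ℝ) (C' : ℕ → ℝ → ℝ), ∀ (H : ℕ) (X A B : Type*)
      [MeasurableSpace X]
      [Fintype A] [Nonempty A] [MeasurableSpace A] [MeasurableSingletonClass A]
      [Fintype B] [Nonempty B] [MeasurableSpace B] [MeasurableSingletonClass B]
      (M : MarkovGame H X A B) (F : FunctionClass H X A B) (I : InducedPolicies F)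
      (p₀ : (h : Fin H) → Measure (F.Elem h)) (_ : ∀ h, IsProbabilityMeasure (p₀ h))
      (μs : Policy H X A) (νs : Policy H X B) (_ : IsNash M μs νs)
      (_ : Realizable M I μs νs) (_ : Complete M I)
      (β : ℝ) (_ : 1 < β) (_ : BoundedBy F β)
      (T : ℕ) (_ : 0 < T)
      (_ : kappa M I p₀ (β / (T : ℝ) ^ 2) < ⊤)
      (D : ℝ) (_ : 1 ≤ D)
      (_ : ∀ m : ℝ, 0 < m → m ≤ 1 → (decouplingCoeff M I T m : ℝ) ≤ D)
      (κ : ℝ) (_ : κ = (kappa M I p₀ (β / (T : ℝ) ^ 2)).toReal)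
      (η lam : ℝ) (_ : η = 1 / (4 * β ^ 2)) (_ : lam = √(T * κ / (β ^ 2 * D)))
      (_ : η * β ^ 2 ≤ 0.5) (_ : 1 ≤ lam * β ^ 2),
      mainRegret M I p₀ η lam μs νs T ≤ C' H β * (β * √(D * κ * T) + D) ∧
      ((H : ℝ) ≤ T * κ →
        mainRegret M I p₀ η lam μs νs T ≤ C * (β * √(D * κ * T) + D)) := by
  refine ⟨7, fun H β => 4 + 2 * H * β ^ 2 + H * β, ?_⟩
  intro _ _ _ _ _ _ _ _ _ _ _ _ _ M _ I p₀ _ _ _ hN hR _ _ hβ hF _ _ hfin _ hD₁ hD _ hκ _ _ hη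
    hlam _ hlamβ
  exact theorem2_general M I p₀ (fun h x => (hN h x).2) hR.1 hβ.le hF hfin hD₁ hD hκ hη hlam hlamβ
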